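/- Let $\bar M$ be a compact manifold with boundary $\partial M$, of dimension $m$, with interior $M$, let $g$ be a smooth Riemannian metric on $M$ that is asymptotically hyperbolic, and let $x$ be a special boundary defining function, so that a neighbourhood of the boundary is identified with $\partial M\times[0,\varepsilon)$ and there $$\bar g := x^2 g = dx^2+G_x ,$$ with $G_x$, $0<x<\varepsilon$, a family of metrics on $\partial M$. Let $n\ge 1$ and assume that $\bar g$ has a polyhomogeneous expansion $$\bar g \sim dx^2+\bar g^{(0)}+x\bar g^{(1)}+\dots+x^{n-1}\bar g^{(n-1)}+x^n\bar g^{(n)}+x^n(\log x)\,\bar g^{(n,1)}+\cdots ,\qquad x\to 0^+,$$ where $\bar g^{(0)}$ is a Riemannian metric on $\partial M$, the coefficients are smooth symmetric 2-tensors on $\partial M$, the remaining terms are of the form $x^k(\log x)^p\,\bar g^{(k,p)}$ with integers $k>n$ and finitely many $p\ge 0$ for each $k$, and the expansion may be differentiated term by term. Let $P$ be a full contraction of the curvature of $g$ and its covariant derivatives (or a finite linear combination of such contractions). Then: 1. $P$ has an expansion of the same form, $$P \sim P^{(0)}+xP^{(1)}+\dots+x^{n-1}P^{(n-1)}+x^nP^{(n)}+x^n(\log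 x)\,P^{(n,1)}+\cdots ,$$ with smooth functions on $\partial M$ as coefficients. 2. $P^{(n)}$ and $P^{(n,1)}$ depend on $\bar g^{(n)}$ and $\bar g^{(n,1)}$ only through their traces with respect to $\bar g^{(0)}$. That is: let $g$ and $g'$ be two such metrics, possibly on different manifolds of the same dimension $m$ with the same boundary, with coefficients $\bar g^{(k)},\bar g^{(n,1)}$ and $\bar g'^{(k)},\bar g'^{(n,1)}$, and let $P$ and $P'$ be the same contraction evaluated on $g$ and on $g'$. If $q\in\partial M$, if $\bar g^{(k)}=\bar g'^{(k)}$ near $q$ for all $k<n$, and if at $q$ $$\operatorname{tr}_{\bar g^{(0)}}\bar g^{(n)}=\operatorname{tr}_{\bar g^{(0)}}\bar g'^{(n)},\qquad \operatorname{tr}_{\bar g^{(0)}}\bar g^{(n,1)}=\operatorname{tr}_{\bar g^{(0)}}\bar g'^{(n,1)},$$ then $P^{(n)}(q)=P'^{(n)}(q)$ and $P^{(n,1)}(q)=P'^{(n,1)}(q)$. -/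

import Mathlib

open scoped Manifold ContDiff Topology

noncomputable section

namespace AH

/-! ### Curvature in coordinates -/

/-- The partial derivative `∂_s f` at `u`, in `ℝᵐ`. -/
def pd {m : ℕ} (s : Fin m) (f : EuclideanSpace ℝ (Fin m) → ℝ) (u : EuclideanSpace ℝ (Fin m)) : ℝ :=
  fderiv ℝ f u (EuclideanSpace.single s 1)

/-- The matrix of components `g_{st}` of a metric, as a function of the coordinates. -/
abbrev MetricComponents (m : ℕ) : Type := EuclideanSpace ℝ (Fin m) → Matrix (Fin m) (Fin m) ℝ

/-- The components `T_{I₀ ⋯ I_{k-1}}` of a covariant `k`-tensor, as functions of the coordinates. -/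
abbrev TensorComponents (m k : ℕ) : Type := (Fin k → Fin m) → EuclideanSpace ℝ (Fin m) → ℝ

/-- `Γ^k_{ij} = ½ g^{kl} (∂_i g_{jl} + ∂_j g_{il} - ∂_l g_{ij})`. -/
def christoffel {m : ℕ} (g : MetricComponents m) (k i j : Fin m)
    (u : EuclideanSpace ℝ (Fin m)) : ℝ :=
  (1 / 2) * ∑ l, (g u)⁻¹ k l *
    (pd i (fun v => g v j l) u + pd j (fun v => g v i l) u - pd l (fun v => g v i j) u)

/-- `R^s_{tuv}`, where `R(∂_a, ∂_b) ∂_t = R^s_{tab} ∂_s`. -/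
def riemannUp {m : ℕ} (g : MetricComponents m) (s t a b : Fin m)
    (u : EuclideanSpace ℝ (Fin m)) : ℝ :=
  pd a (christoffel g s b t) u - pd b (christoffel g s a t) u
    + ∑ w, (christoffel g s a w u * christoffel g w b t u
          - christoffel g s b w u * christoffel g w a t u)

/-- The Riemann curvature tensor with all indices down, `R_{stab} = g(R(∂_a, ∂_b) ∂_t, ∂_s)`. -/
def riemann {m : ℕ} (g : MetricComponents m) : TensorComponents m 4 :=
  fun I u => ∑ w, g u (I 0) w * riemannUp g w (I 1) (I 2) (I 3) u

/-- The Levi-Civita covariant derivative of a covariant tensor; the last index is the direction of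
differentiation. -/
def covDeriv {m k : ℕ} (g : MetricComponents m) (T : TensorComponents m k) :
    TensorComponents m (k + 1) :=
  fun I u => pd (I (Fin.last k)) (T (Fin.init I)) u
    - ∑ a : Fin k, ∑ b : Fin m,
        christoffel g b (I (Fin.last k)) (I a.castSucc) u * T (Function.update (Fin.init I) a b) u

/-- The `p`-th covariant derivative `∇ᵖR` of the curvature tensor. -/
def nablaRiemann {m : ℕ} (g : MetricComponents m) : (p : ℕ) → TensorComponents m (4 + p)
  | 0 => riemann g
  | p + 1 => covDeriv g (nablaRiemann g p)

/-! ### Full contractions of the curvature and its covariant derivatives -/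

/-- The combinatorial data of a full contraction of a product `∇^{p₁}R ⊗ ⋯ ⊗ ∇^{pᵣ}R`: the orders
`p₁, …, pᵣ` and a complete pairing of the index slots of the product. -/
structure FullContraction where
  factors : ℕ
  order : Fin factors → ℕ
  pairs : ℕ
  pairing : (Σ i : Fin factors, Fin (4 + order i)) ≃ Fin pairs × Fin 2

/-- The value of a full contraction: sum over all values of the indices, contracting each
pair of slots with the inverse metric. -/
def FullContraction.eval (C : FullContraction) {m : ℕ} (g : MetricComponents m)
    (u : EuclideanSpace ℝ (Fin m)) : ℝ :=
  ∑ I : (Σ i : Fin C.factors, Fin (4 + C.order i)) → Fin m,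
    (∏ i, nablaRiemann g (C.order i) (fun a => I ⟨i, a⟩) u) *
      ∏ j, (g u)⁻¹ (I (C.pairing.symm (j, 0))) (I (C.pairing.symm (j, 1)))

/-- Scalar Riemannian invariants: finite real linear combinations of full contractions. -/
abbrev ScalarInvariant : Type := FullContraction →₀ ℝ

/-- The value of a scalar Riemannian invariant on a metric in coordinates. -/
def ScalarInvariant.eval (P : ScalarInvariant) {m : ℕ} (g : MetricComponents m)
    (u : EuclideanSpace ℝ (Fin m)) : ℝ :=
  P.sum fun C c => c * C.eval g u

/-! ### Bilinear forms on the tangent spaces of a manifold -/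

section Manifold

variable {d : ℕ}

/-- Fields of bilinear forms on the tangent spaces of a manifold. -/
abbrev BilinField (d : ℕ) (N : Type*) [TopologicalSpace N]
    [ChartedSpace (EuclideanSpace ℝ (Fin d)) N] : Type _ :=
  ∀ q : N, TangentSpace (𝓡 d) q →L[ℝ] TangentSpace (𝓡 d) q →L[ℝ] ℝ

/-- The coordinate vector field `∂_i` of the chart `e`, at the point with coordinates `u`. -/
def coordVec {N : Type*} [TopologicalSpace N] [ChartedSpace (EuclideanSpace ℝ (Fin d)) N]
    (e : OpenPartialHomeomorph N (EuclideanSpace ℝ (Fin d))) (i : Fin d)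
    (u : EuclideanSpace ℝ (Fin d)) : TangentSpace (𝓡 d) (e.symm u) :=
  mfderiv 𝓘(ℝ, EuclideanSpace ℝ (Fin d)) (𝓡 d) e.symm u
    (show EuclideanSpace ℝ (Fin d) from EuclideanSpace.single i 1)

/-- The components `B_{ij} = B(∂_i, ∂_j)` of a field of bilinear forms in the chart `e`. -/
def components {N : Type*} [TopologicalSpace N] [ChartedSpace (EuclideanSpace ℝ (Fin d)) N]
    (e : OpenPartialHomeomorph N (EuclideanSpace ℝ (Fin d))) (B : BilinField d N) :
    MetricComponents d :=
  fun u => Matrix.of fun i j => B (e.symm u) (coordVec e i u) (coordVec e j u)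

/-- The trace of the bilinear form `B` on `T_qN` with respect to the inner product `B₀`, that is
`B₀^{ij} B_{ij}`; it does not depend on the basis of `T_qN` used to compute it. -/
def traceWith {N : Type*} [TopologicalSpace N] [ChartedSpace (EuclideanSpace ℝ (Fin d)) N]
    (B₀ B : BilinField d N) (q : N) : ℝ :=
  let v : Fin d → TangentSpace (𝓡 d) q :=
    fun i => (show EuclideanSpace ℝ (Fin d) from EuclideanSpace.single i 1)
  Matrix.trace ((Matrix.of fun i j => B₀ q (v i) (v j))⁻¹ * Matrix.of fun i j => B q (v i) (v j))

/-- Smooth Riemannian metrics on a manifold of dimension `m`. -/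
abbrev SmoothMetric (m : ℕ) (M : Type*) [TopologicalSpace M]
    [ChartedSpace (EuclideanSpace ℝ (Fin m)) M] [IsManifold (𝓡 m) ∞ M] : Type _ :=
  Bundle.ContMDiffRiemannianMetric (𝓡 m) ∞ (EuclideanSpace ℝ (Fin m))
    (fun p : M => TangentSpace (𝓡 m) p)

/-- The scalar Riemannian invariant `P` of the metric `g`, as a function on the manifold. As it is
a full contraction, its value at a point can be computed in any chart around the point. -/
def ScalarInvariant.onManifold (P : ScalarInvariant) {m : ℕ} {M : Type*} [TopologicalSpace M]
    [ChartedSpace (EuclideanSpace ℝ (Fin m)) M] [IsManifold (𝓡 m) ∞ M] (g : SmoothMetric m M)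
    (p : M) : ℝ :=
  P.eval (components (chartAt (EuclideanSpace ℝ (Fin m)) p) g.inner)
    (chartAt (EuclideanSpace ℝ (Fin m)) p p)

/-! ### Polyhomogeneous expansions -/

/-- `f(u, x) ∼ ∑_k ∑_{p ≤ L k} a_{k,p}(u) x^k (log x)^p` as `x → 0⁺`, for `u ∈ U`: the `a_{k,p}` are
smooth on `U`, and, locally uniformly on `U`, each derivative of `f` in `(u, x)` agrees up to
`O(x^r)` with that of the partial sum, for every `r`, as soon as enough terms are
taken. (The `j`-th derivatives of the terms with `k > r + j` are `O(x^r)`.) -/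
def HasPhgExpansionOn {E : Type*} [NormedAddCommGroup E] [NormedSpace ℝ E] (U : Set E)
    (f : E → ℝ → ℝ) (L : ℕ → ℕ) (a : ℕ → ℕ → E → ℝ) : Prop :=
  (∀ k, ∀ p ≤ L k, ContDiffOn ℝ ∞ (a k p) U) ∧
  ∀ r j : ℕ, ∀ K ⊆ U, IsCompact K → ∃ C δ : ℝ, 0 < δ ∧ ∀ u ∈ K, ∀ x ∈ Set.Ioo 0 δ,
    ContDiffAt ℝ ∞ (fun z : E × ℝ => f z.1 z.2) (u, x) ∧
    ‖iteratedFDeriv ℝ j (fun z : E × ℝ => f z.1 z.2 -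
        ∑ k ∈ Finset.range (r + j + 1), ∑ p ∈ Finset.range (L k + 1),
          a k p z.1 * z.2 ^ k * Real.log z.2 ^ p) (u, x)‖ ≤ C * x ^ r

/-- The function `f` on `N × (0, ε)` has a polyhomogeneous expansion of the form
`a_0 + x a_1 + ⋯ + x^{n-1} a_{n-1} + x^n a_n + x^n (log x) a_{n,1} + ⋯`: no logarithms below `x^n`,
at most a first power of `log x` at `x^n`, and in the terms `x^k (log x)^p` with `k > n` only
finitely many `p` for each `k`. Here `a k p` is the coefficient of `x^k (log x)^p`. -/
def HasScalarExpansion {N : Type*} [TopologicalSpace N]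
    [ChartedSpace (EuclideanSpace ℝ (Fin d)) N] (n : ℕ)
    (f : N → ℝ → ℝ) (a : ℕ → ℕ → N → ℝ) : Prop :=
  ∃ L : ℕ → ℕ, (∀ k < n, L k = 0) ∧ L n = 1 ∧
    ∀ e ∈ IsManifold.maximalAtlas (𝓡 d) ∞ N,
      HasPhgExpansionOn e.target (fun u x => f (e.symm u) x) L (fun k p u => a k p (e.symm u))

/-- The same for a family `G_x`, `x ∈ (0, ε)`, of fields of bilinear forms on `N`: in every chart,
the components have such an expansion. -/
def HasBilinExpansion {N : Type*} [TopologicalSpace N]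
    [ChartedSpace (EuclideanSpace ℝ (Fin d)) N] (n : ℕ)
    (G : ℝ → BilinField d N) (γ : ℕ → ℕ → BilinField d N) : Prop :=
  ∃ L : ℕ → ℕ, (∀ k < n, L k = 0) ∧ L n = 1 ∧
    ∀ e ∈ IsManifold.maximalAtlas (𝓡 d) ∞ N, ∀ i j : Fin d,
      HasPhgExpansionOn e.target (fun u x => components e (G x) u i j) L
        (fun k p u => components e (γ k p) u i j)

/-! ### Asymptotically hyperbolic manifolds with a special boundary defining function -/

/-- A Riemannian metric `g` on the interior `M` of a compact manifold
`M̄ = M ∪ N` of dimension `d + 1` with boundary `N`, and a special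
boundary defining function `x`, together with the identification of the neighbourhood `{x < ε}` of
the boundary with `N × [0, ε)` that `x` induces, in which `x² g = dx² + G_x`.

The compact manifold with boundary `M̄` is obtained from `M` by gluing in `N × [0, ε)` along the
diffeomorphism `collar` from `N × (0, ε)` onto `{x < ε}`. -/
structure SpecialCollar (d : ℕ) (M N : Type*)
    [TopologicalSpace M] [ChartedSpace (EuclideanSpace ℝ (Fin (d + 1))) M]
    [IsManifold (𝓡 (d + 1)) ∞ M]
    [TopologicalSpace N] [ChartedSpace (EuclideanSpace ℝ (Fin d)) N]
    [IsManifold (𝓡 d) ∞ N] where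
  /-- the metric on the interior -/
  g : SmoothMetric (d + 1) M
  /-- the boundary defining function, on the interior -/
  x : M → ℝ
  x_smooth : ContMDiff (𝓡 (d + 1)) 𝓘(ℝ, ℝ) ∞ x
  x_pos : ∀ p, 0 < x p
  compact_superlevel : ∀ δ > 0, IsCompact {p | δ ≤ x p}
  /-- the width of the collar -/
  ε : ℝ
  ε_pos : 0 < ε
  /-- the identification `N × (0, ε) ≅ {x < ε}` -/
  collar : PartialDiffeomorph ((𝓡 d).prod 𝓘(ℝ, ℝ)) (𝓡 (d + 1)) (N × ℝ) M ∞
  collar_source : collar.source = Set.univ ×ˢ Set.Ioo 0 ε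
  collar_target : collar.target = {p | x p < ε}
  x_collar : ∀ q : N, ∀ t ∈ Set.Ioo 0 ε, x (collar (q, t)) = t
  /-- the family of metrics on the boundary -/
  G : ℝ → BilinField d N
  /-- `x² g = dx² + G_x` -/
  normal_form : ∀ q : N, ∀ t ∈ Set.Ioo 0 ε, ∀ v w : EuclideanSpace ℝ (Fin d), ∀ a b : ℝ,
    t ^ 2 * g.inner (collar (q, t))
      (mfderiv ((𝓡 d).prod 𝓘(ℝ, ℝ)) (𝓡 (d + 1)) collar (q, t)
        (show EuclideanSpace ℝ (Fin d) × ℝ from (v, a)))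
      (mfderiv ((𝓡 d).prod 𝓘(ℝ, ℝ)) (𝓡 (d + 1)) collar (q, t)
        (show EuclideanSpace ℝ (Fin d) × ℝ from (w, b))) =
    a * b + G t q v w

/-- `x² g` has the expansion
`dx² + γ_0 + x γ_1 + ⋯ + x^{n-1} γ_{n-1} + x^n γ_n + x^n (log x) γ_{n,1} + ⋯`, and its
extension to the boundary is nondegenerate. -/
def SpecialCollar.HasMetricExpansion {M N : Type*}
    [TopologicalSpace M] [ChartedSpace (EuclideanSpace ℝ (Fin (d + 1))) M]
    [IsManifold (𝓡 (d + 1)) ∞ M]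
    [TopologicalSpace N] [ChartedSpace (EuclideanSpace ℝ (Fin d)) N] [IsManifold (𝓡 d) ∞ N]
    (X : SpecialCollar d M N) (n : ℕ) (γ : ℕ → ℕ → BilinField d N) : Prop :=
  HasBilinExpansion n X.G γ ∧ ∀ (q : N) (v : TangentSpace (𝓡 d) q), v ≠ 0 → 0 < γ 0 0 q v v

/-- The function `P` on `M` has an expansion
`P_0 + x P_1 + ⋯ + x^{n-1} P_{n-1} + x^n P_n + x^n (log x) P_{n,1} + ⋯` in the collar. -/
def SpecialCollar.HasFunctionExpansion {M N : Type*}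
    [TopologicalSpace M] [ChartedSpace (EuclideanSpace ℝ (Fin (d + 1))) M]
    [IsManifold (𝓡 (d + 1)) ∞ M]
    [TopologicalSpace N] [ChartedSpace (EuclideanSpace ℝ (Fin d)) N] [IsManifold (𝓡 d) ∞ N]
    (X : SpecialCollar d M N) (n : ℕ) (P : M → ℝ) (A : ℕ → ℕ → N → ℝ) : Prop :=
  HasScalarExpansion (d := d) n (fun q t => P (X.collar (q, t))) A

end Manifold

end AH

end

set_option linter.unusedSectionVars false

noncomputable section

/-! Near the boundary g = x⁻²(dx² + G_x), and everything is computed in the frame x ∂_x, x ∂_i.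
There the matrix of g is 1 ⊕ G_x, polyhomogeneous up to x = 0 with invertible leading term, and the
brackets [x ∂_x, x ∂_i] = x ∂_i, [x ∂_i, x ∂_j] = 0 have constant coefficients. A scalar invariant
is thus a universal polynomial in the entries of G_x and of its inverse and in their derivatives
under x ∂_x, x ∂_i. Polyhomogeneous functions form an algebra stable under these derivations and
under inversion of functions with nonvanishing leading term, which gives the first claim. The shape
of the expansion (no logarithm below x^n, at most a first power at x^n) survives because the bound
`L k` on the power of log x at x^k can be chosen superadditive (`exists_superadditive`).

For the second claim, let two metrics agree below order n. As n ≥ 1, a product differs at order n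
only by the order-n difference of one factor times the leading term of the other. The derivation x
∂_i raises the order, so only common lower coefficients enter through it, and x ∂_x sends α x^n + β
x^n log x to (nα + β) x^n + nβ x^n log x. Hence the order-n difference of the two invariants is a
first-order variation: the nilpotent part of the same invariant evaluated over the dual numbers ℝ ⊕
ℝ² on the metric γ₀ + h, where h is the pair of differences of the coefficients of x^n and x^n log x
(`Agree`, `agree_collarInvariant`). This variation is linear in h. A constant linear change of the
tangential frame preserves the structure constants, so the variation is GL(d)-invariant. With γ₀
brought to the identity and h = k ⊗ w to diagonal form, it becomes a linear function of the
eigenvalues invariant under permutations, hence of the form (trace of k) times a fixed vector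
(`variation_smul_eq_zero`).

Two algebraic facts carry the argument. Curvature is written over an arbitrary commutative ℝ-algebra
and is natural under homomorphisms (`FrameData.IsHom.invariant`); the algebras used are functions,
formal series, dual numbers, and subalgebras of products that record a relation between these.
Invariants do not depend on the frame (`FrameData.IsFrame.invariant_eq`); this is used to pass from
a chart of M to the collar frame, and again for the GL(d)-invariance. Finally, coefficients of
expansions are unique (`HasLogExpansion.unique`), so any expansion of P has the formally computed
coefficients, whatever the chart. -/

namespace AH

/-! ### Curvature invariants over an abstract ring of functions -/

/-- The data needed to write down the curvature of a metric in a frame: the derivations along the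
frame, the structure functions `[e_a, e_b] = c_{ab}^w e_w`, the metric and its inverse. -/
structure FrameData (m : ℕ) (B : Type*) where
  D : Fin m → B → B
  c : Fin m → Fin m → Fin m → B
  G : Matrix (Fin m) (Fin m) B
  Ginv : Matrix (Fin m) (Fin m) B

namespace FrameData

variable {m : ℕ} {B B' : Type*} [CommRing B] [Algebra ℝ B] [CommRing B'] [Algebra ℝ B']

/-- The Koszul expression `2 g(∇_{e_i} e_j, e_l)`. -/
def koszul (F : FrameData m B) (i j l : Fin m) : B :=
  F.D i (F.G j l) + F.D j (F.G i l) - F.D l (F.G i j)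
    + ∑ w, (F.c i j w * F.G w l - F.c i l w * F.G w j - F.c j l w * F.G w i)

/-- The connection coefficients `∇_{e_i} e_j = ω^k_{ij} e_k`. -/
def conn (F : FrameData m B) (k i j : Fin m) : B :=
  algebraMap ℝ B (1 / 2) * ∑ l, F.Ginv k l * F.koszul i j l

/-- The components of the curvature, `R(e_a, e_b) e_t = R^s_{tab} e_s`. -/
def riemannUp (F : FrameData m B) (s t a b : Fin m) : B :=
  F.D a (F.conn s b t) - F.D b (F.conn s a t)
    + ∑ w, (F.conn s a w * F.conn w b t - F.conn s b w * F.conn w a t)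
    - ∑ w, F.c a b w * F.conn s w t

/-- The curvature tensor with all indices down. -/
def riemann (F : FrameData m B) (I : Fin 4 → Fin m) : B :=
  ∑ w, F.G (I 0) w * F.riemannUp w (I 1) (I 2) (I 3)

/-- The covariant derivative of a covariant tensor. -/
def covDeriv (F : FrameData m B) {k : ℕ} (T : (Fin k → Fin m) → B) (I : Fin (k + 1) → Fin m) : B :=
  F.D (I (Fin.last k)) (T (Fin.init I))
    - ∑ a : Fin k, ∑ b : Fin m,
        F.conn b (I (Fin.last k)) (I a.castSucc) * T (Function.update (Fin.init I) a b)

/-- The iterated covariant derivatives of the curvature tensor. -/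
def nablaRiemann (F : FrameData m B) : (p : ℕ) → (Fin (4 + p) → Fin m) → B
  | 0 => F.riemann
  | p + 1 => F.covDeriv (F.nablaRiemann p)

/-- The value of a full contraction. -/
def contract (F : FrameData m B) (C : FullContraction) : B :=
  ∑ I : (Σ i : Fin C.factors, Fin (4 + C.order i)) → Fin m,
    (∏ i, F.nablaRiemann (C.order i) (fun a => I ⟨i, a⟩)) *
      ∏ j, F.Ginv (I (C.pairing.symm (j, 0))) (I (C.pairing.symm (j, 1)))

/-- The value of a scalar invariant. -/
def invariant (F : FrameData m B) (P : ScalarInvariant) : B :=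
  P.sum fun C c => algebraMap ℝ B c * F.contract C

/-- A homomorphism of algebras that is compatible with frame data. -/
structure IsHom (φ : B →ₐ[ℝ] B') (F : FrameData m B) (F' : FrameData m B') : Prop where
  D : ∀ s b, φ (F.D s b) = F'.D s (φ b)
  c : ∀ a b w, φ (F.c a b w) = F'.c a b w
  G : ∀ i j, φ (F.G i j) = F'.G i j
  Ginv : ∀ i j, φ (F.Ginv i j) = F'.Ginv i j

namespace IsHom

variable {φ : B →ₐ[ℝ] B'} {F : FrameData m B} {F' : FrameData m B'}

theorem conn (h : IsHom φ F F') (k i j : Fin m) : φ (F.conn k i j) = F'.conn k i j := by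
  simp only [FrameData.conn, FrameData.koszul, map_mul, map_sum, map_add, map_sub, h.D, h.c, h.G,
    h.Ginv, AlgHom.commutes]

theorem riemann (h : IsHom φ F F') (I : Fin 4 → Fin m) : φ (F.riemann I) = F'.riemann I := by
  simp only [FrameData.riemann, FrameData.riemannUp, map_mul, map_sum, map_add, map_sub, h.D, h.c,
    h.G, h.conn]

theorem nablaRiemann (h : IsHom φ F F') (p : ℕ) (I : Fin (4 + p) → Fin m) :
    φ (F.nablaRiemann p I) = F'.nablaRiemann p I := by
  induction p with
  | zero => exact h.riemann I
  | succ p ih =>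
    simp only [FrameData.nablaRiemann, FrameData.covDeriv, map_mul, map_sum, map_sub, h.D, h.conn]
    congr 1
    · exact congrArg _ (ih _)
    · exact Finset.sum_congr rfl fun a _ => Finset.sum_congr rfl fun b _ => congrArg _ (ih _)

theorem contract (h : IsHom φ F F') (C : FullContraction) :
    φ (F.contract C) = F'.contract C := by
  simp only [FrameData.contract, map_mul, map_sum, map_prod, h.Ginv, h.nablaRiemann]

/-- The invariant is built from the frame data by ring operations and real scalars alone, so no
derivation law is needed. This is what transports a single computation between different rings. -/
theorem invariant (h : IsHom φ F F') (P : ScalarInvariant) :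
    φ (F.invariant P) = F'.invariant P := by
  simp only [FrameData.invariant, Finsupp.sum, map_mul, map_sum, h.contract, AlgHom.commutes]

end IsHom

end FrameData

/-- The frame data of the coordinate frame. -/
def coordFrame {m : ℕ} (g : MetricComponents m) :
    FrameData m (EuclideanSpace ℝ (Fin m) → ℝ) where
  D := pd
  c := 0
  G := Matrix.of fun i j u => g u i j
  Ginv := Matrix.of fun i j u => (g u)⁻¹ i j

section coordFrame

variable {m : ℕ} (g : MetricComponents m)

theorem coordFrame_conn (k i j : Fin m) : (coordFrame g).conn k i j = christoffel g k i j := by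
  funext u
  simp [FrameData.conn, FrameData.koszul, christoffel, coordFrame]

theorem coordFrame_riemannUp (s t a b : Fin m) :
    (coordFrame g).riemannUp s t a b = riemannUp g s t a b := by
  funext u
  simp only [FrameData.riemannUp, coordFrame_conn, riemannUp]
  simp [coordFrame]

theorem coordFrame_riemann : (coordFrame g).riemann = riemann g := by
  funext I u
  simp only [FrameData.riemann, coordFrame_riemannUp, riemann]
  simp [coordFrame]

theorem coordFrame_nablaRiemann (p : ℕ) :
    (coordFrame g).nablaRiemann p = nablaRiemann g p := by
  induction p with
  | zero => exact coordFrame_riemann g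
  | succ p ih =>
    funext I u
    simp only [FrameData.nablaRiemann, nablaRiemann, ih, FrameData.covDeriv, covDeriv,
      coordFrame_conn]
    simp [coordFrame]

/-- Here the ring consists of all functions, on which `pd` need not be a derivation; the identity
merely compares two formulas, the structure functions being zero. -/
theorem coordFrame_invariant (P : ScalarInvariant) : (coordFrame g).invariant P = P.eval g := by
  funext u
  simp only [FrameData.invariant, ScalarInvariant.eval, Finsupp.sum, FrameData.contract,
    FullContraction.eval, coordFrame_nablaRiemann]
  simp [coordFrame]

end coordFrame

/-! ### Independence of the frame -/

namespace FrameData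

variable {m : ℕ} {B : Type*} [CommRing B] [Algebra ℝ B]

/-- The frame data come from an actual frame: the `D s` are derivations with structure functions
`c`, and the metric is symmetric and invertible. -/
structure IsRegular (F : FrameData m B) : Prop where
  D_add : ∀ s f g, F.D s (f + g) = F.D s f + F.D s g
  D_mul : ∀ s f g, F.D s (f * g) = F.D s f * g + f * F.D s g
  comm : ∀ a b f, F.D a (F.D b f) - F.D b (F.D a f) = ∑ w, F.c a b w * F.D w f
  c_antisymm : ∀ a b w, F.c a b w = -F.c b a w
  symm : ∀ i j, F.G i j = F.G j i
  inv : F.G * F.Ginv = 1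

/-- The derivative of a function along a vector field. -/
def dir (F : FrameData m B) (X : Fin m → B) (f : B) : B := ∑ s, X s * F.D s f

/-- The Lie bracket of vector fields. -/
def bracket (F : FrameData m B) (X Y : Fin m → B) : Fin m → B := fun t =>
  F.dir X (Y t) - F.dir Y (X t) + ∑ a, ∑ b, X a * Y b * F.c a b t

/-- The covariant derivative of a vector field along a vector field. -/
def nab (F : FrameData m B) (X Y : Fin m → B) : Fin m → B := fun t =>
  F.dir X (Y t) + ∑ a, ∑ b, X a * Y b * F.conn t a b

/-- The inner product of vector fields. -/
def inn (F : FrameData m B) (X Y : Fin m → B) : B := ∑ i, ∑ j, X i * Y j * F.G i j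

/-- The curvature operator. -/
def curv (F : FrameData m B) (X Y Z : Fin m → B) : Fin m → B :=
  F.nab X (F.nab Y Z) - F.nab Y (F.nab X Z) - F.nab (F.bracket X Y) Z

section

variable {F : FrameData m B}

theorem dir_add_left (X Y : Fin m → B) (f : B) : F.dir (X + Y) f = F.dir X f + F.dir Y f := by
  simp [dir, add_mul, Finset.sum_add_distrib]

theorem dir_smul_left (a : B) (X : Fin m → B) (f : B) : F.dir (a • X) f = a * F.dir X f := by
  simp [dir, Finset.mul_sum, mul_assoc]

theorem nab_add_left (X Y Z : Fin m → B) : F.nab (X + Y) Z = F.nab X Z + F.nab Y Z := by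
  funext t
  simp only [nab, dir_add_left, Pi.add_apply, add_mul, Finset.sum_add_distrib]
  ring

theorem nab_smul_left (f : B) (X Z : Fin m → B) : F.nab (f • X) Z = f • F.nab X Z := by
  funext t
  simp only [nab, dir_smul_left, Pi.smul_apply, smul_eq_mul, mul_add, Finset.mul_sum, mul_assoc]

theorem inn_add_left (X Y Z : Fin m → B) : F.inn (X + Y) Z = F.inn X Z + F.inn Y Z := by
  simp [inn, add_mul, Finset.sum_add_distrib]

theorem inn_smul_left (f : B) (X Z : Fin m → B) : F.inn (f • X) Z = f * F.inn X Z := by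
  simp [inn, Finset.mul_sum, mul_assoc]

theorem inn_sum_smul {ι : Type*} (s : Finset ι) (f : ι → B) (X : ι → Fin m → B) (Z : Fin m → B) :
    F.inn (∑ i ∈ s, f i • X i) Z = ∑ i ∈ s, f i * F.inn (X i) Z := by
  classical
  induction s using Finset.induction_on with
  | empty => simp [inn]
  | insert a s ha ih => rw [Finset.sum_insert ha, Finset.sum_insert ha, inn_add_left, ih, inn_smul_left]

theorem inn_sub_left (X Y Z : Fin m → B) : F.inn (X - Y) Z = F.inn X Z - F.inn Y Z := by
  simp [inn, sub_mul, Finset.sum_sub_distrib]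

variable (hF : F.IsRegular)
include hF

namespace IsRegular

theorem D_zero (s : Fin m) : F.D s 0 = 0 := by
  have := hF.D_add s 0 0
  simpa using this

theorem D_sum {ι : Type*} (s : Fin m) (t : Finset ι) (f : ι → B) :
    F.D s (∑ i ∈ t, f i) = ∑ i ∈ t, F.D s (f i) := by
  classical
  induction t using Finset.induction_on with
  | empty => simp [hF.D_zero]
  | insert a t ha ih => rw [Finset.sum_insert ha, Finset.sum_insert ha, hF.D_add, ih]

theorem dir_add (X : Fin m → B) (f g : B) : F.dir X (f + g) = F.dir X f + F.dir X g := by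
  simp [dir, hF.D_add, mul_add, Finset.sum_add_distrib]

theorem dir_mul (X : Fin m → B) (f g : B) : F.dir X (f * g) = F.dir X f * g + f * F.dir X g := by
  simp only [dir, hF.D_mul, mul_add, Finset.sum_add_distrib, Finset.sum_mul, Finset.mul_sum]
  congr 1 <;> exact Finset.sum_congr rfl fun _ _ => by ring

theorem dir_sum {ι : Type*} (X : Fin m → B) (t : Finset ι) (f : ι → B) :
    F.dir X (∑ i ∈ t, f i) = ∑ i ∈ t, F.dir X (f i) := by
  simp only [dir, hF.D_sum, Finset.mul_sum]
  exact Finset.sum_comm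

theorem nab_add (X Y Z : Fin m → B) : F.nab X (Y + Z) = F.nab X Y + F.nab X Z := by
  funext t
  simp only [nab, Pi.add_apply, hF.dir_add, mul_add, add_mul, Finset.sum_add_distrib]
  ring

theorem nab_smul (X : Fin m → B) (f : B) (Y : Fin m → B) :
    F.nab X (f • Y) = F.dir X f • Y + f • F.nab X Y := by
  funext t
  simp only [nab, Pi.add_apply, Pi.smul_apply, smul_eq_mul, hF.dir_mul, mul_add, Finset.mul_sum,
    add_assoc]
  congr 2
  exact Finset.sum_congr rfl fun _ _ => Finset.sum_congr rfl fun _ _ => by ring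

theorem bracket_add_left (X Y Z : Fin m → B) :
    F.bracket (X + Y) Z = F.bracket X Z + F.bracket Y Z := by
  funext t
  simp only [bracket, Pi.add_apply, dir_add_left, hF.dir_add, add_mul, Finset.sum_add_distrib]
  ring

theorem bracket_smul_left (f : B) (X Y : Fin m → B) :
    F.bracket (f • X) Y = f • F.bracket X Y - F.dir Y f • X := by
  funext t
  simp only [bracket, Pi.sub_apply, Pi.smul_apply, smul_eq_mul, dir_smul_left, hF.dir_mul, mul_add,
    mul_sub, Finset.mul_sum, mul_assoc]
  ring

theorem bracket_antisymm (X Y : Fin m → B) : F.bracket X Y = -F.bracket Y X := by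
  funext t
  simp only [bracket, Pi.neg_apply]
  rw [Finset.sum_comm]
  have : ∑ a, ∑ b, X b * Y a * F.c b a t = -∑ a, ∑ b, Y a * X b * F.c a b t := by
    simp only [← Finset.sum_neg_distrib]
    exact Finset.sum_congr rfl fun a _ => Finset.sum_congr rfl fun b _ => by
      rw [hF.c_antisymm b a t]; ring
  rw [this]
  ring

theorem dir_dir (X Y : Fin m → B) (f : B) :
    F.dir X (F.dir Y f) = F.dir (fun t => F.dir X (Y t)) f
      + ∑ a, ∑ b, X a * Y b * F.D a (F.D b f) := by
  simp only [dir, hF.D_sum, hF.D_mul, Finset.mul_sum, mul_add, Finset.sum_add_distrib,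
    Finset.sum_mul]
  congr 1
  · rw [Finset.sum_comm]
    exact Finset.sum_congr rfl fun a _ => Finset.sum_congr rfl fun b _ => by ring
  · exact Finset.sum_congr rfl fun a _ => Finset.sum_congr rfl fun b _ => by ring

/-- The second-order terms of the two sides differ by `comm`, which produces the structure-function
term of `bracket`. The identity is what makes `curv` linear over functions in its last argument. -/
theorem dir_bracket (X Y : Fin m → B) (f : B) :
    F.dir (F.bracket X Y) f = F.dir X (F.dir Y f) - F.dir Y (F.dir X f) := by
  rw [hF.dir_dir, hF.dir_dir Y X]
  have h1 : ∑ a, ∑ b, Y a * X b * F.D a (F.D b f) = ∑ a, ∑ b, X a * Y b * F.D b (F.D a f) := by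
    rw [Finset.sum_comm]
    exact Finset.sum_congr rfl fun a _ => Finset.sum_congr rfl fun b _ => by ring
  have h2 : ∑ a, ∑ b, X a * Y b * F.D a (F.D b f) - ∑ a, ∑ b, X a * Y b * F.D b (F.D a f)
      = F.dir (fun t => ∑ a, ∑ b, X a * Y b * F.c a b t) f := by
    simp only [← Finset.sum_sub_distrib, ← mul_sub, hF.comm, dir, Finset.mul_sum, Finset.sum_mul]
    rw [Finset.sum_comm' (t' := Finset.univ) (s' := fun _ => Finset.univ) (by simp)]
    rw [Finset.sum_comm]
    refine (Finset.sum_congr rfl fun a _ => ?_).trans (Finset.sum_comm)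
    rw [Finset.sum_comm]
    exact Finset.sum_congr rfl fun b _ => Finset.sum_congr rfl fun w _ => by ring
  have h3 : F.bracket X Y = (fun t => F.dir X (Y t)) + (-1 : B) • (fun t => F.dir Y (X t))
      + fun t => ∑ a, ∑ b, X a * Y b * F.c a b t := by
    funext t
    simp [bracket, sub_eq_add_neg]
  rw [h3, dir_add_left, dir_add_left, dir_smul_left, ← h2, h1]
  ring

theorem curv_add_left (X X' Y Z : Fin m → B) :
    F.curv (X + X') Y Z = F.curv X Y Z + F.curv X' Y Z := by
  simp only [curv, hF.bracket_add_left, nab_add_left, hF.nab_add]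
  abel

/-- The term (Y f) ∇_X Z contributed by the bracket [f X, Y] cancels the one produced by
differentiating f ∇_X Z along Y. -/
theorem curv_smul_left (f : B) (X Y Z : Fin m → B) : F.curv (f • X) Y Z = f • F.curv X Y Z := by
  have h : F.nab (F.bracket (f • X) Y) Z = f • F.nab (F.bracket X Y) Z - F.dir Y f • F.nab X Z := by
    rw [hF.bracket_smul_left, sub_eq_add_neg, ← neg_smul, nab_add_left, nab_smul_left,
      nab_smul_left, neg_smul, ← sub_eq_add_neg]
  simp only [curv, h, nab_smul_left, hF.nab_smul, smul_sub]
  abel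

theorem nab_neg_left (X Z : Fin m → B) : F.nab (-X) Z = -F.nab X Z := by
  rw [← neg_one_smul B X, nab_smul_left, neg_one_smul]

theorem curv_antisymm (X Y Z : Fin m → B) : F.curv X Y Z = -F.curv Y X Z := by
  simp only [curv, hF.bracket_antisymm X Y, hF.nab_neg_left]
  abel

theorem curv_add_mid (X Y Y' Z : Fin m → B) :
    F.curv X (Y + Y') Z = F.curv X Y Z + F.curv X Y' Z := by
  rw [hF.curv_antisymm, hF.curv_add_left, hF.curv_antisymm X Y, hF.curv_antisymm X Y', neg_add]

theorem curv_smul_mid (f : B) (X Y Z : Fin m → B) : F.curv X (f • Y) Z = f • F.curv X Y Z := by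
  rw [hF.curv_antisymm, hF.curv_smul_left, hF.curv_antisymm X Y, smul_neg]

theorem curv_add_right (X Y Z Z' : Fin m → B) :
    F.curv X Y (Z + Z') = F.curv X Y Z + F.curv X Y Z' := by
  simp only [curv, hF.nab_add]
  abel

theorem curv_smul_right (f : B) (X Y Z : Fin m → B) : F.curv X Y (f • Z) = f • F.curv X Y Z := by
  simp only [curv, hF.nab_smul, hF.nab_add, hF.dir_bracket, smul_sub, sub_smul]
  abel

theorem inn_symm (X Y : Fin m → B) : F.inn X Y = F.inn Y X := by
  simp only [inn]
  rw [Finset.sum_comm]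
  exact Finset.sum_congr rfl fun a _ => Finset.sum_congr rfl fun b _ => by
    rw [hF.symm]; ring

theorem inv_left : F.Ginv * F.G = 1 := mul_eq_one_comm.mp hF.inv

theorem two_mul_conn_lower (i j l : Fin m) :
    2 * ∑ k, F.conn k i j * F.G k l = F.koszul i j l := by
  have h2 : (2 : B) * algebraMap ℝ B (1 / 2) = 1 := by
    rw [← map_ofNat (algebraMap ℝ B) 2, ← map_mul]; norm_num
  have h : ∑ k, F.conn k i j * F.G k l
      = algebraMap ℝ B (1 / 2) * ∑ n, (∑ k, F.G l k * F.Ginv k n) * F.koszul i j n := by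
    simp only [conn, Finset.mul_sum, Finset.sum_mul]
    rw [Finset.sum_comm]
    exact Finset.sum_congr rfl fun a _ => Finset.sum_congr rfl fun b _ => by
      rw [hF.symm l b]; ring
  have h' : ∀ n, ∑ k, F.G l k * F.Ginv k n = (1 : Matrix (Fin m) (Fin m) B) l n := fun n => by
    rw [← hF.inv]; rfl
  simp only [h, h', Matrix.one_apply, ite_mul, one_mul, zero_mul, Finset.sum_ite_eq,
    Finset.mem_univ, if_true]
  rw [← mul_assoc, h2, one_mul]

theorem eq_of_lower {X Y : Fin m → B}
    (h : ∀ l, ∑ k, X k * F.G k l = ∑ k, Y k * F.G k l) : X = Y := by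
  have h1 : Matrix.vecMul X F.G = Matrix.vecMul Y F.G := funext h
  have h2 := congrArg (fun v => Matrix.vecMul v F.Ginv) h1
  simpa [Matrix.vecMul_vecMul, hF.inv] using h2

/-- Antisymmetrizing the Koszul expression in i, j gives the torsion identity `conn_sub`;
symmetrizing it in j, l (`koszul_add`) gives compatibility with the metric, `dir_inn`. -/
theorem koszul_sub (i j l : Fin m) :
    F.koszul i j l - F.koszul j i l = 2 * ∑ w, F.c i j w * F.G w l := by
  have : ∀ w, F.c j i w = -F.c i j w := fun w => hF.c_antisymm j i w
  simp only [koszul, hF.symm j i, this, Finset.sum_sub_distrib, neg_mul, Finset.sum_neg_distrib]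
  ring

theorem koszul_add (i j l : Fin m) : F.koszul i j l + F.koszul i l j = 2 * F.D i (F.G j l) := by
  have : ∀ w, F.c l j w = -F.c j l w := fun w => hF.c_antisymm l j w
  simp only [koszul, hF.symm l j, this, Finset.sum_sub_distrib, neg_mul, Finset.sum_neg_distrib]
  ring

omit hF in
theorem two_cancel {x y : B} (h : 2 * x = 2 * y) : x = y := by
  have h2 : algebraMap ℝ B (1 / 2) * 2 = 1 := by
    rw [← map_ofNat (algebraMap ℝ B) 2, ← map_mul]; norm_num
  have := congrArg (algebraMap ℝ B (1 / 2) * ·) h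
  simpa only [← mul_assoc, h2, one_mul] using this

theorem conn_sub (i j k : Fin m) : F.conn k i j - F.conn k j i = F.c i j k := by
  refine congrFun (hF.eq_of_lower (X := fun k => F.conn k i j - F.conn k j i)
    (Y := fun k => F.c i j k) fun l => two_cancel ?_) k
  rw [← hF.koszul_sub, ← hF.two_mul_conn_lower, ← hF.two_mul_conn_lower, ← mul_sub]
  simp only [sub_mul, Finset.sum_sub_distrib]

theorem nab_sub_nab (X Y : Fin m → B) : F.nab X Y - F.nab Y X = F.bracket X Y := by
  funext t
  simp only [nab, bracket, Pi.sub_apply]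
  have : ∑ a, ∑ b, Y a * X b * F.conn t a b = ∑ a, ∑ b, X a * Y b * F.conn t b a := by
    rw [Finset.sum_comm]
    exact Finset.sum_congr rfl fun a _ => Finset.sum_congr rfl fun b _ => by ring
  simp only [this, ← hF.conn_sub, mul_sub, Finset.sum_sub_distrib]
  ring

theorem inn_nab (X Y Z : Fin m → B) :
    F.inn (F.nab X Y) Z = ∑ t, ∑ l, F.dir X (Y t) * Z l * F.G t l
      + ∑ a, ∑ b, ∑ l, X a * Y b * Z l * ∑ t, F.conn t a b * F.G t l := by
  simp only [inn, nab, add_mul, Finset.sum_add_distrib, Finset.sum_mul, Finset.mul_sum]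
  congr 1
  have e1 : ∀ t l : Fin m, ∑ a, ∑ b, X a * Y b * F.conn t a b * Z l * F.G t l
      = ∑ p : Fin m × Fin m, X p.1 * Y p.2 * F.conn t p.1 p.2 * Z l * F.G t l :=
    fun t l => (Fintype.sum_prod_type (fun p : Fin m × Fin m =>
      X p.1 * Y p.2 * F.conn t p.1 p.2 * Z l * F.G t l)).symm
  have e2 : ∀ f : Fin m → Fin m → Fin m → Fin m → B,
      ∑ a, ∑ b, ∑ l, ∑ t, f a b l t = ∑ p : Fin m × Fin m, ∑ l, ∑ t, f p.1 p.2 l t :=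
    fun f => (Fintype.sum_prod_type (fun p : Fin m × Fin m => ∑ l, ∑ t, f p.1 p.2 l t)).symm
  simp only [e1, e2]
  rw [Finset.sum_comm]
  rw [show (∑ y : Fin m, ∑ x : Fin m, ∑ p : Fin m × Fin m,
      X p.1 * Y p.2 * F.conn x p.1 p.2 * Z y * F.G x y) = ∑ y : Fin m, ∑ p : Fin m × Fin m,
        ∑ x : Fin m, X p.1 * Y p.2 * F.conn x p.1 p.2 * Z y * F.G x y from
    Finset.sum_congr rfl fun _ _ => Finset.sum_comm]
  rw [Finset.sum_comm]
  exact Finset.sum_congr rfl fun a _ => Finset.sum_congr rfl fun b _ =>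
    Finset.sum_congr rfl fun _ _ => by ring

theorem dir_inn (X Y Z : Fin m → B) :
    F.dir X (F.inn Y Z) = F.inn (F.nab X Y) Z + F.inn Y (F.nab X Z) := by
  rw [hF.inn_symm Y (F.nab X Z), hF.inn_nab, hF.inn_nab]
  have e : ∑ a, ∑ b, ∑ l, X a * Z b * Y l * ∑ t, F.conn t a b * F.G t l
      = ∑ a, ∑ b, ∑ l, X a * Y b * Z l * ∑ t, F.conn t a l * F.G t b := by
    refine Finset.sum_congr rfl fun a _ => ?_
    rw [Finset.sum_comm]
    exact Finset.sum_congr rfl fun b _ => Finset.sum_congr rfl fun l _ => by ring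
  have e' : ∑ t, ∑ l, F.dir X (Z t) * Y l * F.G t l
      = ∑ t, ∑ l, Y t * F.dir X (Z l) * F.G t l := by
    rw [Finset.sum_comm]
    exact Finset.sum_congr rfl fun b _ => Finset.sum_congr rfl fun l _ => by
      rw [hF.symm l b]; ring
  have k : ∀ a b l, ∑ t, F.conn t a b * F.G t l + ∑ t, F.conn t a l * F.G t b
      = F.D a (F.G b l) := fun a b l => two_cancel <| by
    rw [mul_add, hF.two_mul_conn_lower, hF.two_mul_conn_lower, hF.koszul_add]
  have e3 : ∑ a, ∑ b, ∑ l, X a * Y b * Z l * F.D a (F.G b l)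
      = ∑ b, ∑ l, Y b * Z l * F.dir X (F.G b l) := by
    rw [Finset.sum_comm]
    refine Finset.sum_congr rfl fun b _ => ?_
    rw [Finset.sum_comm]
    refine Finset.sum_congr rfl fun l _ => ?_
    rw [dir, Finset.mul_sum]
    exact Finset.sum_congr rfl fun _ _ => by ring
  have e4 : ∑ a, ∑ b, ∑ l, X a * Y b * Z l * ∑ t, F.conn t a b * F.G t l
      + ∑ a, ∑ b, ∑ l, X a * Y b * Z l * ∑ t, F.conn t a l * F.G t b
      = ∑ a, ∑ b, ∑ l, X a * Y b * Z l * F.D a (F.G b l) := by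
    simp only [← Finset.sum_add_distrib, ← mul_add, k]
  rw [e, e', add_add_add_comm, e4, e3]
  simp only [inn, hF.dir_sum, hF.dir_mul, ← Finset.sum_add_distrib]
  exact Finset.sum_congr rfl fun b _ => Finset.sum_congr rfl fun l _ => by ring

/-- The Koszul formula. -/
theorem two_mul_inn_nab (X Y Z : Fin m → B) :
    2 * F.inn (F.nab X Y) Z = F.dir X (F.inn Y Z) + F.dir Y (F.inn X Z) - F.dir Z (F.inn X Y)
      + (F.inn (F.bracket X Y) Z - F.inn (F.bracket X Z) Y - F.inn (F.bracket Y Z) X) := by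
  simp only [hF.dir_inn, ← hF.nab_sub_nab, inn_sub_left]
  rw [hF.inn_symm Y (F.nab X Z), hF.inn_symm X (F.nab Y Z), hF.inn_symm X (F.nab Z Y)]
  ring

end IsRegular

end

end FrameData

/-! ### Covariant tensors and contractions under a change of frame -/

namespace FrameData

variable {m : ℕ} {B : Type*} [CommRing B] [Algebra ℝ B] {F : FrameData m B}

/-- The Levi-Civita derivative of a covariant tensor along a vector field. -/
def tensorNab (F : FrameData m B) (hF : F.IsRegular) {k : ℕ}
    (T : MultilinearMap B (fun _ : Fin k => Fin m → B) B) :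
    MultilinearMap B (fun _ : Fin k => Fin m → B) ((Fin m → B) →ₗ[B] B) where
  toFun Y :=
    { toFun := fun X => F.dir X (T Y) - ∑ a, T (Function.update Y a (F.nab X (Y a)))
      map_add' := fun X X' => by
        simp only [dir_add_left, nab_add_left, T.map_update_add, Finset.sum_add_distrib]
        ring
      map_smul' := fun f X => by
        simp only [dir_smul_left, nab_smul_left, T.map_update_smul, smul_eq_mul, RingHom.id_apply,
          mul_sub, Finset.mul_sum] }
  map_update_add' {inst} Y c Z Z' := by
    obtain rfl := Subsingleton.elim inst (instDecidableEqFin k)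
    refine LinearMap.ext fun X => ?_
    -- A vector W in slot c enters the correction sum in two ways: the c-th summand contains ∇_X W,
    -- and in every other summand W just occupies slot c.
    have h : ∀ W : Fin m → B, ∑ a, T (Function.update (Function.update Y c W) a
        (F.nab X (Function.update Y c W a))) = T (Function.update Y c (F.nab X W))
          + ∑ a ∈ Finset.univ.erase c,
            T (Function.update (Function.update Y a (F.nab X (Y a))) c W) := by
      intro W
      rw [← Finset.add_sum_erase _ _ (Finset.mem_univ c)]
      congr 1
      · simp
      · refine Finset.sum_congr rfl fun a ha => ?_
        have hac : a ≠ c := Finset.ne_of_mem_erase ha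
        rw [Function.update_of_ne hac, Function.update_comm hac]
    simp only [LinearMap.coe_mk, AddHom.coe_mk, LinearMap.add_apply, h, T.map_update_add,
      hF.dir_add, hF.nab_add, Finset.sum_add_distrib]
    ring
  map_update_smul' {inst} Y c f Z := by
    obtain rfl := Subsingleton.elim inst (instDecidableEqFin k)
    refine LinearMap.ext fun X => ?_
    have h : ∀ W : Fin m → B, ∑ a, T (Function.update (Function.update Y c W) a
        (F.nab X (Function.update Y c W a))) = T (Function.update Y c (F.nab X W))
          + ∑ a ∈ Finset.univ.erase c,
            T (Function.update (Function.update Y a (F.nab X (Y a))) c W) := by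
      intro W
      rw [← Finset.add_sum_erase _ _ (Finset.mem_univ c)]
      congr 1
      · simp
      · refine Finset.sum_congr rfl fun a ha => ?_
        have hac : a ≠ c := Finset.ne_of_mem_erase ha
        rw [Function.update_of_ne hac, Function.update_comm hac]
    simp only [LinearMap.coe_mk, AddHom.coe_mk, LinearMap.smul_apply, h, T.map_update_smul,
      T.map_update_add, hF.dir_mul, hF.nab_smul, smul_eq_mul, mul_sub, mul_add, Finset.mul_sum]
    ring

/-- The curvature tensor as a multilinear map. -/
def curvTensor (F : FrameData m B) (hF : F.IsRegular) :
    MultilinearMap B (fun _ : Fin 4 => Fin m → B) B where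
  toFun Y := F.inn (Y 0) (F.curv (Y 2) (Y 3) (Y 1))
  map_update_add' {inst} Y c Z Z' := by
    obtain rfl := Subsingleton.elim inst (instDecidableEqFin 4)
    simp only [hF.inn_symm _ (F.curv _ _ _)]
    fin_cases c <;>
      simp [hF.curv_add_left, hF.curv_add_mid, hF.curv_add_right,
        inn_add_left, hF.inn_symm _ (Z + Z'), hF.inn_symm _ Z, hF.inn_symm _ Z']
  map_update_smul' {inst} Y c f Z := by
    obtain rfl := Subsingleton.elim inst (instDecidableEqFin 4)
    simp only [hF.inn_symm _ (F.curv _ _ _)]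
    fin_cases c <;>
      simp [hF.curv_smul_left, hF.curv_smul_mid, hF.curv_smul_right,
        inn_smul_left, hF.inn_symm _ (f • Z), hF.inn_symm _ Z]

/-- The iterated covariant derivatives of the curvature tensor as multilinear maps. -/
def nablaTensor (F : FrameData m B) (hF : F.IsRegular) :
    (p : ℕ) → MultilinearMap B (fun _ : Fin (4 + p) => Fin m → B) B
  | 0 => F.curvTensor hF
  | p + 1 => (F.tensorNab hF (F.nablaTensor hF p)).uncurryRight

/-- `F'` are the frame data of the frame with vectors `A i` in the frame of `F`. -/
structure IsFrame (F : FrameData m B) (A : Fin m → Fin m → B) (F' : FrameData m B) : Prop where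
  D : ∀ s f, F'.D s f = F.dir (A s) f
  c : ∀ a b, ∑ w, F'.c a b w • A w = F.bracket (A a) (A b)
  G : ∀ i j, F'.G i j = F.inn (A i) (A j)
  inv : F'.G * F'.Ginv = 1

namespace IsFrame

variable {A : Fin m → Fin m → B} {F' : FrameData m B}

theorem G_eq (h : F.IsFrame A F') :
    F'.G = Matrix.of A * F.G * (Matrix.of A).transpose := by
  ext i j
  rw [h.G, Matrix.mul_apply]
  simp only [inn, Matrix.mul_apply, Matrix.transpose_apply, Matrix.of_apply, Finset.sum_mul]
  rw [Finset.sum_comm]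
  exact Finset.sum_congr rfl fun _ _ => Finset.sum_congr rfl fun _ _ => by ring

theorem right_inv (h : F.IsFrame A F') :
    Matrix.of A * (F.G * (Matrix.of A).transpose * F'.Ginv) = 1 := by
  rw [← h.inv, h.G_eq]
  simp only [Matrix.mul_assoc]

/-- Inner products with the A's determine a vector because the matrix A is invertible. This is not
assumed in `IsFrame`: it follows from invertibility of the metric matrix A G Aᵀ of `F'`. -/
theorem eq_of_inn (h : F.IsFrame A F') {X Y : Fin m → B}
    (hXY : ∀ l, F.inn X (A l) = F.inn Y (A l)) : X = Y := by
  have key : ∀ X : Fin m → B, X = Matrix.vecMul (Matrix.vecMul (fun l => F.inn X (A l)) F'.Ginv)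
      (Matrix.of A) := by
    intro X
    have e : (fun l => F.inn X (A l)) = Matrix.vecMul X (F.G * (Matrix.of A).transpose) := by
      funext l
      simp only [inn, Matrix.vecMul, dotProduct, Matrix.mul_apply, Matrix.transpose_apply,
        Matrix.of_apply, Finset.mul_sum]
      exact Finset.sum_congr rfl fun _ _ => Finset.sum_congr rfl fun _ _ => by ring
    rw [e, Matrix.vecMul_vecMul, Matrix.vecMul_vecMul, ← Matrix.mul_assoc (F.G * _),
      mul_eq_one_comm.mp h.right_inv, Matrix.vecMul_one]
  rw [key X, key Y, funext hXY]

/-- By the Koszul formula for vector fields, 2⟨∇_{A_i} A_j, A_l⟩ is the Koszul expression of `F'`,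
since the derivations, brackets and inner products of `F'` are those of the A's. Both frames
therefore describe the same connection. -/
theorem nab_eq (hF : F.IsRegular) (h : F.IsFrame A F') (i j : Fin m) :
    ∑ k, F'.conn k i j • A k = F.nab (A i) (A j) := by
  have two : (2 : B) * algebraMap ℝ B (1 / 2) = 1 := by
    rw [← map_ofNat (algebraMap ℝ B) 2, ← map_mul]; norm_num
  have hsymm : ∀ a b, F'.G a b = F'.G b a := fun a b => by rw [h.G, h.G, hF.inn_symm]
  refine h.eq_of_inn fun l => IsRegular.two_cancel ?_
  rw [hF.two_mul_inn_nab, inn_sum_smul, ← h.c, ← h.c, ← h.c]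
  simp only [inn_sum_smul, ← h.G, ← h.D]
  have e : ∑ k, F'.conn k i j * F'.G k l
      = algebraMap ℝ B (1 / 2) * ∑ n, (∑ k, F'.G l k * F'.Ginv k n) * F'.koszul i j n := by
    simp only [conn, Finset.mul_sum, Finset.sum_mul]
    rw [Finset.sum_comm]
    exact Finset.sum_congr rfl fun a _ => Finset.sum_congr rfl fun b _ => by
      rw [hsymm l b]; ring
  have e' : ∀ n, ∑ k, F'.G l k * F'.Ginv k n = (1 : Matrix (Fin m) (Fin m) B) l n := fun n => by
    rw [← h.inv]; rfl
  simp only [e, e', Matrix.one_apply, ite_mul, one_mul, zero_mul, Finset.sum_ite_eq,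
    Finset.mem_univ, if_true]
  rw [← mul_assoc, two, one_mul, koszul]
  simp only [Finset.sum_sub_distrib]

theorem nab_sum (hF : F.IsRegular) (X : Fin m → B) (f : Fin m → B) (Y : Fin m → Fin m → B) :
    F.nab X (∑ k, f k • Y k) = ∑ k, (F.dir X (f k) • Y k + f k • F.nab X (Y k)) := by
  have h0 : F.nab X 0 = 0 := by
    have := hF.nab_add X 0 0
    simpa using this
  have : ∀ s : Finset (Fin m), F.nab X (∑ k ∈ s, f k • Y k)
      = ∑ k ∈ s, (F.dir X (f k) • Y k + f k • F.nab X (Y k)) := by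
    intro s
    induction s using Finset.induction_on with
    | empty => simp [h0]
    | insert a s ha ih =>
      rw [Finset.sum_insert ha, Finset.sum_insert ha, hF.nab_add, ih, hF.nab_smul]
  exact this _

theorem nab_sum_left (f : Fin m → B) (Y : Fin m → Fin m → B) (X : Fin m → B) :
    F.nab (∑ k, f k • Y k) X = ∑ k, f k • F.nab (Y k) X := by
  have : ∀ s : Finset (Fin m), F.nab (∑ k ∈ s, f k • Y k) X
      = ∑ k ∈ s, f k • F.nab (Y k) X := by
    intro s
    induction s using Finset.induction_on with
    | empty => funext t; simp [nab, dir]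
    | insert a s ha ih =>
      rw [Finset.sum_insert ha, Finset.sum_insert ha, nab_add_left, ih, nab_smul_left]
  exact this _

theorem curv_eq (hF : F.IsRegular) (h : F.IsFrame A F') (a b t : Fin m) :
    F.curv (A a) (A b) (A t) = ∑ s, F'.riemannUp s t a b • A s := by
  have hn : ∀ a b t, F.nab (A a) (F.nab (A b) (A t))
      = ∑ s, (F'.D a (F'.conn s b t) + ∑ w, F'.conn s a w * F'.conn w b t) • A s := by
    intro a b t
    rw [← h.nab_eq hF, nab_sum hF]
    simp only [← h.D, Finset.sum_add_distrib, add_smul, ← h.nab_eq hF]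
    congr 1
    simp only [Finset.smul_sum, smul_smul, Finset.sum_smul]
    rw [Finset.sum_comm]
    exact Finset.sum_congr rfl fun _ _ => Finset.sum_congr rfl fun _ _ => by rw [mul_comm]
  have hb : F.nab (F.bracket (A a) (A b)) (A t)
      = ∑ s, (∑ w, F'.c a b w * F'.conn s w t) • A s := by
    rw [← h.c, nab_sum_left]
    simp only [← h.nab_eq hF, Finset.smul_sum, smul_smul, Finset.sum_smul]
    rw [Finset.sum_comm]
  rw [curv, hn, hn, hb, ← Finset.sum_sub_distrib, ← Finset.sum_sub_distrib]
  refine Finset.sum_congr rfl fun s _ => ?_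
  rw [← sub_smul, ← sub_smul, riemannUp, Finset.sum_sub_distrib]
  congr 1
  ring

theorem riemann_eq (hF : F.IsRegular) (h : F.IsFrame A F') (I : Fin 4 → Fin m) :
    F'.riemann I = F.curvTensor hF fun a => A (I a) := by
  change _ = F.inn (A (I 0)) (F.curv (A (I 2)) (A (I 3)) (A (I 1)))
  rw [h.curv_eq hF, hF.inn_symm, inn_sum_smul, riemann]
  exact Finset.sum_congr rfl fun w _ => by rw [h.G, mul_comm, hF.inn_symm]

/-- The components in any frame are the values of one multilinear map on the frame vectors. In the
inductive step the corrections match because ∇ of a frame vector expands in the frame by `nab_eq`.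
-/
theorem nablaRiemann_eq (hF : F.IsRegular) (h : F.IsFrame A F') (p : ℕ)
    (I : Fin (4 + p) → Fin m) :
    F'.nablaRiemann p I = F.nablaTensor hF p fun a => A (I a) := by
  induction p with
  | zero => exact h.riemann_eq hF I
  | succ p ih =>
    change F'.covDeriv (F'.nablaRiemann p) I
      = F.dir (A (I (Fin.last (4 + p))))
          (F.nablaTensor hF p (Fin.init fun a => A (I a)))
        - ∑ a : Fin (4 + p), F.nablaTensor hF p (Function.update (Fin.init fun a => A (I a)) a
            (F.nab (A (I (Fin.last (4 + p)))) (A (I a.castSucc))))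
    rw [covDeriv, h.D, ih]
    congr 1
    refine Finset.sum_congr rfl fun a _ => ?_
    rw [← h.nab_eq hF, MultilinearMap.map_update_sum]
    refine Finset.sum_congr rfl fun b _ => ?_
    rw [MultilinearMap.map_update_smul, smul_eq_mul, ih]
    congr 2
    funext c
    by_cases hc : c = a
    · subst hc; simp
    · simp [Function.update_of_ne hc, Fin.init]

end IsFrame

theorem inn_single (i j : Fin m) :
    F.inn (Pi.single i 1) (Pi.single j 1) = F.G i j := by
  simp [inn, Pi.single_apply]

theorem isFrame_self (hF : F.IsRegular) : F.IsFrame (fun i => Pi.single i 1) F where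
  D s f := by simp [dir, Pi.single_apply]
  c a b := by
    have h1 : ∀ s, F.D s 1 = 0 := fun s => by
      have := hF.D_mul s 1 1
      simpa using this
    have hd : ∀ (s : Fin m) i j, F.D s ((Pi.single i 1 : Fin m → B) j) = 0 := by
      intro s i j
      by_cases hij : j = i
      · subst hij; simp [h1]
      · simp [Pi.single_eq_of_ne hij, hF.D_zero]
    funext t
    simp only [bracket, dir, hd]
    simp [Pi.single_apply, Finset.sum_apply]
  G i j := (inn_single i j).symm
  inv := hF.inv

/-- A contraction of multilinear maps with a matrix. -/
def contractTensor (C : FullContraction) (T : ∀ i : Fin C.factors,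
    MultilinearMap B (fun _ : Fin (4 + C.order i) => Fin m → B) B)
    (A : Fin m → Fin m → B) (H : Matrix (Fin m) (Fin m) B) : B :=
  ∑ I : (Σ i : Fin C.factors, Fin (4 + C.order i)) → Fin m,
    (∏ i, T i fun a => A (I ⟨i, a⟩)) *
      ∏ j, H (I (C.pairing.symm (j, 0))) (I (C.pairing.symm (j, 1)))

/-- Expanding every slot in the standard basis moves the matrices A onto the pairing factors, where
each pair of slots contributes one entry of Aᵀ H A independently of the others. -/
theorem contractTensor_frame (C : FullContraction) (T : ∀ i : Fin C.factors,
    MultilinearMap B (fun _ : Fin (4 + C.order i) => Fin m → B) B)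
    (A : Fin m → Fin m → B) (H : Matrix (Fin m) (Fin m) B) :
    contractTensor C T A H
      = contractTensor C T (fun i => Pi.single i 1)
          ((Matrix.of A).transpose * H * Matrix.of A) := by
  classical
  have hT : ∀ i (I : Fin (4 + C.order i) → Fin m), T i (fun a => A (I a))
      = ∑ J : Fin (4 + C.order i) → Fin m, (∏ a, A (I a) (J a)) *
          T i fun a => Pi.single (J a) 1 := by
    intro i I
    have : (fun a => A (I a)) = fun a => ∑ b, A (I a) b • (Pi.single b 1 : Fin m → B) := by
      funext a t
      simp [Finset.sum_apply, Pi.single_apply]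
    rw [this, MultilinearMap.map_sum]
    exact Finset.sum_congr rfl fun J _ => by rw [MultilinearMap.map_smul_univ, smul_eq_mul]
  have hprod : ∀ I : (Σ i : Fin C.factors, Fin (4 + C.order i)) → Fin m,
      ∏ i, T i (fun a => A (I ⟨i, a⟩))
      = ∑ J : (Σ i : Fin C.factors, Fin (4 + C.order i)) → Fin m,
          (∏ s, A (I s) (J s)) * ∏ i, T i fun a => Pi.single (J ⟨i, a⟩) 1 := by
    intro I
    simp only [hT]
    rw [Finset.prod_univ_sum]
    simp only [Fintype.piFinset_univ, Finset.prod_mul_distrib]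
    refine (Equiv.sum_comp (Equiv.piCurry fun _ _ => Fin m) _).symm.trans ?_
    refine Finset.sum_congr rfl fun J _ => ?_
    rw [Fintype.prod_sigma]
    rfl
  have hpair : ∀ J : (Σ i : Fin C.factors, Fin (4 + C.order i)) → Fin m,
      ∑ I : (Σ i : Fin C.factors, Fin (4 + C.order i)) → Fin m, (∏ s, A (I s) (J s)) *
        ∏ j, H (I (C.pairing.symm (j, 0))) (I (C.pairing.symm (j, 1)))
      = ∏ j, ((Matrix.of A).transpose * H * Matrix.of A) (J (C.pairing.symm (j, 0)))
          (J (C.pairing.symm (j, 1))) := by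
    intro J
    have e1 : ∀ i j, ((Matrix.of A).transpose * H * Matrix.of A) i j
        = ∑ v : Fin 2 → Fin m, A (v 0) i * A (v 1) j * H (v 0) (v 1) := by
      intro i j
      rw [← (finTwoArrowEquiv (Fin m)).symm.sum_comp, Fintype.sum_prod_type]
      simp only [Matrix.mul_apply, Matrix.transpose_apply, Matrix.of_apply, Finset.sum_mul]
      rw [Finset.sum_comm]
      exact Finset.sum_congr rfl fun _ _ => Finset.sum_congr rfl fun _ _ => by
        simp [finTwoArrowEquiv]; ring
    simp only [e1]
    rw [Finset.prod_univ_sum]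
    -- Through the pairing, an assignment of indices to slots is the same as two indices for each
    -- pair.
    rw [← Equiv.sum_comp ((Equiv.curry (Fin C.pairs) (Fin 2) (Fin m)).symm.trans
      (Equiv.arrowCongr C.pairing.symm (Equiv.refl _)))]
    simp only [Fintype.piFinset_univ, Finset.prod_mul_distrib]
    refine Finset.sum_congr rfl fun v _ => ?_
    rw [← Equiv.prod_comp C.pairing.symm, Fintype.prod_prod_type]
    simp [Fin.prod_univ_two, Equiv.arrowCongr, Finset.prod_mul_distrib]
  simp only [contractTensor, hprod, Finset.sum_mul, ← hpair, Finset.mul_sum]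
  rw [Finset.sum_comm]
  exact Finset.sum_congr rfl fun _ _ => Finset.sum_congr rfl fun _ _ => by ring

/-- Scalar invariants do not depend on the frame in which they are computed. -/
theorem IsFrame.invariant_eq {A : Fin m → Fin m → B} {F' : FrameData m B} (hF : F.IsRegular)
    (h : F.IsFrame A F') (P : ScalarInvariant) : F'.invariant P = F.invariant P := by
  -- The inverse metric transforms oppositely to the tensors, so the matrices A disappear from a
  -- full contraction.
  have hinv : (Matrix.of A).transpose * F'.Ginv * Matrix.of A = F.Ginv := by
    refine (left_inv_eq_right_inv hF.inv_left ?_).symm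
    rw [← mul_eq_one_comm.mp h.right_inv]
    simp only [Matrix.mul_assoc]
  have key : ∀ (A : Fin m → Fin m → B) (F' : FrameData m B), F.IsFrame A F' → ∀ C,
      F'.contract C = contractTensor C (fun i => F.nablaTensor hF (C.order i)) A F'.Ginv := by
    intro A F' h C
    simp only [contract, contractTensor, h.nablaRiemann_eq hF]
  refine Finset.sum_congr rfl fun C _ => ?_
  dsimp only
  rw [key A F' h, key _ F (isFrame_self hF), contractTensor_frame, hinv]

end FrameData

open Filter Asymptotics

/-! ### Functions near the boundary -/

section Boundary

variable {E : Type*} [NormedAddCommGroup E] [NormedSpace ℝ E] {u₀ : E} {f g : E × ℝ → ℝ}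

/-- The filter of punctured neighbourhoods `x > 0` of the boundary point `u₀`. -/
def bdry (u₀ : E) : Filter (E × ℝ) := 𝓝[{z | 0 < z.2}] (u₀, 0)

theorem isOpen_pos : IsOpen {z : E × ℝ | 0 < z.2} := isOpen_lt continuous_const continuous_snd

/-- The half space x > 0 is open, so what holds eventually holds on full neighbourhoods of nearby
points; this lets eventual equalities be differentiated. -/
theorem eventually_bdry_nhds {p : E × ℝ → Prop} (h : ∀ᶠ z in bdry u₀, p z) :
    ∀ᶠ z in bdry u₀, ∀ᶠ w in 𝓝 z, p w := by
  have h1 := eventually_eventually_nhdsWithin.mpr h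
  filter_upwards [h1, self_mem_nhdsWithin] with z hz hpos
  rwa [isOpen_pos.nhdsWithin_eq hpos] at hz

theorem bdry_pos : ∀ᶠ z in bdry u₀, 0 < z.2 := self_mem_nhdsWithin

theorem tendsto_fst_bdry : Tendsto Prod.fst (bdry u₀) (𝓝 u₀) :=
  (continuous_fst.tendsto (u₀, (0 : ℝ))).mono_left nhdsWithin_le_nhds

theorem tendsto_snd_bdry : Tendsto Prod.snd (bdry u₀) (𝓝[>] 0) :=
  tendsto_nhdsWithin_iff.mpr
    ⟨(continuous_snd.tendsto (u₀, (0 : ℝ))).mono_left nhdsWithin_le_nhds, bdry_pos⟩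

theorem bdry_eq : bdry u₀ = 𝓝 u₀ ×ˢ 𝓝[>] (0 : ℝ) := by
  rw [bdry, ← nhdsWithin_univ u₀, ← nhdsWithin_prod_eq]
  congr 1
  ext z
  simp

/-- `f` is smooth near the boundary point `u₀`, away from the boundary. -/
def SmoothNear (u₀ : E) (f : E × ℝ → ℝ) : Prop := ∀ᶠ z in bdry u₀, ContDiffAt ℝ ∞ f z

/-- All derivatives of `f` of order at most `J` are `O(x ^ R)`. -/
def DerivsBigO (u₀ : E) : ℕ → ℤ → (E × ℝ → ℝ) → Prop
  | 0, R, f => f =O[bdry u₀] fun z => z.2 ^ R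
  | J + 1, R, f => f =O[bdry u₀] (fun z => z.2 ^ R) ∧
      ∀ v, DerivsBigO u₀ J R fun z => fderiv ℝ f z v

theorem eventuallyEq_fderiv (h : f =ᶠ[bdry u₀] g) (v : E × ℝ) :
    (fun z => fderiv ℝ f z v) =ᶠ[bdry u₀] fun z => fderiv ℝ g z v := by
  filter_upwards [eventually_bdry_nhds h] with z hz
  rw [EventuallyEq.fderiv_eq hz]

namespace SmoothNear

theorem congr (hf : SmoothNear u₀ f) (h : f =ᶠ[bdry u₀] g) : SmoothNear u₀ g := by
  filter_upwards [hf, eventually_bdry_nhds h] with z h1 h2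
  exact h1.congr_of_eventuallyEq (EventuallyEq.symm h2)

theorem differentiableAt (hf : SmoothNear u₀ f) : ∀ᶠ z in bdry u₀, DifferentiableAt ℝ f z := by
  filter_upwards [hf] with z hz using hz.differentiableAt (by simp)

theorem add (hf : SmoothNear u₀ f) (hg : SmoothNear u₀ g) : SmoothNear u₀ (f + g) := by
  filter_upwards [hf, hg] with z h1 h2 using h1.add h2

theorem neg (hf : SmoothNear u₀ f) : SmoothNear u₀ (-f) := by
  filter_upwards [hf] with z h1 using h1.neg

theorem sub (hf : SmoothNear u₀ f) (hg : SmoothNear u₀ g) : SmoothNear u₀ (f - g) := by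
  filter_upwards [hf, hg] with z h1 h2 using h1.sub h2

theorem mul (hf : SmoothNear u₀ f) (hg : SmoothNear u₀ g) : SmoothNear u₀ (f * g) := by
  filter_upwards [hf, hg] with z h1 h2 using h1.mul h2

theorem const (c : ℝ) : SmoothNear u₀ fun _ => c := Eventually.of_forall fun _ => contDiffAt_const

theorem sum {ι : Type*} {s : Finset ι} {F : ι → E × ℝ → ℝ} (h : ∀ i ∈ s, SmoothNear u₀ (F i)) :
    SmoothNear u₀ (∑ i ∈ s, F i) :=
  Finset.sum_induction _ _ (fun _ _ => add) (const 0) h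

theorem fderiv_apply (hf : SmoothNear u₀ f) (v : E × ℝ) :
    SmoothNear u₀ fun z => fderiv ℝ f z v := by
  filter_upwards [hf] with z h1
  exact (h1.fderiv_right (m := ∞) (by simp)).clm_apply contDiffAt_const

theorem inv (hf : SmoothNear u₀ f) (h0 : ∀ᶠ z in bdry u₀, f z ≠ 0) : SmoothNear u₀ f⁻¹ := by
  filter_upwards [hf, h0] with z h1 h2 using h1.inv h2

theorem comp_fst {a : E → ℝ} (ha : ∀ᶠ u in 𝓝 u₀, ContDiffAt ℝ ∞ a u) :
    SmoothNear u₀ fun z => a z.1 := by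
  filter_upwards [tendsto_fst_bdry.eventually ha] with z hz
  exact hz.comp z contDiffAt_fst

theorem snd : SmoothNear u₀ (Prod.snd : E × ℝ → ℝ) := Eventually.of_forall fun _ => contDiffAt_snd

theorem zpow_mul_log_pow (k : ℤ) (p : ℕ) :
    SmoothNear u₀ fun z => z.2 ^ k * Real.log z.2 ^ p := by
  filter_upwards [bdry_pos] with z hz
  refine ContDiffAt.mul ?_ ((contDiffAt_snd.log hz.ne').pow p)
  cases k with
  | ofNat k => simpa using contDiffAt_snd.pow k
  | negSucc k =>
    simp only [zpow_negSucc]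
    exact (contDiffAt_snd.pow _).inv (pow_ne_zero _ hz.ne')

end SmoothNear

theorem zpow_isBigO {R R' : ℤ} (h : R' ≤ R) :
    (fun z : E × ℝ => z.2 ^ R) =O[bdry u₀] fun z => z.2 ^ R' := by
  refine IsBigO.of_bound 1 ?_
  have h1 : ∀ᶠ z in bdry u₀, z.2 < 1 :=
    tendsto_snd_bdry.eventually (nhdsWithin_le_nhds (gt_mem_nhds one_pos))
  filter_upwards [bdry_pos, h1] with z hz hz1
  rw [one_mul, Real.norm_of_nonneg (zpow_nonneg hz.le _), Real.norm_of_nonneg (zpow_nonneg hz.le _)]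
  exact zpow_le_zpow_right_of_le_one₀ hz hz1.le h

namespace DerivsBigO

theorem isBigO {J : ℕ} {R : ℤ} (hf : DerivsBigO u₀ J R f) :
    f =O[bdry u₀] fun z => z.2 ^ R := by
  cases J with
  | zero => exact hf
  | succ J => exact hf.1

theorem congr {J : ℕ} {R : ℤ} (hf : DerivsBigO u₀ J R f) (h : f =ᶠ[bdry u₀] g) :
    DerivsBigO u₀ J R g := by
  induction J generalizing f g with
  | zero => exact IsBigO.congr' hf h EventuallyEq.rfl
  | succ J ih =>
    exact ⟨hf.1.congr' h EventuallyEq.rfl, fun v => ih (hf.2 v) (eventuallyEq_fderiv h v)⟩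

theorem mono {J : ℕ} {R R' : ℤ} (hf : DerivsBigO u₀ J R f) (h : R' ≤ R) :
    DerivsBigO u₀ J R' f := by
  induction J generalizing f with
  | zero => exact IsBigO.trans hf (zpow_isBigO h)
  | succ J ih => exact ⟨hf.1.trans (zpow_isBigO h), fun v => ih (hf.2 v)⟩

theorem of_succ {J : ℕ} {R : ℤ} (hf : DerivsBigO u₀ (J + 1) R f) : DerivsBigO u₀ J R f := by
  induction J generalizing f with
  | zero => exact hf.1
  | succ J ih => exact ⟨hf.1, fun v => ih (hf.2 v)⟩

theorem add {J : ℕ} {R : ℤ} (sf : SmoothNear u₀ f) (sg : SmoothNear u₀ g)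
    (hf : DerivsBigO u₀ J R f) (hg : DerivsBigO u₀ J R g) : DerivsBigO u₀ J R (f + g) := by
  induction J generalizing f g with
  | zero => exact IsBigO.add hf hg
  | succ J ih =>
    refine ⟨hf.1.add hg.1, fun v =>
      (ih (sf.fderiv_apply v) (sg.fderiv_apply v) (hf.2 v) (hg.2 v)).congr ?_⟩
    filter_upwards [sf.differentiableAt, sg.differentiableAt] with z h1 h2
    simp [fderiv_add h1 h2]

theorem mul {J : ℕ} {R R' : ℤ} (sf : SmoothNear u₀ f) (sg : SmoothNear u₀ g)
    (hf : DerivsBigO u₀ J R f) (hg : DerivsBigO u₀ J R' g) :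
    DerivsBigO u₀ J (R + R') (f * g) := by
  have key : ∀ {f g : E × ℝ → ℝ}, f =O[bdry u₀] (fun z => z.2 ^ R) →
      g =O[bdry u₀] (fun z => z.2 ^ R') → (f * g) =O[bdry u₀] fun z => z.2 ^ (R + R') := by
    intro f g hf hg
    refine (hf.mul hg).congr' EventuallyEq.rfl ?_
    filter_upwards [bdry_pos] with z hz
    rw [zpow_add₀ hz.ne']
  induction J generalizing f g with
  | zero => exact key hf hg
  | succ J ih =>
    refine ⟨key hf.1 hg.1, fun v => (add ((sf.fderiv_apply v).mul sg) (sf.mul (sg.fderiv_apply v))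
      (ih (sf.fderiv_apply v) sg (hf.2 v) hg.of_succ)
      (ih sf (sg.fderiv_apply v) hf.of_succ (hg.2 v))).congr ?_⟩
    filter_upwards [sf.differentiableAt, sg.differentiableAt] with z h1 h2
    simp [fderiv_mul h1 h2]
    ring

theorem zero (J : ℕ) (R : ℤ) : DerivsBigO u₀ J R (0 : E × ℝ → ℝ) := by
  induction J with
  | zero => exact isBigO_zero _ _
  | succ J ih => exact ⟨isBigO_zero _ _, fun v => by simpa [Pi.zero_def] using! ih⟩

theorem comp_fst (J : ℕ) {a : E → ℝ} (ha : ∀ᶠ u in 𝓝 u₀, ContDiffAt ℝ ∞ a u) :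
    DerivsBigO u₀ J 0 fun z => a z.1 := by
  have key : ∀ {a : E → ℝ}, (∀ᶠ u in 𝓝 u₀, ContDiffAt ℝ ∞ a u) →
      (fun z : E × ℝ => a z.1) =O[bdry u₀] fun z => z.2 ^ (0 : ℤ) := by
    intro a ha
    simp only [zpow_zero]
    exact ((ha.self_of_nhds.continuousAt.tendsto).comp tendsto_fst_bdry).isBigO_one ℝ
  induction J generalizing a with
  | zero => exact key ha
  | succ J ih =>
    refine ⟨key ha, fun v => (ih (a := fun u => fderiv ℝ a u v.1) ?_).congr ?_⟩
    · filter_upwards [ha] with u hu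
      exact (hu.fderiv_right (m := ∞) (by simp)).clm_apply contDiffAt_const
    · filter_upwards [tendsto_fst_bdry.eventually ha] with z hz
      have h1 : HasFDerivAt a (fderiv ℝ a z.1) z.1 :=
        (hz.differentiableAt (by simp)).hasFDerivAt
      have h2 := h1.comp z (hasFDerivAt_fst (𝕜 := ℝ) (E := E) (F := ℝ))
      simp only [Function.comp_def] at h2
      rw [h2.fderiv]
      simp

theorem const (J : ℕ) (c : ℝ) : DerivsBigO u₀ J 0 fun _ => c :=
  comp_fst J (Eventually.of_forall fun _ => contDiffAt_const)

theorem const_mul {J : ℕ} {R : ℤ} (c : ℝ) (sf : SmoothNear u₀ f) (hf : DerivsBigO u₀ J R f) :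
    DerivsBigO u₀ J R ((fun _ => c) * f) := by
  simpa using mul (SmoothNear.const c) sf (const J c) hf

theorem neg {J : ℕ} {R : ℤ} (sf : SmoothNear u₀ f) (hf : DerivsBigO u₀ J R f) :
    DerivsBigO u₀ J R (-f) :=
  (const_mul (-1) sf hf).congr (Eventually.of_forall fun z => by simp)

theorem sub {J : ℕ} {R : ℤ} (sf : SmoothNear u₀ f) (sg : SmoothNear u₀ g)
    (hf : DerivsBigO u₀ J R f) (hg : DerivsBigO u₀ J R g) : DerivsBigO u₀ J R (f - g) := by
  rw [sub_eq_add_neg]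
  exact add sf sg.neg hf (neg sg hg)

theorem sum {J : ℕ} {R : ℤ} {ι : Type*} {s : Finset ι} {F : ι → E × ℝ → ℝ}
    (hs : ∀ i ∈ s, SmoothNear u₀ (F i)) (h : ∀ i ∈ s, DerivsBigO u₀ J R (F i)) :
    DerivsBigO u₀ J R (∑ i ∈ s, F i) :=
  (Finset.sum_induction F (fun f => SmoothNear u₀ f ∧ DerivsBigO u₀ J R f)
    (fun _ _ h h' => ⟨h.1.add h'.1, add h.1 h'.1 h.2 h'.2⟩) ⟨SmoothNear.const 0, zero J R⟩
    fun i hi => ⟨hs i hi, h i hi⟩).2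

/-- Each derivative costs one power of x, and one further power absorbs the logarithms. The loss is
harmless, since expansions are available to every order. -/
theorem zpow_mul_log_pow (J : ℕ) (k : ℤ) (p : ℕ) :
    DerivsBigO u₀ J (k - 1 - J) fun z => z.2 ^ k * Real.log z.2 ^ p := by
  have key : ∀ (k : ℤ) (p : ℕ), (fun z : E × ℝ => z.2 ^ k * Real.log z.2 ^ p)
      =O[bdry u₀] fun z => z.2 ^ (k - 1) := by
    intro k p
    have h1 : (fun x : ℝ => Real.log x ^ p) =O[𝓝[>] 0] fun x => x⁻¹ := by
      have h2 := (Real.isLittleO_pow_log_id_atTop (n := p)).isBigO.comp_tendsto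
        (tendsto_inv_nhdsGT_zero (𝕜 := ℝ))
      refine IsBigO.of_norm_left (h2.norm_left.congr_left fun x => ?_)
      simp [Real.log_inv]
    have h2 := (isBigO_refl (fun z : E × ℝ => z.2 ^ k) (bdry u₀)).mul
      (h1.comp_tendsto tendsto_snd_bdry)
    refine h2.congr' EventuallyEq.rfl ?_
    filter_upwards [bdry_pos] with z hz
    rw [zpow_sub_one₀ hz.ne']
    rfl
  induction J generalizing k p with
  | zero => simpa [DerivsBigO] using key k p
  | succ J ih =>
    refine ⟨(key k p).trans (zpow_isBigO (by push_cast; omega)), fun v => ?_⟩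
    have h1 := const_mul (v.2 * k) (SmoothNear.zpow_mul_log_pow (u₀ := u₀) (k - 1) p) (ih (k - 1) p)
    have h2 := const_mul (v.2 * p) (SmoothNear.zpow_mul_log_pow (u₀ := u₀) (k - 1) (p - 1))
      (ih (k - 1) (p - 1))
    have h3 := add ((SmoothNear.const _).mul (SmoothNear.zpow_mul_log_pow _ _))
      ((SmoothNear.const _).mul (SmoothNear.zpow_mul_log_pow _ _)) h1 h2
    refine (h3.mono (by push_cast; omega)).congr ?_
    filter_upwards [bdry_pos] with z hz
    have hd : HasDerivAt (fun x : ℝ => x ^ k * Real.log x ^ p)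
        (k * z.2 ^ (k - 1) * Real.log z.2 ^ p
          + z.2 ^ k * (p * Real.log z.2 ^ (p - 1) * z.2⁻¹)) z.2 :=
      (hasDerivAt_zpow k z.2 (Or.inl hz.ne')).mul ((Real.hasDerivAt_log hz.ne').pow p)
    have h4 := hd.hasFDerivAt.comp z (hasFDerivAt_snd (𝕜 := ℝ) (E := E) (F := ℝ))
    simp only [Function.comp_def] at h4
    rw [h4.fderiv]
    simp [zpow_sub_one₀ hz.ne']
    ring

/-- The derivative of 1/f is −f'/f², so a bound on J derivatives of 1/f gives one on J + 1. The
exponent obtained is crude; only its existence matters. -/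
theorem inv (sf : SmoothNear u₀ f) (hf : ∀ J, ∃ R, DerivsBigO u₀ J R f)
    (h0 : f⁻¹ =O[bdry u₀] fun z => z.2 ^ (0 : ℤ)) (hne : ∀ᶠ z in bdry u₀, f z ≠ 0) (J : ℕ) :
    ∃ R, DerivsBigO u₀ J R f⁻¹ := by
  induction J with
  | zero => exact ⟨0, h0⟩
  | succ J ih =>
    obtain ⟨R, hR⟩ := ih
    obtain ⟨R', hR'⟩ := hf (J + 1)
    have si := sf.inv hne
    refine ⟨min 0 (R' + R + R), h0.trans (zpow_isBigO (min_le_left _ _)), fun v => ?_⟩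
    have h1 := mul ((sf.fderiv_apply v).mul si) si (mul (sf.fderiv_apply v) si (hR'.2 v) hR) hR
    refine ((neg (((sf.fderiv_apply v).mul si).mul si) h1).mono (min_le_right _ _)).congr ?_
    filter_upwards [sf.differentiableAt, hne] with z h2 h3
    have h4 := (hasDerivAt_inv h3).comp_hasFDerivAt z h2.hasFDerivAt
    have h5 : fderiv ℝ f⁻¹ z = (-(f z ^ 2)⁻¹) • fderiv ℝ f z := h4.fderiv
    rw [h5]
    simp
    field_simp

/-! #### Comparison with bounds for the iterated derivatives -/

theorem of_iteratedFDeriv {J : ℕ} {R : ℤ} (sf : SmoothNear u₀ f)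
    (h : ∀ j ≤ J, (fun z => iteratedFDeriv ℝ j f z) =O[bdry u₀] fun z => z.2 ^ R) :
    DerivsBigO u₀ J R f := by
  have h0 : f =O[bdry u₀] fun z => z.2 ^ R := by
    refine IsBigO.of_norm_left ((h 0 (Nat.zero_le _)).norm_left.congr_left fun z => ?_)
    simp
  induction J generalizing f with
  | zero => exact h0
  | succ J ih =>
    refine ⟨h0, fun v => ?_⟩
    have key : ∀ j ≤ J, (fun z => iteratedFDeriv ℝ j (fun z => fderiv ℝ f z v) z)
        =O[bdry u₀] fun z => z.2 ^ R := by
      intro j hj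
      refine IsBigO.trans (IsBigO.of_bound ‖v‖ ?_) (h (j + 1) (by omega))
      filter_upwards [sf] with z hz
      refine (norm_iteratedFDeriv_clm_apply_const (N := ∞)
        (hz.fderiv_right (m := ∞) (by simp)) (by exact_mod_cast le_top)).trans ?_
      rw [norm_iteratedFDeriv_fderiv]
    refine ih (sf.fderiv_apply v) key ?_
    refine IsBigO.of_norm_left ((key 0 (Nat.zero_le _)).norm_left.congr_left fun z => ?_)
    simp

/-- The full derivative is recovered from the directional ones along a finite basis. This converts
back to the norm bounds in which `HasPhgExpansionOn` is stated. -/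
theorem iteratedFDeriv_isBigO [FiniteDimensional ℝ E] {J : ℕ} {R : ℤ} (sf : SmoothNear u₀ f)
    (h : DerivsBigO u₀ J R f) :
    (fun z => iteratedFDeriv ℝ J f z) =O[bdry u₀] fun z => z.2 ^ R := by
  induction J generalizing f with
  | zero =>
    refine IsBigO.of_norm_left ((IsBigO.norm_left h).congr_left fun z => ?_)
    simp
  | succ J ih =>
    let b := Module.finBasis ℝ (E × ℝ)
    let L := fun i => LinearMap.toContinuousLinearMap (b.coord i)
    let M : _ → ℝ →L[ℝ] (E × ℝ →L[ℝ] ℝ) := fun i => (ContinuousLinearMap.toSpanSingleton ℝ (L i))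
    have e : fderiv ℝ f = ∑ i, M i ∘ fun z => fderiv ℝ f z (b i) := by
      funext z
      refine ContinuousLinearMap.ext fun v => ?_
      have hv : fderiv ℝ f z v = ∑ i, b.repr v i * fderiv ℝ f z (b i) := by
        conv_lhs => rw [← b.sum_repr v, map_sum]
        simp only [map_smul, smul_eq_mul]
      rw [hv]
      simp [M, L, Finset.sum_apply, mul_comm]
    have h1 : (fun z => ∑ i, iteratedFDeriv ℝ J (M i ∘ fun z => fderiv ℝ f z (b i)) z)
        =O[bdry u₀] fun z => z.2 ^ R := by
      refine IsBigO.fun_sum fun i _ =>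
        IsBigO.trans (IsBigO.of_bound ‖M i‖ ?_) (ih (sf.fderiv_apply (b i)) (h.2 (b i)))
      filter_upwards [sf.fderiv_apply (b i)] with z hz
      exact (M i).norm_iteratedFDeriv_comp_left hz (by exact_mod_cast le_top)
    refine IsBigO.of_norm_left (h1.norm_left.congr' ?_ EventuallyEq.rfl)
    have h2 : ∀ᶠ z in bdry u₀, ∀ i, ContDiffAt ℝ ∞ (fun z => fderiv ℝ f z (b i)) z :=
      eventually_all.mpr fun i => sf.fderiv_apply (b i)
    filter_upwards [h2] with z hz
    rw [← norm_iteratedFDeriv_fderiv, congrArg (fun F => iteratedFDeriv ℝ J F z) e,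
      iteratedFDeriv_sum_apply]
    intro i _
    exact (M i).contDiff.contDiffAt.comp z ((hz i).of_le (by exact_mod_cast le_top))

end DerivsBigO

end Boundary

/-! ### Formal polyhomogeneous series -/

/-- Formal series `∑ a_{k,p} x^k (log x)^p`, whose coefficients are functions on `E`: power series
in `x` over the polynomials in `log x`. -/
abbrev FormalSeries (E : Type*) : Type _ := PowerSeries (Polynomial (E → ℝ))

section Formal

variable {E : Type*}

/-- Functions on `E`, as functions on `E × ℝ`. -/
def pullbackFst : (E → ℝ) →+* (E × ℝ → ℝ) where
  toFun a z := a z.1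
  map_one' := rfl
  map_mul' _ _ := rfl
  map_zero' := rfl
  map_add' _ _ := rfl

@[simp]
theorem pullbackFst_apply (a : E → ℝ) (z : E × ℝ) : pullbackFst a z = a z.1 := rfl

/-- The function `∑ a_p (log x)^p` of a polynomial in `log x`. -/
def evalLog : Polynomial (E → ℝ) →+* (E × ℝ → ℝ) :=
  Polynomial.eval₂RingHom pullbackFst fun z => Real.log z.2

/-- The function `∑ a_{k,p} x^k (log x)^p` of a finite formal series. -/
def evalSeries : Polynomial (Polynomial (E → ℝ)) →+* (E × ℝ → ℝ) :=
  Polynomial.eval₂RingHom evalLog Prod.snd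

theorem evalLog_eq_sum (a : Polynomial (E → ℝ)) {n : ℕ} (hn : a.natDegree < n) (z : E × ℝ) :
    evalLog a z = ∑ p ∈ Finset.range n, a.coeff p z.1 * Real.log z.2 ^ p := by
  rw [evalLog, Polynomial.coe_eval₂RingHom, Polynomial.eval₂_eq_sum_range' _ hn]
  simp [Finset.sum_apply]

theorem evalSeries_eq_sum (Q : Polynomial (Polynomial (E → ℝ))) {n : ℕ} (hn : Q.natDegree < n)
    (z : E × ℝ) : evalSeries Q z = ∑ k ∈ Finset.range n, evalLog (Q.coeff k) z * z.2 ^ k := by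
  rw [evalSeries, Polynomial.coe_eval₂RingHom, Polynomial.eval₂_eq_sum_range' _ hn]
  simp [Finset.sum_apply]

theorem evalSeries_trunc (A : FormalSeries E) (M : ℕ) (z : E × ℝ) :
    evalSeries (PowerSeries.trunc M A) z
      = ∑ k ∈ Finset.range M, evalLog (PowerSeries.coeff k A) z * z.2 ^ k := by
  rcases M with _ | M
  · simp
  · rw [evalSeries_eq_sum _ (PowerSeries.natDegree_trunc_lt A M)]
    refine Finset.sum_congr rfl fun k hk => ?_
    rw [PowerSeries.coeff_trunc, if_pos (Finset.mem_range.mp hk)]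

theorem evalLog_monomial (p : ℕ) (b : E → ℝ) (z : E × ℝ) :
    evalLog (Polynomial.monomial p b) z = b z.1 * Real.log z.2 ^ p := by
  simp [evalLog]

end Formal

/-! ### Functions with a polyhomogeneous expansion at a boundary point -/

section Phg

variable {E : Type*} [NormedAddCommGroup E] [NormedSpace ℝ E] {u₀ : E} {f g : E × ℝ → ℝ}

/-- The coefficients of a polynomial in `log x` are smooth near `u₀`. -/
def SmoothCoeffs (u₀ : E) (a : Polynomial (E → ℝ)) : Prop :=
  ∀ p, ∀ᶠ u in 𝓝 u₀, ContDiffAt ℝ ∞ (a.coeff p) u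

namespace SmoothCoeffs

variable {a b : Polynomial (E → ℝ)}

theorem add (ha : SmoothCoeffs u₀ a) (hb : SmoothCoeffs u₀ b) : SmoothCoeffs u₀ (a + b) := by
  intro p
  filter_upwards [ha p, hb p] with u h1 h2
  rw [Polynomial.coeff_add]
  exact h1.add h2

theorem C {c : E → ℝ} (hc : ∀ᶠ u in 𝓝 u₀, ContDiffAt ℝ ∞ c u) :
    SmoothCoeffs u₀ (Polynomial.C c) := by
  intro p
  rw [Polynomial.coeff_C]
  split_ifs
  · exact hc
  · exact Eventually.of_forall fun _ => contDiffAt_const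

theorem zero : SmoothCoeffs u₀ 0 := fun p => by
  rw [Polynomial.coeff_zero]
  exact Eventually.of_forall fun _ => contDiffAt_const

theorem sum {ι : Type*} {s : Finset ι} {F : ι → Polynomial (E → ℝ)}
    (h : ∀ i ∈ s, SmoothCoeffs u₀ (F i)) : SmoothCoeffs u₀ (∑ i ∈ s, F i) :=
  Finset.sum_induction _ _ (fun _ _ => add) zero h

theorem mul (ha : SmoothCoeffs u₀ a) (hb : SmoothCoeffs u₀ b) : SmoothCoeffs u₀ (a * b) := by
  intro p
  rw [Polynomial.coeff_mul]
  have h : ∀ x ∈ Finset.HasAntidiagonal.antidiagonal p,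
      ∀ᶠ u in 𝓝 u₀, ContDiffAt ℝ ∞ (a.coeff x.1 * b.coeff x.2) u := fun x _ => by
    filter_upwards [ha x.1, hb x.2] with u h1 h2 using h1.mul h2
  filter_upwards [(Finset.eventually_all _).mpr h] with u hu
  have := ContDiffAt.sum hu
  convert this using 1
  funext v
  simp [Finset.sum_apply]

theorem neg (ha : SmoothCoeffs u₀ a) : SmoothCoeffs u₀ (-a) := by
  intro p
  filter_upwards [ha p] with u h1
  rw [Polynomial.coeff_neg]
  exact h1.neg

theorem sub (ha : SmoothCoeffs u₀ a) (hb : SmoothCoeffs u₀ b) : SmoothCoeffs u₀ (a - b) := by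
  rw [sub_eq_add_neg]
  exact ha.add hb.neg

theorem derivative (ha : SmoothCoeffs u₀ a) : SmoothCoeffs u₀ (Polynomial.derivative a) := by
  intro p
  rw [Polynomial.coeff_derivative]
  filter_upwards [ha (p + 1)] with u h
  exact h.mul (contDiffAt_const (c := (p : ℝ) + 1))

end SmoothCoeffs

/-- A finite series without terms below x^M lies within the error that `IsPhg` allows at M, by the
termwise bound `DerivsBigO.zpow_mul_log_pow`. -/
theorem smoothNear_evalSeries {Q : Polynomial (Polynomial (E → ℝ))}
    (hQ : ∀ k, SmoothCoeffs u₀ (Q.coeff k)) : SmoothNear u₀ (evalSeries Q) ∧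
      ∀ (M J : ℕ), (∀ k < M, Q.coeff k = 0) → DerivsBigO u₀ J (M - 1 - J) (evalSeries Q) := by
  have e : evalSeries Q = ∑ k ∈ Finset.range (Q.natDegree + 1),
      ∑ p ∈ Finset.range ((Q.coeff k).natDegree + 1),
        (fun z : E × ℝ => (Q.coeff k).coeff p z.1) *
          fun z : E × ℝ => z.2 ^ (k : ℤ) * Real.log z.2 ^ p := by
    funext z
    rw [evalSeries_eq_sum Q (Nat.lt_succ_self _)]
    simp only [Finset.sum_apply, Pi.mul_apply]
    refine Finset.sum_congr rfl fun k _ => ?_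
    rw [evalLog_eq_sum _ (Nat.lt_succ_self _), Finset.sum_mul]
    refine Finset.sum_congr rfl fun p _ => ?_
    rw [zpow_natCast]
    ring
  have hs : ∀ k p, SmoothNear u₀ ((fun z : E × ℝ => (Q.coeff k).coeff p z.1) *
      fun z : E × ℝ => z.2 ^ (k : ℤ) * Real.log z.2 ^ p) := fun k p =>
    (SmoothNear.comp_fst (hQ k p)).mul (SmoothNear.zpow_mul_log_pow _ _)
  refine ⟨e ▸ SmoothNear.sum fun k _ => SmoothNear.sum fun p _ => hs k p, fun M J hM => ?_⟩
  rw [e]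
  refine DerivsBigO.sum (fun k _ => SmoothNear.sum fun p _ => hs k p) fun k _ =>
    DerivsBigO.sum (fun p _ => hs k p) fun p _ => ?_
  by_cases hk : k < M
  · rw [hM k hk]
    exact (DerivsBigO.zero J _).congr (Eventually.of_forall fun z => by simp)
  · refine (DerivsBigO.mul (SmoothNear.comp_fst (hQ k p)) (SmoothNear.zpow_mul_log_pow _ _)
      (DerivsBigO.comp_fst J (hQ k p)) (DerivsBigO.zpow_mul_log_pow J k p)).mono ?_
    push Not at hk
    have : (M : ℤ) ≤ k := by exact_mod_cast hk
    linarith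

/-- `f` is smooth near the boundary point `u₀` with polyhomogeneous expansion `A` there, in which
`x^k` comes with at most the power `L k` of `log x`. -/
structure IsPhg (u₀ : E) (L : ℕ → ℕ) (f : E × ℝ → ℝ) (A : FormalSeries E) : Prop where
  smooth : SmoothNear u₀ f
  coeff : ∀ k, SmoothCoeffs u₀ (PowerSeries.coeff k A)
  natDegree : ∀ k, (PowerSeries.coeff k A).natDegree ≤ L k
  bound : ∀ J M : ℕ, DerivsBigO u₀ J (M - 1 - J) (f - evalSeries (PowerSeries.trunc M A))

variable {L : ℕ → ℕ} {A B : FormalSeries E}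

theorem smoothCoeffs_trunc (hA : ∀ k, SmoothCoeffs u₀ (PowerSeries.coeff k A)) (M k : ℕ) :
    SmoothCoeffs u₀ ((PowerSeries.trunc M A).coeff k) := by
  rw [PowerSeries.coeff_trunc]
  split_ifs
  · exact hA k
  · exact SmoothCoeffs.zero

/-- The approximant Q may carry arbitrary smooth-coefficient terms of order at least M, as these lie
within the error allowed at M. Hence products of truncations need not be truncated again, and
wasteful exponents are repaired by approximating to higher order. -/
theorem IsPhg.of_approx (hf : SmoothNear u₀ f)
    (hA : ∀ k, SmoothCoeffs u₀ (PowerSeries.coeff k A))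
    (hL : ∀ k, (PowerSeries.coeff k A).natDegree ≤ L k)
    (h : ∀ (R : ℤ) (J M : ℕ), ∃ Q : Polynomial (Polynomial (E → ℝ)),
      (∀ k, SmoothCoeffs u₀ (Q.coeff k)) ∧ (∀ k < M, Q.coeff k = PowerSeries.coeff k A) ∧
        DerivsBigO u₀ J R (f - evalSeries Q)) : IsPhg u₀ L f A where
  smooth := hf
  coeff := hA
  natDegree := hL
  bound J M := by
    obtain ⟨Q, hQ, hQA, hb⟩ := h (M - 1 - J) J M
    have hs : ∀ k, SmoothCoeffs u₀ ((Q - PowerSeries.trunc M A).coeff k) := fun k => by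
      rw [Polynomial.coeff_sub]
      exact (hQ k).sub (smoothCoeffs_trunc hA M k)
    have h1 := (smoothNear_evalSeries hs).2 M J fun k hk => by
      rw [Polynomial.coeff_sub, PowerSeries.coeff_trunc, if_pos hk, hQA k hk, sub_self]
    refine (DerivsBigO.add (hf.sub (smoothNear_evalSeries hQ).1) (smoothNear_evalSeries hs).1
      hb h1).congr (Eventually.of_forall fun z => ?_)
    rw [RingHom.map_sub evalSeries Q]
    simp

namespace IsPhg

theorem congr (hf : IsPhg u₀ L f A) (h : f =ᶠ[bdry u₀] g) : IsPhg u₀ L g A where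
  smooth := hf.smooth.congr h
  coeff := hf.coeff
  natDegree := hf.natDegree
  bound J M := (hf.bound J M).congr (h.sub EventuallyEq.rfl)

theorem smooth_trunc (hf : IsPhg u₀ L f A) (M : ℕ) :
    SmoothNear u₀ (evalSeries (PowerSeries.trunc M A)) :=
  (smoothNear_evalSeries (smoothCoeffs_trunc hf.coeff M)).1

theorem moderate (hf : IsPhg u₀ L f A) (J : ℕ) : DerivsBigO u₀ J (-1 - J) f := by
  refine (hf.bound J 0).congr (Eventually.of_forall fun z => ?_) |>.mono (by simp)
  simp

theorem trunc_moderate (hA : ∀ k, SmoothCoeffs u₀ (PowerSeries.coeff k A)) (M J : ℕ) :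
    DerivsBigO u₀ J (-1 - J) (evalSeries (PowerSeries.trunc M A)) := by
  simpa using (smoothNear_evalSeries (smoothCoeffs_trunc hA M)).2 0 J (by simp)

theorem bound_of_le (hf : IsPhg u₀ L f A) (R : ℤ) (J M : ℕ) :
    ∃ N, M ≤ N ∧ DerivsBigO u₀ J R (f - evalSeries (PowerSeries.trunc N A)) := by
  refine ⟨max M (R + 1 + J).toNat, le_max_left _ _, (hf.bound J _).mono ?_⟩
  have := Int.self_le_toNat (R + 1 + J)
  push_cast
  omega

theorem add (hf : IsPhg u₀ L f A) (hg : IsPhg u₀ L g B) : IsPhg u₀ L (f + g) (A + B) where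
  smooth := hf.smooth.add hg.smooth
  coeff k := by
    rw [map_add]
    exact (hf.coeff k).add (hg.coeff k)
  natDegree k := by
    rw [map_add]
    exact Polynomial.natDegree_add_le_of_degree_le (hf.natDegree k) (hg.natDegree k)
  bound J M := by
    refine (DerivsBigO.add (hf.smooth.sub (hf.smooth_trunc M)) (hg.smooth.sub (hg.smooth_trunc M))
      (hf.bound J M) (hg.bound J M)).congr (Eventually.of_forall fun z => ?_)
    simp
    ring

theorem const {c : ℝ} :
    IsPhg u₀ L (fun _ => c) (PowerSeries.C (Polynomial.C fun _ : E => c)) := by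
  have hc : ∀ k, SmoothCoeffs u₀ (PowerSeries.coeff k
      (PowerSeries.C (Polynomial.C fun _ : E => c))) := fun k => by
    rw [PowerSeries.coeff_C]
    split_ifs
    · exact SmoothCoeffs.C (Eventually.of_forall fun _ => contDiffAt_const)
    · exact SmoothCoeffs.zero
  refine of_approx (SmoothNear.const c) hc (fun k => ?_) fun R J M =>
    ⟨Polynomial.C (Polynomial.C fun _ => c), fun k => ?_, fun k _ => ?_,
      (DerivsBigO.zero J R).congr (Eventually.of_forall fun z => ?_)⟩
  · rw [PowerSeries.coeff_C]
    split_ifs <;> simp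
  · have := hc k
    rwa [PowerSeries.coeff_C, ← Polynomial.coeff_C] at this
  · rw [PowerSeries.coeff_C, Polynomial.coeff_C]
  · simp [evalSeries, evalLog]

theorem coeff_trunc_mul {M N k : ℕ} (hM : k < M) (hN : k < N) :
    (PowerSeries.trunc M A * PowerSeries.trunc N B).coeff k = PowerSeries.coeff k (A * B) := by
  rw [Polynomial.coeff_mul, PowerSeries.coeff_mul]
  refine Finset.sum_congr rfl fun x hx => ?_
  have := Finset.HasAntidiagonal.mem_antidiagonal.mp hx
  rw [PowerSeries.coeff_trunc, PowerSeries.coeff_trunc, if_pos (by omega), if_pos (by omega)]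

theorem smoothCoeffs_mul {P Q : Polynomial (Polynomial (E → ℝ))}
    (hP : ∀ k, SmoothCoeffs u₀ (P.coeff k)) (hQ : ∀ k, SmoothCoeffs u₀ (Q.coeff k)) (k : ℕ) :
    SmoothCoeffs u₀ ((P * Q).coeff k) := by
  rw [Polynomial.coeff_mul]
  exact SmoothCoeffs.sum fun x _ => (hP x.1).mul (hQ x.2)

/-- With truncations A_N and B_N', f g − A_N B_N' = (f − A_N) g + A_N (g − B_N'), and each term is a
small factor times one of controlled growth. Superadditivity of L bounds the powers of log x in A B.
-/
theorem mul (hL : ∀ i j, L i + L j ≤ L (i + j)) (hf : IsPhg u₀ L f A) (hg : IsPhg u₀ L g B) :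
    IsPhg u₀ L (f * g) (A * B) := by
  refine of_approx (hf.smooth.mul hg.smooth) (fun k => ?_) (fun k => ?_) fun R J M => ?_
  · rw [PowerSeries.coeff_mul]
    exact SmoothCoeffs.sum fun x _ => (hf.coeff x.1).mul (hg.coeff x.2)
  · rw [PowerSeries.coeff_mul]
    refine Polynomial.natDegree_sum_le_of_forall_le _ _ fun x hx => ?_
    refine Polynomial.natDegree_mul_le.trans
      ((add_le_add (hf.natDegree _) (hg.natDegree _)).trans ?_)
    rw [← Finset.HasAntidiagonal.mem_antidiagonal.mp hx]
    exact hL _ _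
  -- The extra 1 + J offsets the exponent −1 − J of the other factor in `moderate` and
  -- `trunc_moderate`.
  · obtain ⟨N, hMN, hN⟩ := hf.bound_of_le (R + 1 + J) J M
    obtain ⟨N', hMN', hN'⟩ := hg.bound_of_le (R + 1 + J) J M
    have s1 := hf.smooth.sub (hf.smooth_trunc N)
    have s2 := hg.smooth.sub (hg.smooth_trunc N')
    refine ⟨PowerSeries.trunc N A * PowerSeries.trunc N' B,
      smoothCoeffs_mul (smoothCoeffs_trunc hf.coeff N) (smoothCoeffs_trunc hg.coeff N'),
      fun k hk => coeff_trunc_mul (hk.trans_le hMN) (hk.trans_le hMN'), ?_⟩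
    have h1 := DerivsBigO.mul s1 hg.smooth hN (hg.moderate J)
    have h2 := DerivsBigO.mul (hf.smooth_trunc N) s2 (trunc_moderate hf.coeff N J) hN'
    refine (DerivsBigO.add (s1.mul hg.smooth) ((hf.smooth_trunc N).mul s2) (h1.mono (by linarith))
      (h2.mono (by linarith))).congr (Eventually.of_forall fun z => ?_)
    simp
    ring

end IsPhg

/-- The coefficientwise derivative of a polynomial in `log x`. -/
def coeffDeriv (w : E) (a : Polynomial (E → ℝ)) : Polynomial (E → ℝ) :=
  ∑ p ∈ Finset.range (a.natDegree + 1), Polynomial.monomial p fun u => fderiv ℝ (a.coeff p) u w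

theorem coeff_coeffDeriv (w : E) (a : Polynomial (E → ℝ)) (p : ℕ) :
    (coeffDeriv w a).coeff p = fun u => fderiv ℝ (a.coeff p) u w := by
  rw [coeffDeriv, Polynomial.finsetSum_coeff]
  simp only [Polynomial.coeff_monomial, Finset.sum_ite_eq', Finset.mem_range]
  split_ifs with h
  · rfl
  · rw [Polynomial.coeff_eq_zero_of_natDegree_lt (by omega)]
    funext u
    simp [Pi.zero_def]

theorem natDegree_coeffDeriv_le (w : E) (a : Polynomial (E → ℝ)) :
    (coeffDeriv w a).natDegree ≤ a.natDegree := by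
  refine Polynomial.natDegree_sum_le_of_forall_le _ _ fun p hp => ?_
  exact (Polynomial.natDegree_monomial_le _).trans (Nat.lt_succ_iff.mp (Finset.mem_range.mp hp))

theorem SmoothCoeffs.coeffDeriv {a : Polynomial (E → ℝ)} (ha : SmoothCoeffs u₀ a) (w : E) :
    SmoothCoeffs u₀ (coeffDeriv w a) := by
  intro p
  rw [coeff_coeffDeriv]
  filter_upwards [ha p] with u hu
  exact (hu.fderiv_right (m := ∞) (by simp)).clm_apply contDiffAt_const

/-- The formal derivative `x ∂_v` in the direction of `v`. -/
def formalDeriv (v : E × ℝ) (A : FormalSeries E) : FormalSeries E :=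
  PowerSeries.X * PowerSeries.mk (fun k => coeffDeriv v.1 (PowerSeries.coeff k A))
    + v.2 • PowerSeries.mk fun k =>
        (k : ℝ) • PowerSeries.coeff k A + Polynomial.derivative (PowerSeries.coeff k A)

theorem hasFDerivAt_evalLog {a : Polynomial (E → ℝ)} {z : E × ℝ} (hz : 0 < z.2)
    (ha : ∀ p, DifferentiableAt ℝ (a.coeff p) z.1) (v : E × ℝ) :
    DifferentiableAt ℝ (evalLog a) z ∧ fderiv ℝ (evalLog a) z v
      = evalLog (coeffDeriv v.1 a) z + v.2 * z.2⁻¹ * evalLog (Polynomial.derivative a) z := by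
  have e : evalLog a = fun z : E × ℝ => ∑ p ∈ Finset.range (a.natDegree + 1),
      a.coeff p z.1 * Real.log z.2 ^ p := funext fun z => evalLog_eq_sum a (Nat.lt_succ_self _) z
  have h : ∀ p, HasFDerivAt (fun z : E × ℝ => a.coeff p z.1 * Real.log z.2 ^ p)
      (a.coeff p z.1 • ((p * Real.log z.2 ^ (p - 1) * z.2⁻¹) • ContinuousLinearMap.snd ℝ E ℝ)
        + Real.log z.2 ^ p • (fderiv ℝ (a.coeff p) z.1).comp (ContinuousLinearMap.fst ℝ E ℝ)) z :=
    fun p => ((ha p).hasFDerivAt.comp z hasFDerivAt_fst).mul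
      (((Real.hasDerivAt_log hz.ne').pow p).comp_hasFDerivAt z hasFDerivAt_snd)
  have hs := HasFDerivAt.fun_sum (u := Finset.range (a.natDegree + 1)) fun p _ => h p
  rw [← e] at hs
  refine ⟨hs.differentiableAt, ?_⟩
  have ed : evalLog (Polynomial.derivative a) z = ∑ p ∈ Finset.range (a.natDegree + 1),
      a.coeff p z.1 * (p * Real.log z.2 ^ (p - 1)) := by
    conv_lhs => rw [a.as_sum_range, map_sum, map_sum, Finset.sum_apply]
    refine Finset.sum_congr rfl fun p _ => ?_
    rw [Polynomial.derivative_monomial, evalLog_monomial]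
    simp [mul_assoc]
  rw [hs.fderiv, coeffDeriv, map_sum, Finset.sum_apply, ed, Finset.mul_sum,
    ← Finset.sum_add_distrib, sum_apply]
  refine Finset.sum_congr rfl fun p _ => ?_
  simp [evalLog_monomial]
  ring

theorem coeff_formalDeriv_zero (v : E × ℝ) (A : FormalSeries E) :
    PowerSeries.coeff 0 (formalDeriv v A)
      = v.2 • Polynomial.derivative (PowerSeries.coeff 0 A) := by
  simp [formalDeriv]

theorem coeff_formalDeriv_succ (v : E × ℝ) (A : FormalSeries E) (k : ℕ) :
    PowerSeries.coeff (k + 1) (formalDeriv v A)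
      = coeffDeriv v.1 (PowerSeries.coeff k A) + v.2 • (((k + 1 : ℕ) : ℝ) •
        PowerSeries.coeff (k + 1) A + Polynomial.derivative (PowerSeries.coeff (k + 1) A)) := by
  rw [formalDeriv, map_add, PowerSeries.coeff_succ_X_mul, PowerSeries.coeff_mk,
    PowerSeries.coeff_smul, PowerSeries.coeff_mk]

end Phg

/-! ### The derivations x ∂_v on expansions, and uniqueness of coefficients -/

section Phg

variable {E : Type*} [NormedAddCommGroup E] [NormedSpace ℝ E] {u₀ : E} {f g : E × ℝ → ℝ}
  {L : ℕ → ℕ} {A B : FormalSeries E}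

theorem SmoothCoeffs.smul {a : Polynomial (E → ℝ)} (c : ℝ) (ha : SmoothCoeffs u₀ a) :
    SmoothCoeffs u₀ (c • a) := by
  intro p
  filter_upwards [ha p] with u h
  rw [Polynomial.coeff_smul]
  exact contDiffAt_const.mul h

theorem smoothCoeffs_formalDeriv (v : E × ℝ)
    (hA : ∀ k, SmoothCoeffs u₀ (PowerSeries.coeff k A)) (k : ℕ) :
    SmoothCoeffs u₀ (PowerSeries.coeff k (formalDeriv v A)) := by
  cases k with
  | zero =>
    rw [coeff_formalDeriv_zero]
    exact (hA 0).derivative.smul _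
  | succ k =>
    rw [coeff_formalDeriv_succ]
    exact ((hA k).coeffDeriv _).add ((((hA _).smul _).add (hA _).derivative).smul _)

theorem evalLog_smul (c : ℝ) (a : Polynomial (E → ℝ)) (z : E × ℝ) :
    evalLog (c • a) z = c * evalLog a z := by
  have : c • a = Polynomial.C (fun _ => c) * a := by
    rw [← Polynomial.smul_eq_C_mul]
    ext p u
    simp
  rw [this, map_mul]
  simp [evalLog]

theorem differentiableAt_evalLog (hA : ∀ k, SmoothCoeffs u₀ (PowerSeries.coeff k A)) (k : ℕ) :
    ∀ᶠ z in bdry u₀, ∀ p, DifferentiableAt ℝ ((PowerSeries.coeff k A).coeff p) z.1 := by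
  have h : ∀ᶠ z in bdry u₀, ∀ p ∈ Finset.range ((PowerSeries.coeff k A).natDegree + 1),
      DifferentiableAt ℝ ((PowerSeries.coeff k A).coeff p) z.1 :=
    (Finset.eventually_all _).mpr fun p _ =>
      (tendsto_fst_bdry.eventually (hA k p)).mono fun z hz => hz.differentiableAt (by simp)
  filter_upwards [h] with z hz p
  by_cases hp : p < (PowerSeries.coeff k A).natDegree + 1
  · exact hz p (Finset.mem_range.mpr hp)
  · rw [Polynomial.coeff_eq_zero_of_natDegree_lt (by omega)]
    exact differentiableAt_const _

/-- The factor x restores the order lost to ∂_x and pushes tangential derivatives up by one order;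
so a series with no terms from order N on acquires terms of order at most N, and truncation at N + 1
is exact. -/
theorem fderiv_evalSeries_trunc (hA : ∀ k, SmoothCoeffs u₀ (PowerSeries.coeff k A)) {N : ℕ}
    (hN : ∀ k ≥ N, PowerSeries.coeff k A = 0) (v : E × ℝ) :
    ∀ᶠ z in bdry u₀, z.2 * fderiv ℝ (evalSeries (PowerSeries.trunc N A)) z v
      = evalSeries (PowerSeries.trunc (N + 1) (formalDeriv v A)) z := by
  have h1 : ∀ᶠ z in bdry u₀, ∀ k ∈ Finset.range N, ∀ p,
      DifferentiableAt ℝ ((PowerSeries.coeff k A).coeff p) z.1 :=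
    (Finset.eventually_all _).mpr fun k _ => differentiableAt_evalLog hA k
  filter_upwards [h1, bdry_pos] with z hz hpos
  have e : evalSeries (PowerSeries.trunc N A) = fun z => ∑ k ∈ Finset.range N,
      evalLog (PowerSeries.coeff k A) z * z.2 ^ k := funext (evalSeries_trunc A N)
  have h : ∀ k ∈ Finset.range N, HasFDerivAt
      (fun z : E × ℝ => evalLog (PowerSeries.coeff k A) z * z.2 ^ k)
      (evalLog (PowerSeries.coeff k A) z • ((k * z.2 ^ (k - 1)) • ContinuousLinearMap.snd ℝ E ℝ)
        + z.2 ^ k • fderiv ℝ (evalLog (PowerSeries.coeff k A)) z) z := fun k hk =>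
    (hasFDerivAt_evalLog hpos (hz k hk) v).1.hasFDerivAt.mul
      ((hasDerivAt_pow k z.2).comp_hasFDerivAt z hasFDerivAt_snd)
  rw [e, (HasFDerivAt.fun_sum h).fderiv, sum_apply, evalSeries_trunc, Finset.sum_range_succ',
    coeff_formalDeriv_zero]
  have e2 : ∑ k ∈ Finset.range N, evalLog (PowerSeries.coeff (k + 1) (formalDeriv v A)) z
        * z.2 ^ (k + 1)
      = ∑ k ∈ Finset.range N, evalLog (coeffDeriv v.1 (PowerSeries.coeff k A)) z * z.2 ^ (k + 1)
        + ∑ k ∈ Finset.range N, v.2 * (((k + 1 : ℕ) : ℝ) * evalLog (PowerSeries.coeff (k + 1) A) z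
          + evalLog (Polynomial.derivative (PowerSeries.coeff (k + 1) A)) z) * z.2 ^ (k + 1) := by
    rw [← Finset.sum_add_distrib]
    refine Finset.sum_congr rfl fun k _ => ?_
    rw [coeff_formalDeriv_succ, map_add, Pi.add_apply, evalLog_smul, map_add, Pi.add_apply,
      evalLog_smul]
    ring
  have e3 := Finset.sum_range_succ' (fun k => v.2 * ((k : ℝ) * evalLog (PowerSeries.coeff k A) z
          + evalLog (Polynomial.derivative (PowerSeries.coeff k A)) z) * z.2 ^ k) N
  rw [Finset.sum_range_succ, hN N le_rfl] at e3
  simp only [map_zero, Pi.zero_apply, mul_zero, add_zero, zero_mul,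
    Nat.cast_zero, zero_add, pow_zero, mul_one] at e3
  rw [e2, evalLog_smul, pow_zero, mul_one, add_assoc, ← e3, ← Finset.sum_add_distrib,
    Finset.mul_sum]
  refine Finset.sum_congr rfl fun k hk => ?_
  have h2 := (hasFDerivAt_evalLog hpos (hz k hk) v).2
  simp only [add_apply, smul_apply, ContinuousLinearMap.coe_snd', smul_eq_mul, h2]
  rcases k with _ | k
  · simp
    field_simp
  · field_simp
    simp
    ring

namespace IsPhg

/-- The remainder is x ∂_v (f − A_N) for the truncation A_N, controlled by one more derivative of
the remainder of f. Monotonicity of L accommodates the order shift of the tangential part. -/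
theorem deriv (hL : ∀ k, L k ≤ L (k + 1)) (hf : IsPhg u₀ L f A) (v : E × ℝ) :
    IsPhg u₀ L (fun z => z.2 * fderiv ℝ f z v) (formalDeriv v A) := by
  have hs := smoothCoeffs_formalDeriv v hf.coeff
  refine of_approx (SmoothNear.snd.mul (hf.smooth.fderiv_apply v)) hs (fun k => ?_)
    fun R J M => ?_
  · cases k with
    | zero =>
      rw [coeff_formalDeriv_zero]
      exact (Polynomial.natDegree_smul_le _ _).trans
        ((Polynomial.natDegree_derivative_le _).trans ((Nat.sub_le _ _).trans (hf.natDegree 0)))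
    | succ k =>
      rw [coeff_formalDeriv_succ]
      refine Polynomial.natDegree_add_le_of_degree_le
        ((natDegree_coeffDeriv_le _ _).trans ((hf.natDegree k).trans (hL k)))
        ((Polynomial.natDegree_smul_le _ _).trans
        (Polynomial.natDegree_add_le_of_degree_le ((Polynomial.natDegree_smul_le _ _).trans
          (hf.natDegree _)) ((Polynomial.natDegree_derivative_le _).trans
            ((Nat.sub_le _ _).trans (hf.natDegree _)))))
  · obtain ⟨N, hMN, hN⟩ := hf.bound_of_le (R + J) (J + 1) M
    have hT : ∀ k, PowerSeries.coeff k (PowerSeries.trunc N A : FormalSeries E)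
        = if k < N then PowerSeries.coeff k A else 0 := fun k => by
      rw [Polynomial.coeff_coe, PowerSeries.coeff_trunc]
    have hTs : ∀ k, SmoothCoeffs u₀
        (PowerSeries.coeff k (PowerSeries.trunc N A : FormalSeries E)) := fun k => by
      rw [Polynomial.coeff_coe]
      exact smoothCoeffs_trunc hf.coeff N k
    refine ⟨PowerSeries.trunc (N + 1) (formalDeriv v (PowerSeries.trunc N A : FormalSeries E)),
      smoothCoeffs_trunc (smoothCoeffs_formalDeriv v hTs) _, fun k hk => ?_, ?_⟩
    · rw [PowerSeries.coeff_trunc, if_pos (by omega)]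
      cases k with
      | zero => rw [coeff_formalDeriv_zero, coeff_formalDeriv_zero, hT, if_pos (by omega)]
      | succ k =>
        rw [coeff_formalDeriv_succ, coeff_formalDeriv_succ, hT, hT, if_pos (by omega),
          if_pos (by omega)]
    · have h1 := fderiv_evalSeries_trunc hTs (N := N)
        (fun k hk => by rw [hT, if_neg (by omega)]) v
      have e : PowerSeries.trunc N (PowerSeries.trunc N A : FormalSeries E)
          = PowerSeries.trunc N A := by
        ext k : 1
        rw [PowerSeries.coeff_trunc, hT, PowerSeries.coeff_trunc]
        split_ifs <;> rfl
      rw [e] at h1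
      -- The general bound for x = x¹ (log x)⁰ only gives exponent −J, which is why the order R + J
      -- was required of the remainder.
      have hx : DerivsBigO u₀ J (-J) (Prod.snd : E × ℝ → ℝ) := by
        refine ((DerivsBigO.zpow_mul_log_pow (u₀ := u₀) J 1 0).congr
          (Eventually.of_forall fun z => by simp)).mono (by simp)
      have sN := hf.smooth.sub (hf.smooth_trunc N)
      refine ((DerivsBigO.mul SmoothNear.snd (sN.fderiv_apply v) hx (hN.2 v)).mono
        (by linarith)).congr ?_
      filter_upwards [h1, hf.smooth.differentiableAt, (hf.smooth_trunc N).differentiableAt]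
        with z h1 h2 h3
      simp only [Pi.mul_apply, Pi.sub_apply, fderiv_sub h2 h3, ← h1, sub_apply]
      ring

end IsPhg

/-! #### Values at a boundary point -/

/-- The coefficient of `x ^ k`, a polynomial in `log x`, at the point `u`. -/
def coeffAt (u : E) (A : FormalSeries E) (k : ℕ) : Polynomial ℝ :=
  (PowerSeries.coeff k A).map (Pi.evalRingHom (fun _ : E => ℝ) u)

@[simp]
theorem coeff_coeffAt (u : E) (A : FormalSeries E) (k p : ℕ) :
    (coeffAt u A k).coeff p = (PowerSeries.coeff k A).coeff p u := by
  simp [coeffAt]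

theorem evalLog_eq_eval (a : Polynomial (E → ℝ)) (z : E × ℝ) :
    evalLog a z = (a.map (Pi.evalRingHom (fun _ : E => ℝ) z.1)).eval (Real.log z.2) := by
  rw [Polynomial.eval_map, evalLog_eq_sum a (Nat.lt_succ_self _), Polynomial.eval₂_eq_sum_range]
  rfl

/-- The function `h` of `x` has the asymptotic expansion `∑ a_k(log x) x^k`. -/
def HasLogExpansion (h : ℝ → ℝ) (a : ℕ → Polynomial ℝ) : Prop :=
  ∀ M : ℕ, (fun x => h x - ∑ k ∈ Finset.range M, (a k).eval (Real.log x) * x ^ k)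
    =O[𝓝[>] 0] fun x => x ^ ((M : ℤ) - 1)

theorem tendsto_bdry_of_fst (u₀ : E) : Tendsto (fun x : ℝ => (u₀, x)) (𝓝[>] 0) (bdry u₀) := by
  rw [bdry_eq]
  exact tendsto_const_nhds.prodMk tendsto_id

theorem IsPhg.hasLogExpansion (hf : IsPhg u₀ L f A) :
    HasLogExpansion (fun x => f (u₀, x)) (coeffAt u₀ A) := by
  intro M
  have h := (hf.bound 0 M).isBigO.comp_tendsto (tendsto_bdry_of_fst u₀)
  refine (h.congr (fun x => ?_) fun x => ?_)
  · simp only [Function.comp_apply, Pi.sub_apply, evalSeries_trunc, evalLog_eq_eval]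
    rfl
  · simp

/-- With x = e^(−t), this is a polynomial in t tending to 0 as t → ∞. -/
theorem eq_zero_of_tendsto_eval_log {c : Polynomial ℝ}
    (h : Tendsto (fun x => c.eval (Real.log x)) (𝓝[>] 0) (𝓝 0)) : c = 0 := by
  have h1 : Tendsto (fun t => c.eval (Real.log (Real.exp (-t)))) atTop (𝓝 0) := by
    refine h.comp ?_
    exact tendsto_nhdsWithin_iff.mpr ⟨Real.tendsto_exp_neg_atTop_nhds_zero,
      Eventually.of_forall fun t => Real.exp_pos _⟩
  simp only [Real.log_exp] at h1
  have h2 : Tendsto (fun t => (c.comp (-Polynomial.X)).eval t) atTop (𝓝 0) := by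
    simpa [Polynomial.eval_comp] using h1
  have h3 := (Polynomial.tendsto_nhds_iff _).mp h2
  have h4 : c.comp (-Polynomial.X) = 0 := Polynomial.leadingCoeff_eq_zero.mp h3.1
  have h5 := congrArg (fun q => q.comp (-Polynomial.X)) h4
  simpa [Polynomial.comp_assoc] using h5

theorem eval_log_mul_isBigO (c : Polynomial ℝ) :
    Tendsto (fun x => c.eval (Real.log x) * x) (𝓝[>] 0) (𝓝 0) := by
  have h : ∀ p : ℕ, Tendsto (fun x : ℝ => Real.log x ^ p * x) (𝓝[>] 0) (𝓝 0) := by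
    intro p
    have h2 := (Real.isLittleO_pow_log_id_atTop (n := p)).comp_tendsto
      (tendsto_inv_nhdsGT_zero (𝕜 := ℝ))
    have h3 := h2.tendsto_div_nhds_zero.const_mul ((-1 : ℝ) ^ p)
    rw [mul_zero] at h3
    refine h3.congr fun x => ?_
    simp only [Function.comp_apply, Real.log_inv, id, div_inv_eq_mul]
    rw [← mul_assoc, ← mul_pow]
    ring
  have h2 : Tendsto (fun x => ∑ p ∈ Finset.range (c.natDegree + 1),
      c.coeff p * (Real.log x ^ p * x)) (𝓝[>] 0) (𝓝 (∑ p ∈ Finset.range (c.natDegree + 1),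
        c.coeff p * 0)) := tendsto_finsetSum _ fun p _ => (h p).const_mul _
  simp only [mul_zero, Finset.sum_const_zero] at h2
  refine h2.congr fun x => ?_
  rw [Polynomial.eval_eq_sum_range, Finset.sum_mul]
  exact Finset.sum_congr rfl fun p _ => by ring

/-- By induction the lower terms cancel, and one divides by x^k. Keeping k + 2 terms makes the error
O(x), and x times a polynomial in log x tends to 0, so (a_k − b_k)(log x) → 0. This makes
coefficients independent of charts and of the way they were computed. -/
theorem HasLogExpansion.unique {h h' : ℝ → ℝ} {a b : ℕ → Polynomial ℝ} (ha : HasLogExpansion h a)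
    (hb : HasLogExpansion h' b) (hh : h =ᶠ[𝓝[>] 0] h') (k : ℕ) : a k = b k := by
  induction k using Nat.strong_induction_on with
  | _ k ih =>
  have h1 := ((hb (k + 2)).sub (ha (k + 2)))
  have h2 : (fun x => ((a k - b k).eval (Real.log x)
      + (a (k + 1) - b (k + 1)).eval (Real.log x) * x)) =O[𝓝[>] 0] fun x : ℝ => x := by
    have h3 := h1.mul (isBigO_refl (fun x : ℝ => x ^ (-(k : ℤ))) (𝓝[>] 0))
    refine h3.congr' ?_ ?_
    · filter_upwards [hh, self_mem_nhdsWithin] with x hx hpos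
      have hpos : (0 : ℝ) < x := hpos
      have es : ∑ i ∈ Finset.range k, (a i).eval (Real.log x) * x ^ i
          = ∑ i ∈ Finset.range k, (b i).eval (Real.log x) * x ^ i :=
        Finset.sum_congr rfl fun i hi => by rw [ih i (Finset.mem_range.mp hi)]
      simp only [Finset.sum_range_succ, es, hx, Polynomial.eval_sub]
      rw [zpow_neg, zpow_natCast, pow_succ]
      field_simp
      ring
    · filter_upwards [self_mem_nhdsWithin] with x hpos
      have hpos : (0 : ℝ) < x := hpos
      rw [← zpow_add₀ hpos.ne']
      push_cast
      rw [show (k : ℤ) + 2 - 1 + -k = 1 by ring, zpow_one]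
  have h4 : Tendsto (fun x : ℝ => x) (𝓝[>] 0) (𝓝 0) := nhdsWithin_le_nhds
  have h5 := (h2.trans_tendsto h4).sub (eval_log_mul_isBigO (a (k + 1) - b (k + 1)))
  simp only [add_sub_cancel_right, sub_zero] at h5
  exact sub_eq_zero.mp (eq_zero_of_tendsto_eval_log h5)

end Phg

/-! ### Inverses of polyhomogeneous functions, and comparison with `HasPhgExpansionOn` -/

section Phg

variable {E : Type*} [NormedAddCommGroup E] [NormedSpace ℝ E] {u₀ : E} {f g : E × ℝ → ℝ}
  {L : ℕ → ℕ} {A B : FormalSeries E}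

theorem SmoothCoeffs.one : SmoothCoeffs u₀ (1 : Polynomial (E → ℝ)) := by
  rw [← Polynomial.C_1]
  exact SmoothCoeffs.C (Eventually.of_forall fun _ => contDiffAt_const)

namespace IsPhg

theorem tendsto (hL : L 0 = 0) (hf : IsPhg u₀ L f A) :
    Tendsto f (bdry u₀) (𝓝 ((PowerSeries.coeff 0 A).coeff 0 u₀)) := by
  have h1 : Tendsto (f - evalSeries (PowerSeries.trunc 2 A)) (bdry u₀) (𝓝 0) := by
    refine (hf.bound 0 2).isBigO.trans_tendsto ?_
    have : Tendsto (fun z : E × ℝ => z.2) (bdry u₀) (𝓝 0) :=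
      (continuous_snd.tendsto (u₀, (0 : ℝ))).mono_left nhdsWithin_le_nhds
    simpa using this
  have hc : ∀ k p, Tendsto (fun z : E × ℝ => (PowerSeries.coeff k A).coeff p z.1) (bdry u₀)
      (𝓝 ((PowerSeries.coeff k A).coeff p u₀)) := fun k p =>
    ((hf.coeff k p).self_of_nhds.continuousAt.tendsto).comp tendsto_fst_bdry
  have h2 : Tendsto (fun z : E × ℝ => ∑ p ∈ Finset.range ((PowerSeries.coeff 1 A).natDegree + 1),
      (PowerSeries.coeff 1 A).coeff p z.1 * (Real.log z.2 ^ p * z.2)) (bdry u₀)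
      (𝓝 (∑ p ∈ Finset.range ((PowerSeries.coeff 1 A).natDegree + 1),
        (PowerSeries.coeff 1 A).coeff p u₀ * 0)) := by
    refine tendsto_finsetSum _ fun p _ => (hc 1 p).mul ?_
    have := (eval_log_mul_isBigO (Polynomial.X ^ p)).comp (tendsto_snd_bdry (u₀ := u₀))
    simpa [Function.comp_def] using this
  simp only [mul_zero, Finset.sum_const_zero] at h2
  have h3 := (h1.add (hc 0 0)).add h2
  simp only [zero_add, add_zero] at h3
  refine h3.congr fun z => ?_
  rw [Pi.sub_apply, evalSeries_trunc, Finset.sum_range_succ, Finset.sum_range_one,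
    evalLog_eq_sum (PowerSeries.coeff 1 A) (Nat.lt_succ_self _),
    evalLog_eq_sum (PowerSeries.coeff 0 A) (Nat.lt_succ_iff.mpr ((hf.natDegree 0).trans hL.le))]
  simp only [Finset.sum_range_one, pow_zero, mul_one, pow_one, Finset.sum_mul]
  rw [sub_add, sub_add, sub_eq_self]
  simp [mul_assoc]

/-- For truncations A_N and B_N, 1/f − B_N = (1/f)((1 − A_N B_N) − (f − A_N) B_N). The first
difference has no terms below order N because A B = 1, the second contains the remainder of f, and
1/f costs only an exponent independent of N. -/
theorem inv (hL : ∀ i j, L i + L j ≤ L (i + j)) (hf : IsPhg u₀ L f A) (hAB : A * B = 1) :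
    IsPhg u₀ L f⁻¹ B := by
  have hL0 : L 0 = 0 := by
    have := hL 0 0
    rw [add_zero] at this
    omega
  set α := (PowerSeries.coeff 0 A).coeff 0 with hα
  have hA0 : PowerSeries.coeff 0 A = Polynomial.C α :=
    Polynomial.eq_C_of_natDegree_le_zero ((hf.natDegree 0).trans hL0.le)
  have hα0 : ∀ u, α u ≠ 0 := by
    have h1 : PowerSeries.coeff 0 A * PowerSeries.coeff 0 B = 1 := by
      have := congrArg (PowerSeries.coeff 0) hAB
      rwa [PowerSeries.coeff_mul, Finset.HasAntidiagonal.antidiagonal_zero, Finset.sum_singleton,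
        PowerSeries.coeff_zero_one] at this
    have h2 := congrArg (fun q => q.coeff 0) h1
    simp only [hA0, Polynomial.coeff_C_mul, Polynomial.coeff_one_zero] at h2
    intro u hu
    have := congrFun h2 u
    simp [hu] at this
  have hinv : α⁻¹ * α = 1 := funext fun u => inv_mul_cancel₀ (hα0 u)
  -- A B = 1 solved recursively for B. Only the log-free leading coefficient α is inverted, so
  -- smoothness and the bound L pass to B by strong induction.
  have hrec : ∀ k, PowerSeries.coeff k B = Polynomial.C α⁻¹ * (PowerSeries.coeff k 1
      - ∑ x ∈ (Finset.HasAntidiagonal.antidiagonal k).erase (0, k),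
          PowerSeries.coeff x.1 A * PowerSeries.coeff x.2 B) := by
    intro k
    have hmem : (0, k) ∈ Finset.HasAntidiagonal.antidiagonal k :=
      Finset.HasAntidiagonal.mem_antidiagonal.mpr (zero_add k)
    rw [← hAB, PowerSeries.coeff_mul, ← Finset.add_sum_erase _ _ hmem, add_sub_cancel_right, hA0,
      ← mul_assoc, ← Polynomial.C_mul, hinv, Polynomial.C_1, one_mul]
  have hlt : ∀ k, ∀ x ∈ (Finset.HasAntidiagonal.antidiagonal k).erase (0, k), x.2 < k := by
    rintro k ⟨i, j⟩ hx
    obtain ⟨h1, h2⟩ := Finset.mem_erase.mp hx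
    have h3 := Finset.HasAntidiagonal.mem_antidiagonal.mp h2
    rcases Nat.eq_zero_or_pos i with rfl | hi
    · exact absurd (by simpa using h3) h1
    · simp only at h3 ⊢
      omega
  have hαs : ∀ᶠ u in 𝓝 u₀, ContDiffAt ℝ ∞ α⁻¹ u := by
    filter_upwards [hf.coeff 0 0] with u hu using hu.inv (hα0 u)
  have hB : ∀ k, SmoothCoeffs u₀ (PowerSeries.coeff k B)
      ∧ (PowerSeries.coeff k B).natDegree ≤ L k := by
    intro k
    induction k using Nat.strong_induction_on with
    | _ k ih =>
    rw [hrec]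
    have h1 : SmoothCoeffs u₀ (PowerSeries.coeff k (1 : FormalSeries E)) ∧
        (PowerSeries.coeff k (1 : FormalSeries E)).natDegree ≤ L k := by
      rw [PowerSeries.coeff_one]
      split_ifs
      · exact ⟨SmoothCoeffs.one, by simp⟩
      · exact ⟨SmoothCoeffs.zero, by simp⟩
    refine ⟨(SmoothCoeffs.C hαs).mul (h1.1.sub (SmoothCoeffs.sum fun x hx =>
      (hf.coeff _).mul (ih _ (hlt k x hx)).1)), ?_⟩
    refine (Polynomial.natDegree_C_mul_le _ _).trans
      ((Polynomial.natDegree_sub_le_of_le h1.2 (Polynomial.natDegree_sum_le_of_forall_le _ _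
        fun x hx => ?_)).trans (max_self _).le)
    refine Polynomial.natDegree_mul_le.trans
      ((add_le_add (hf.natDegree _) (ih _ (hlt k x hx)).2).trans ?_)
    rw [← Finset.HasAntidiagonal.mem_antidiagonal.mp (Finset.mem_of_mem_erase hx)]
    exact hL _ _
  have ht := hf.tendsto hL0
  have hne : ∀ᶠ z in bdry u₀, f z ≠ 0 := ht.eventually_ne (hα0 u₀)
  have hO : f⁻¹ =O[bdry u₀] fun z => z.2 ^ (0 : ℤ) := by
    simp only [zpow_zero]
    exact (ht.inv₀ (hα0 u₀)).isBigO_one ℝ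
  have si := hf.smooth.inv hne
  refine of_approx si (fun k => (hB k).1) (fun k => (hB k).2) fun R J M => ?_
  obtain ⟨R', hR'⟩ := DerivsBigO.inv hf.smooth (fun J => ⟨_, hf.moderate J⟩) hO hne J
  have hBs : ∀ N, SmoothNear u₀ (evalSeries (PowerSeries.trunc N B)) := fun N =>
    (smoothNear_evalSeries (smoothCoeffs_trunc (fun k => (hB k).1) N)).1
  -- Chosen so that the exponents R' of 1/f, N − 1 − J of the remainder and −1 − J of the truncation
  -- of B add up to at least R.
  set N := max M (R - R' + 2 + 2 * J).toNat with hN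
  have hNR : R ≤ R' + ((N : ℤ) - 1 - J + (-1 - J)) := by
    have := Int.self_le_toNat (R - R' + 2 + 2 * J)
    have h2 : (R - R' + 2 + 2 * J).toNat ≤ N := le_max_right _ _
    have h3 : ((R - R' + 2 + 2 * J).toNat : ℤ) ≤ N := by exact_mod_cast h2
    linarith
  refine ⟨PowerSeries.trunc N B, smoothCoeffs_trunc (fun k => (hB k).1) N, fun k hk => ?_, ?_⟩
  · rw [PowerSeries.coeff_trunc, if_pos (hk.trans_le (le_max_left _ _))]
  have s1 := hf.smooth.sub (hf.smooth_trunc N)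
  set T : Polynomial (Polynomial (E → ℝ)) :=
    1 - PowerSeries.trunc N A * PowerSeries.trunc N B with hT
  have hTs : ∀ k, SmoothCoeffs u₀ (T.coeff k) := fun k => by
    rw [hT, Polynomial.coeff_sub]
    refine SmoothCoeffs.sub ?_ (smoothCoeffs_mul (smoothCoeffs_trunc hf.coeff N)
      (smoothCoeffs_trunc (fun k => (hB k).1) N) k)
    rw [Polynomial.coeff_one]
    split_ifs
    · exact SmoothCoeffs.one
    · exact SmoothCoeffs.zero
  have h1 := (smoothNear_evalSeries hTs).2 N J fun k hk => by
    rw [hT, Polynomial.coeff_sub, coeff_trunc_mul hk hk, hAB, PowerSeries.coeff_one,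
      Polynomial.coeff_one, sub_self]
  have h2 := DerivsBigO.mul s1 (hBs N) (hf.bound J N)
    (trunc_moderate (fun k => (hB k).1) N J)
  have h3 := DerivsBigO.sub (smoothNear_evalSeries hTs).1 (s1.mul (hBs N))
    (h1.mono (R' := (N : ℤ) - 1 - J + (-1 - J)) (by omega)) h2
  refine ((DerivsBigO.mul si ((smoothNear_evalSeries hTs).1.sub (s1.mul (hBs N))) hR' h3).mono
    hNR).congr ?_
  filter_upwards [hne] with z hz
  have hTe : evalSeries T = 1 - evalSeries (PowerSeries.trunc N A)
      * evalSeries (PowerSeries.trunc N B) := by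
    refine eq_sub_of_add_eq ?_
    rw [← map_mul, ← map_add, hT]
    exact (congrArg evalSeries (sub_add_cancel _ _)).trans (map_one _)
  rw [hTe]
  simp only [Pi.mul_apply, Pi.sub_apply, Pi.inv_apply, Pi.one_apply]
  field_simp
  ring

end IsPhg

/-- The pairs of a function and its polyhomogeneous expansion at `u₀`. -/
def phgAlg (u₀ : E) (L : ℕ → ℕ) (hL : ∀ i j, L i + L j ≤ L (i + j)) :
    Subalgebra ℝ ((E × ℝ → ℝ) × FormalSeries E) where
  carrier := {q | IsPhg u₀ L q.1 q.2}
  mul_mem' h h' := h.mul hL h'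
  add_mem' h h' := h.add h'
  algebraMap_mem' c := by
    have e : (algebraMap ℝ ((E × ℝ → ℝ) × FormalSeries E)) c
        = (fun _ => c, PowerSeries.C (Polynomial.C fun _ => c)) := by
      refine Prod.ext rfl ?_
      change algebraMap ℝ (FormalSeries E) c = _
      rw [PowerSeries.algebraMap_apply]
      rfl
    rw [Set.mem_ofPred_eq, e]
    exact IsPhg.const

/-- The formal series with coefficients `a k p`, `p ≤ L k`. -/
def ofCoeffs (L : ℕ → ℕ) (a : ℕ → ℕ → E → ℝ) : FormalSeries E :=
  PowerSeries.mk fun k => ∑ p ∈ Finset.range (L k + 1), Polynomial.monomial p (a k p)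

theorem coeff_ofCoeffs (L : ℕ → ℕ) (a : ℕ → ℕ → E → ℝ) (k p : ℕ) :
    (PowerSeries.coeff k (ofCoeffs L a)).coeff p = if p ≤ L k then a k p else 0 := by
  rw [ofCoeffs, PowerSeries.coeff_mk, Polynomial.finsetSum_coeff]
  simp [Polynomial.coeff_monomial]

theorem natDegree_ofCoeffs_le (L : ℕ → ℕ) (a : ℕ → ℕ → E → ℝ) (k : ℕ) :
    (PowerSeries.coeff k (ofCoeffs L a)).natDegree ≤ L k := by
  rw [Polynomial.natDegree_le_iff_coeff_eq_zero]
  intro p hp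
  rw [coeff_ofCoeffs, if_neg (by omega)]

theorem evalSeries_trunc_ofCoeffs (L : ℕ → ℕ) (a : ℕ → ℕ → E → ℝ) (M : ℕ) (z : E × ℝ) :
    evalSeries (PowerSeries.trunc M (ofCoeffs L a)) z = ∑ k ∈ Finset.range M,
      ∑ p ∈ Finset.range (L k + 1), a k p z.1 * z.2 ^ k * Real.log z.2 ^ p := by
  rw [evalSeries_trunc]
  refine Finset.sum_congr rfl fun k _ => ?_
  rw [evalLog_eq_sum _ (Nat.lt_succ_iff.mpr (natDegree_ofCoeffs_le L a k)), Finset.sum_mul]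
  refine Finset.sum_congr rfl fun p hp => ?_
  rw [coeff_ofCoeffs, if_pos (Nat.lt_succ_iff.mp (Finset.mem_range.mp hp))]
  ring

theorem eventually_bdry_iff {p : E × ℝ → Prop} : (∀ᶠ z in bdry u₀, p z) ↔
    ∃ V ∈ 𝓝 u₀, ∃ δ > 0, ∀ u ∈ V, ∀ x ∈ Set.Ioo 0 δ, p (u, x) := by
  rw [bdry_eq, Filter.Eventually, Filter.mem_prod_iff]
  constructor
  · rintro ⟨V, hV, T, hT, h⟩
    obtain ⟨δ, hδ, hs⟩ := mem_nhdsGT_iff_exists_Ioo_subset.mp hT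
    exact ⟨V, hV, δ, hδ, fun u hu x hx => h ⟨hu, hs hx⟩⟩
  · rintro ⟨V, hV, δ, hδ, h⟩
    exact ⟨V, hV, Set.Ioo 0 δ, Ioo_mem_nhdsGT hδ, fun z hz => h z.1 hz.1 z.2 hz.2⟩

theorem HasPhgExpansionOn.isPhg [FiniteDimensional ℝ E] {U : Set E} (hU : IsOpen U)
    {F : E → ℝ → ℝ} {L L' : ℕ → ℕ} {a : ℕ → ℕ → E → ℝ} (h : HasPhgExpansionOn U F L a)
    (hL : ∀ k, L k ≤ L' k) (hu : u₀ ∈ U) :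
    IsPhg u₀ L' (fun z => F z.1 z.2) (ofCoeffs L a) := by
  have : ProperSpace E := FiniteDimensional.proper ℝ E
  obtain ⟨K, hK, hKU, hKc⟩ := LocallyCompactSpace.local_compact_nhds u₀ U (hU.mem_nhds hu)
  have hsm : SmoothNear u₀ (fun z : E × ℝ => F z.1 z.2) := by
    obtain ⟨C, δ, hδ, hb⟩ := h.2 0 0 K hKU hKc
    exact eventually_bdry_iff.mpr ⟨K, hK, δ, hδ, fun u hu x hx => (hb u hu x hx).1⟩
  have hc : ∀ k, SmoothCoeffs u₀ (PowerSeries.coeff k (ofCoeffs L a)) := by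
    intro k p
    rw [coeff_ofCoeffs]
    split_ifs with hp
    · filter_upwards [hU.mem_nhds hu] with u hu'
      exact (h.1 k p hp).contDiffAt (hU.mem_nhds hu')
    · exact Eventually.of_forall fun _ => contDiffAt_const
  refine IsPhg.of_approx hsm hc (fun k => (natDegree_ofCoeffs_le L a k).trans (hL k))
    fun R J M => ?_
  set N := max M (R.toNat + J + 1) with hN
  refine ⟨PowerSeries.trunc N (ofCoeffs L a), smoothCoeffs_trunc hc N, fun k hk => ?_,
    DerivsBigO.of_iteratedFDeriv
      (hsm.sub (smoothNear_evalSeries (smoothCoeffs_trunc hc N)).1) fun j hj => ?_⟩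
  · rw [PowerSeries.coeff_trunc, if_pos (hk.trans_le (le_max_left _ _))]
  -- The definition uses r + j + 1 terms for the j-th derivative; with r = N − j − 1 all derivatives
  -- refer to the same N-term partial sum.
  obtain ⟨C, δ, hδ, hb⟩ := h.2 (N - j - 1) j K hKU hKc
  have hNj : N - j - 1 + j + 1 = N := by omega
  have hR : R ≤ ((N - j - 1 : ℕ) : ℤ) := by
    have := Int.self_le_toNat R
    omega
  refine IsBigO.trans (IsBigO.of_bound C ?_) (zpow_isBigO hR)
  refine eventually_bdry_iff.mpr ⟨K, hK, δ, hδ, fun u hu x hx => ?_⟩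
  have hb' := (hb u hu x hx).2
  rw [hNj] at hb'
  rw [zpow_natCast, Real.norm_of_nonneg (pow_nonneg hx.1.le _)]
  refine le_trans (le_of_eq ?_) hb'
  congr 2
  funext z
  rw [Pi.sub_apply, evalSeries_trunc_ofCoeffs]

/-- The bound at a boundary point holds uniformly near it, and finitely many such neighbourhoods
cover a compact set. With M = r + j + 1 terms, the exponent M − 1 − j of `IsPhg.bound` is exactly r.
-/
theorem hasPhgExpansionOn_of_isPhg [FiniteDimensional ℝ E] {U : Set E} (hU : IsOpen U)
    {F : E → ℝ → ℝ} {L : ℕ → ℕ} {a : ℕ → ℕ → E → ℝ}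
    (hA : ∀ k, ∀ p ≤ L k, ∀ u ∈ U, a k p u = (PowerSeries.coeff k A).coeff p u)
    (h : ∀ u ∈ U, IsPhg u L (fun z => F z.1 z.2) A) : HasPhgExpansionOn U F L a := by
  refine ⟨fun k p hp => ?_, fun r j K hKU hK => ?_⟩
  · refine ContDiffOn.congr (fun u hu => ?_) (hA k p hp)
    exact ((h u hu).coeff k p).self_of_nhds.contDiffWithinAt
  have hsum : ∀ u ∈ U, (fun z : E × ℝ => F z.1 z.2 - ∑ k ∈ Finset.range (r + j + 1),
      ∑ p ∈ Finset.range (L k + 1), a k p z.1 * z.2 ^ k * Real.log z.2 ^ p) =ᶠ[bdry u]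
      (fun z => F z.1 z.2) - evalSeries (PowerSeries.trunc (r + j + 1) A) := by
    intro u hu
    filter_upwards [tendsto_fst_bdry.eventually (hU.mem_nhds hu)] with z hz
    rw [Pi.sub_apply, evalSeries_trunc]
    congr 1
    refine Finset.sum_congr rfl fun k _ => ?_
    rw [evalLog_eq_sum _ (Nat.lt_succ_iff.mpr ((h u hu).natDegree k)), Finset.sum_mul]
    refine Finset.sum_congr rfl fun p hp => ?_
    rw [hA k p (Nat.lt_succ_iff.mp (Finset.mem_range.mp hp)) _ hz]
    ring
  refine hK.induction_on (p := fun K => ∃ C δ : ℝ, 0 < δ ∧ ∀ u ∈ K, ∀ x ∈ Set.Ioo 0 δ,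
    ContDiffAt ℝ ∞ (fun z : E × ℝ => F z.1 z.2) (u, x) ∧
    ‖iteratedFDeriv ℝ j (fun z : E × ℝ => F z.1 z.2 -
        ∑ k ∈ Finset.range (r + j + 1), ∑ p ∈ Finset.range (L k + 1),
          a k p z.1 * z.2 ^ k * Real.log z.2 ^ p) (u, x)‖ ≤ C * x ^ r)
    ⟨0, 1, one_pos, by simp⟩ ?_ ?_ ?_
  · rintro s t hst ⟨C, δ, hδ, hb⟩
    exact ⟨C, δ, hδ, fun u hu => hb u (hst hu)⟩
  · rintro s t ⟨C, δ, hδ, hb⟩ ⟨C', δ', hδ', hb'⟩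
    refine ⟨max C C', min δ δ', lt_min hδ hδ', fun u hu x hx => ?_⟩
    have hp := pow_nonneg hx.1.le r
    rcases hu with hu | hu
    · obtain ⟨h1, h2⟩ := hb u hu x ⟨hx.1, hx.2.trans_le (min_le_left _ _)⟩
      exact ⟨h1, h2.trans (mul_le_mul_of_nonneg_right (le_max_left _ _) hp)⟩
    · obtain ⟨h1, h2⟩ := hb' u hu x ⟨hx.1, hx.2.trans_le (min_le_right _ _)⟩
      exact ⟨h1, h2.trans (mul_le_mul_of_nonneg_right (le_max_right _ _) hp)⟩
  · intro u hu
    have hu := hKU hu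
    have hf := h u hu
    have s := hf.smooth.sub (hf.smooth_trunc (r + j + 1))
    obtain ⟨C, hC⟩ := ((hf.bound j (r + j + 1)).iteratedFDeriv_isBigO s).bound
    have hev : ∀ᶠ z in bdry u, ContDiffAt ℝ ∞ (fun z : E × ℝ => F z.1 z.2) z ∧
        ‖iteratedFDeriv ℝ j (fun z : E × ℝ => F z.1 z.2 -
        ∑ k ∈ Finset.range (r + j + 1), ∑ p ∈ Finset.range (L k + 1),
          a k p z.1 * z.2 ^ k * Real.log z.2 ^ p) z‖ ≤ C * z.2 ^ r := by
      filter_upwards [hf.smooth, hC, eventually_bdry_nhds (hsum u hu), bdry_pos]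
        with z h1 h2 h3 hz
      refine ⟨h1, ?_⟩
      have h3' : (fun z : E × ℝ => F z.1 z.2 - ∑ k ∈ Finset.range (r + j + 1),
          ∑ p ∈ Finset.range (L k + 1), a k p z.1 * z.2 ^ k * Real.log z.2 ^ p) =ᶠ[𝓝 z]
          (fun z => F z.1 z.2) - evalSeries (PowerSeries.trunc (r + j + 1) A) := h3
      rw [(h3'.iteratedFDeriv ℝ j).self_of_nhds]
      refine h2.trans (le_of_eq ?_)
      rw [show (((r + j + 1 : ℕ) : ℤ) - 1 - j) = (r : ℤ) by push_cast; ring, zpow_natCast,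
        Real.norm_of_nonneg (pow_nonneg hz.le _)]
    obtain ⟨V, hV, δ, hδ, hb⟩ := eventually_bdry_iff.mp hev
    exact ⟨V, mem_nhdsWithin_of_mem_nhds hV, C, δ, hδ, hb⟩

end Phg

/-! ### Smooth functions on an open set -/

section SmoothFun

variable {Z : Type*} [NormedAddCommGroup Z] [NormedSpace ℝ Z] {W : Set Z}

/-- The algebra of smooth functions on `W`. -/
def SmoothFun (W : Set Z) : Subalgebra ℝ (W → ℝ) where
  carrier := {f | ∃ F : Z → ℝ, ContDiffOn ℝ ∞ F W ∧ ∀ w : W, f w = F w}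
  mul_mem' := by
    rintro f g ⟨F, hF, h⟩ ⟨F', hF', h'⟩
    exact ⟨F * F', hF.mul hF', fun w => by simp [h, h']⟩
  add_mem' := by
    rintro f g ⟨F, hF, h⟩ ⟨F', hF', h'⟩
    exact ⟨F + F', hF.add hF', fun w => by simp [h, h']⟩
  algebraMap_mem' c := ⟨fun _ => c, contDiffOn_const, fun w => rfl⟩

/-- The derivative of a function on `W` in the direction `v`. -/
def derivOn (v : Z) (f : W → ℝ) : W → ℝ := by
  classical
  exact fun w => fderiv ℝ (fun z => if h : z ∈ W then f ⟨z, h⟩ else 0) w v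

theorem derivOn_restrict (hW : IsOpen W) (v : Z) {f : W → ℝ} {F : Z → ℝ} (h : ∀ w : W, f w = F w)
    (w : W) : derivOn v f w = fderiv ℝ F w v := by
  classical
  have e : (fun z => if h : z ∈ W then f ⟨z, h⟩ else 0) =ᶠ[𝓝 (w : Z)] F := by
    filter_upwards [hW.mem_nhds w.2] with z hz
    rw [dif_pos hz, h]
  rw [derivOn, e.fderiv_eq]

namespace SmoothFun

/-- The restriction to `W` of a function that is smooth on `W`. -/
def mk (F : Z → ℝ) (hF : ContDiffOn ℝ ∞ F W) : SmoothFun W := ⟨fun w => F w, F, hF, fun _ => rfl⟩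

@[simp]
theorem mk_apply (F : Z → ℝ) (hF : ContDiffOn ℝ ∞ F W) (w : W) : (mk F hF).1 w = F w := rfl

theorem exists_eq_mk (f : SmoothFun W) : ∃ F, ∃ hF : ContDiffOn ℝ ∞ F W, f = mk F hF := by
  obtain ⟨f, F, hF, h⟩ := f
  exact ⟨F, hF, Subtype.ext (funext h)⟩

theorem ext_apply {f g : SmoothFun W} (h : ∀ w, f.1 w = g.1 w) : f = g :=
  Subtype.ext (funext h)

/-- Evaluation at a point of `W`. -/
def eval (w : W) : SmoothFun W →ₐ[ℝ] ℝ := (Pi.evalAlgHom ℝ (fun _ : W => ℝ) w).comp (SmoothFun W).val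

@[simp]
theorem eval_apply (w : W) (f : SmoothFun W) : eval w f = f.1 w := rfl

theorem isUnit {f : SmoothFun W} (h : ∀ w, f.1 w ≠ 0) : IsUnit f := by
  obtain ⟨F, hF, rfl⟩ := exists_eq_mk f
  refine IsUnit.of_mul_eq_one (mk (fun z => (F z)⁻¹) (hF.inv fun z hz => h ⟨z, hz⟩)) ?_
  refine ext_apply fun w => ?_
  exact mul_inv_cancel₀ (h w)

theorem inv_apply {n : ℕ} {M : Matrix (Fin n) (Fin n) (SmoothFun W)} (hM : IsUnit M.det) (w : W)
    (i j : Fin n) : (M⁻¹ i j).1 w = (Matrix.of fun i j => (M i j).1 w)⁻¹ i j := by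
  have h := congrArg (fun N => (eval w).mapMatrix N) (Matrix.mul_nonsing_inv M hM)
  simp only [map_mul, map_one] at h
  rw [← show (eval w).mapMatrix M = Matrix.of fun i j => (M i j).1 w from rfl,
    Matrix.inv_eq_right_inv h]
  rfl

theorem isUnit_det {n : ℕ} {M : Matrix (Fin n) (Fin n) (SmoothFun W)}
    (h : ∀ w, (Matrix.of fun i j => (M i j).1 w).det ≠ 0) : IsUnit M.det := by
  refine isUnit fun w => ?_
  have := h w
  rwa [← show (eval w).mapMatrix M = Matrix.of fun i j => (M i j).1 w from rfl,
    ← AlgHom.map_det] at this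

end SmoothFun

variable (hW : IsOpen W)
include hW

theorem derivOn_mem (v : Z) {f : W → ℝ} (hf : f ∈ SmoothFun W) : derivOn v f ∈ SmoothFun W := by
  obtain ⟨F, hF, h⟩ := hf
  refine ⟨fun z => fderiv ℝ F z v, ?_, derivOn_restrict hW v h⟩
  exact (hF.fderiv_of_isOpen hW (by simp)).clm_apply contDiffOn_const

theorem derivOn_add (v : Z) {f g : W → ℝ} (hf : f ∈ SmoothFun W) (hg : g ∈ SmoothFun W) :
    derivOn v (f + g) = derivOn v f + derivOn v g := by
  obtain ⟨F, hF, h⟩ := hf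
  obtain ⟨F', hF', h'⟩ := hg
  funext w
  have hd := ((hF.contDiffAt (hW.mem_nhds w.2)).differentiableAt (by simp))
  have hd' := ((hF'.contDiffAt (hW.mem_nhds w.2)).differentiableAt (by simp))
  rw [derivOn_restrict hW v (F := F + F') (fun w => by simp [h, h']), Pi.add_apply,
    derivOn_restrict hW v h, derivOn_restrict hW v h', fderiv_add hd hd']
  rfl

theorem derivOn_mul (v : Z) {f g : W → ℝ} (hf : f ∈ SmoothFun W) (hg : g ∈ SmoothFun W) :
    derivOn v (f * g) = derivOn v f * g + f * derivOn v g := by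
  obtain ⟨F, hF, h⟩ := hf
  obtain ⟨F', hF', h'⟩ := hg
  funext w
  have hd := ((hF.contDiffAt (hW.mem_nhds w.2)).differentiableAt (by simp))
  have hd' := ((hF'.contDiffAt (hW.mem_nhds w.2)).differentiableAt (by simp))
  rw [derivOn_restrict hW v (F := F * F') (fun w => by simp [h, h']), Pi.add_apply, Pi.mul_apply,
    Pi.mul_apply, derivOn_restrict hW v h, derivOn_restrict hW v h', fderiv_mul hd hd', h, h']
  simp
  ring

theorem derivOn_comm (v v' : Z) {f : W → ℝ} (hf : f ∈ SmoothFun W) :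
    derivOn v (derivOn v' f) = derivOn v' (derivOn v f) := by
  obtain ⟨F, hF, h⟩ := hf
  funext w
  have hc := hF.contDiffAt (hW.mem_nhds w.2)
  have hd : DifferentiableAt ℝ (fderiv ℝ F) w :=
    (hc.fderiv_right (m := ∞) (by simp)).differentiableAt (by simp)
  rw [derivOn_restrict hW v (F := fun z => fderiv ℝ F z v') (derivOn_restrict hW v' h),
    derivOn_restrict hW v' (F := fun z => fderiv ℝ F z v) (derivOn_restrict hW v h)]
  have e : ∀ u : Z, fderiv ℝ (fun z => fderiv ℝ F z u) w = (fderiv ℝ (fderiv ℝ F) w).flip u := by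
    intro u
    rw [fderiv_clm_apply hd (differentiableAt_const _)]
    simp
  rw [e, e]
  simp only [ContinuousLinearMap.flip_apply]
  exact (hc.isSymmSndFDerivAt (by
    rw [minSmoothness_of_isRCLikeNormedField]; exact WithTop.coe_le_coe.mpr le_top)).eq _ _

end SmoothFun

/-! ### The frame `x ∂_x, x ∂_i` -/

section BoundaryFrame

variable {d : ℕ}

/-- The coordinate directions in the collar; the direction `0` is that of `x`. -/
def dirVec (d : ℕ) : Fin (d + 1) → EuclideanSpace ℝ (Fin d) × ℝ :=
  Fin.cons (0, 1) fun i => (EuclideanSpace.single i 1, 0)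

theorem dirVec_snd (s : Fin (d + 1)) : (dirVec d s).2 = if s = 0 then 1 else 0 := by
  refine Fin.cases ?_ (fun i => ?_) s <;> simp [dirVec, Fin.succ_ne_zero]

/-- Frame data with the structure constants of the frame `x ∂_x, x ∂_i`. -/
def boundaryFrame {B : Type*} [CommRing B] (D : Fin (d + 1) → B → B)
    (G Ginv : Matrix (Fin (d + 1)) (Fin (d + 1)) B) : FrameData (d + 1) B where
  D := D
  c a b w := (if a = 0 ∧ b = w then 1 else 0) - if b = 0 ∧ a = w then 1 else 0
  G := G
  Ginv := Ginv

theorem isHom_boundaryFrame {B B' : Type*} [CommRing B] [Algebra ℝ B] [CommRing B'] [Algebra ℝ B']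
    {φ : B →ₐ[ℝ] B'} {D : Fin (d + 1) → B → B} {D' : Fin (d + 1) → B' → B'}
    {G Ginv : Matrix (Fin (d + 1)) (Fin (d + 1)) B}
    {G' Ginv' : Matrix (Fin (d + 1)) (Fin (d + 1)) B'} (hD : ∀ s b, φ (D s b) = D' s (φ b))
    (hG : ∀ i j, φ (G i j) = G' i j) (hGinv : ∀ i j, φ (Ginv i j) = Ginv' i j) :
    FrameData.IsHom φ (boundaryFrame D G Ginv) (boundaryFrame D' G' Ginv') where
  D := hD
  c a b w := by
    simp only [boundaryFrame, map_sub]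
    congr 1 <;> split_ifs <;> simp
  G := hG
  Ginv := hGinv

/-- The derivations `x ∂_s` of functions on the collar. -/
def collarDeriv (s : Fin (d + 1)) (f : EuclideanSpace ℝ (Fin d) × ℝ → ℝ) :
    EuclideanSpace ℝ (Fin d) × ℝ → ℝ := fun z => z.2 * fderiv ℝ f z (dirVec d s)

/-- The frame data of the frame `x ∂_x, x ∂_i` and a family of metrics. -/
def collarFrame (H : EuclideanSpace ℝ (Fin d) × ℝ → Matrix (Fin (d + 1)) (Fin (d + 1)) ℝ) :
    FrameData (d + 1) (EuclideanSpace ℝ (Fin d) × ℝ → ℝ) :=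
  boundaryFrame collarDeriv (Matrix.of fun i j z => H z i j) (Matrix.of fun i j z => (H z)⁻¹ i j)

variable {W : Set (EuclideanSpace ℝ (Fin d) × ℝ)} (hW : IsOpen W)

/-- The derivations `x ∂_s` of smooth functions on `W`. -/
def smoothCollarDeriv (hW : IsOpen W) (s : Fin (d + 1)) (f : SmoothFun W) : SmoothFun W :=
  SmoothFun.mk Prod.snd contDiff_snd.contDiffOn * ⟨derivOn (dirVec d s) f.1, derivOn_mem hW _ f.2⟩

/-- On smooth functions the x ∂_s are genuine derivations, unlike on the ring of all functions.
Coordinate derivatives commute, so the commutator comes only from differentiating the factor x, that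
is from a = 0 or b = 0. -/
theorem isRegular_boundaryFrame {G Ginv : Matrix (Fin (d + 1)) (Fin (d + 1)) (SmoothFun W)}
    (hG : ∀ i j, G i j = G j i) (hinv : G * Ginv = 1) :
    (boundaryFrame (smoothCollarDeriv hW) G Ginv).IsRegular where
  D_add s f g := by
    refine Subtype.ext ?_
    change _ * derivOn _ (f.1 + g.1) = _ * _ + _ * _
    rw [derivOn_add hW _ f.2 g.2, mul_add]
  D_mul s f g := by
    refine Subtype.ext ?_
    change _ * derivOn _ (f.1 * g.1) = _ * _ * _ + _ * (_ * _)
    rw [derivOn_mul hW _ f.2 g.2]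
    ring
  comm a b f := by
    have hx : (fun w : W => (w : EuclideanSpace ℝ (Fin d) × ℝ).2) ∈ SmoothFun W :=
      (SmoothFun.mk Prod.snd contDiff_snd.contDiffOn).2
    have hxd : ∀ s, derivOn (dirVec d s) (fun w : W => (w : EuclideanSpace ℝ (Fin d) × ℝ).2)
        = fun _ => if s = 0 then 1 else 0 := by
      intro s
      funext w
      rw [derivOn_restrict hW _ (F := Prod.snd) fun _ => rfl, fderiv_snd]
      exact dirVec_snd s
    have h2 : ∀ a b, (smoothCollarDeriv hW a (smoothCollarDeriv hW b f)).1
        = (fun w : W => (w : EuclideanSpace ℝ (Fin d) × ℝ).2) *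
          ((fun _ => if a = 0 then 1 else 0) * derivOn (dirVec d b) f.1
            + (fun w : W => (w : EuclideanSpace ℝ (Fin d) × ℝ).2) *
              derivOn (dirVec d a) (derivOn (dirVec d b) f.1)) := by
      intro a b
      change _ * derivOn _ (_ * derivOn _ f.1) = _
      rw [derivOn_mul hW _ (SmoothFun.mk Prod.snd contDiff_snd.contDiffOn).2
        (derivOn_mem hW _ f.2)]
      rw [← hxd]
      rfl
    have hr : ∑ w, (boundaryFrame (smoothCollarDeriv hW) G Ginv).c a b w *
        (boundaryFrame (smoothCollarDeriv hW) G Ginv).D w f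
        = (if a = 0 then smoothCollarDeriv hW b f else 0)
          - if b = 0 then smoothCollarDeriv hW a f else 0 := by
      simp only [boundaryFrame, sub_mul, Finset.sum_sub_distrib]
      by_cases ha : a = 0 <;> by_cases hb : b = 0 <;> simp [ha, hb]
    rw [hr]
    refine Subtype.ext ?_
    change (smoothCollarDeriv hW a (smoothCollarDeriv hW b f)).1
      - (smoothCollarDeriv hW b (smoothCollarDeriv hW a f)).1 = _
    rw [h2, h2, derivOn_comm hW (dirVec d b) _ f.2]
    funext w
    by_cases ha : a = 0 <;> by_cases hb : b = 0 <;> simp [ha, hb, smoothCollarDeriv] <;> ring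
  c_antisymm a b w := by simp [boundaryFrame]
  symm := hG
  inv := hinv

end BoundaryFrame

/-! ### From a chart of the interior to the collar frame -/

section ChangeOfCoordinates

variable {d : ℕ}

/-- The coordinate frame on the smooth functions on an open set. -/
def smoothCoordFrame {m : ℕ} {V : Set (EuclideanSpace ℝ (Fin m))} (hV : IsOpen V)
    (G : Matrix (Fin m) (Fin m) (SmoothFun V)) : FrameData m (SmoothFun V) where
  D s f := ⟨derivOn (EuclideanSpace.single s 1) f.1, derivOn_mem hV _ f.2⟩
  c := 0
  G := G
  Ginv := G⁻¹

/-- Both sides are mapped to the ring of all functions on V, one by restriction and one by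
inclusion; naturality requires no regularity there. -/
theorem eval_eq_smoothCoordFrame {m : ℕ} {V : Set (EuclideanSpace ℝ (Fin m))} (hV : IsOpen V)
    (G : Matrix (Fin m) (Fin m) (SmoothFun V)) (hdet : IsUnit G.det) (g : MetricComponents m)
    (hg : ∀ (v : V) i j, (G i j).1 v = g v i j) (P : ScalarInvariant) (v : V) :
    P.eval g v = ((smoothCoordFrame hV G).invariant P).1 v := by
  let F : FrameData m (V → ℝ) :=
    { D := fun s f => derivOn (EuclideanSpace.single s 1) f
      c := 0
      G := Matrix.of fun i j v => g v i j
      Ginv := Matrix.of fun i j v => (g v)⁻¹ i j }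
  let r : (EuclideanSpace ℝ (Fin m) → ℝ) →ₐ[ℝ] (V → ℝ) :=
    { toFun := fun f v => f v
      map_one' := rfl
      map_mul' := fun _ _ => rfl
      map_zero' := rfl
      map_add' := fun _ _ => rfl
      commutes' := fun _ => rfl }
  have h1 : FrameData.IsHom r (coordFrame g) F :=
    { D := fun s b => funext fun v => (derivOn_restrict hV _ (fun _ => rfl) v).symm
      c := fun _ _ _ => rfl
      G := fun _ _ => rfl
      Ginv := fun _ _ => rfl }
  have h2 : FrameData.IsHom (SmoothFun V).val (smoothCoordFrame hV G) F :=
    { D := fun s b => rfl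
      c := fun _ _ _ => rfl
      G := fun i j => funext fun v => hg v i j
      Ginv := fun i j => funext fun v => by
        change (G⁻¹ i j).1 v = (g v)⁻¹ i j
        rw [SmoothFun.inv_apply hdet]
        rw [show (Matrix.of fun i j => (G i j).1 v) = g v from Matrix.ext fun i j => hg v i j] }
  have e1 := congrFun (h1.invariant P) v
  have e2 := congrFun (h2.invariant P) v
  rw [coordFrame_invariant] at e1
  exact e1.trans e2.symm

theorem collarFrame_invariant {W : Set (EuclideanSpace ℝ (Fin d) × ℝ)} (hW : IsOpen W)
    (G : Matrix (Fin (d + 1)) (Fin (d + 1)) (SmoothFun W)) (hdet : IsUnit G.det)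
    (H : EuclideanSpace ℝ (Fin d) × ℝ → Matrix (Fin (d + 1)) (Fin (d + 1)) ℝ)
    (hH : ∀ (w : W) i j, (G i j).1 w = H w i j) (P : ScalarInvariant) (w : W) :
    (collarFrame H).invariant P w
      = ((boundaryFrame (smoothCollarDeriv hW) G G⁻¹).invariant P).1 w := by
  let D : Fin (d + 1) → (W → ℝ) → (W → ℝ) :=
    fun s f w => (w : EuclideanSpace ℝ (Fin d) × ℝ).2 * derivOn (dirVec d s) f w
  let G' : Matrix (Fin (d + 1)) (Fin (d + 1)) (W → ℝ) := Matrix.of fun i j w => H w i j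
  let G'' : Matrix (Fin (d + 1)) (Fin (d + 1)) (W → ℝ) := Matrix.of fun i j w => (H w)⁻¹ i j
  let r : (EuclideanSpace ℝ (Fin d) × ℝ → ℝ) →ₐ[ℝ] (W → ℝ) :=
    { toFun := fun f v => f v
      map_one' := rfl
      map_mul' := fun _ _ => rfl
      map_zero' := rfl
      map_add' := fun _ _ => rfl
      commutes' := fun _ => rfl }
  have h1 : FrameData.IsHom r (collarFrame H) (boundaryFrame D G' G'') :=
    isHom_boundaryFrame (fun s b => funext fun v =>
      congrArg (_ * ·) (derivOn_restrict hW _ (fun _ => rfl) v).symm) (fun _ _ => rfl)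
      fun _ _ => rfl
  have h2 : FrameData.IsHom (SmoothFun W).val (boundaryFrame (smoothCollarDeriv hW) G G⁻¹)
      (boundaryFrame D G' G'') := by
    refine isHom_boundaryFrame (fun s b => rfl) (fun i j => funext fun v => hH v i j)
      fun i j => funext fun v => ?_
    change (G⁻¹ i j).1 v = (H v)⁻¹ i j
    rw [SmoothFun.inv_apply hdet]
    rw [show (Matrix.of fun i j => (G i j).1 v) = H v from Matrix.ext fun i j => hH v i j]
  exact (congrFun (h1.invariant P) w).trans (congrFun (h2.invariant P) w).symm

/-- Composition with a smooth map. -/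
def SmoothFun.comp {Z Z' : Type*} [NormedAddCommGroup Z] [NormedSpace ℝ Z] [NormedAddCommGroup Z']
    [NormedSpace ℝ Z'] {W : Set Z} {V : Set Z'} (φ : Z → Z') (hφ : ContDiffOn ℝ ∞ φ W)
    (hm : Set.MapsTo φ W V) : SmoothFun V →ₐ[ℝ] SmoothFun W where
  toFun f := ⟨fun w => f.1 ⟨φ w, hm w.2⟩, by
    obtain ⟨F, hF, h⟩ := f.2
    exact ⟨F ∘ φ, hF.comp hφ hm, fun w => h _⟩⟩
  map_one' := rfl
  map_mul' _ _ := rfl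
  map_zero' := rfl
  map_add' _ _ := rfl
  commutes' _ := rfl

/-- A scalar invariant, computed in the coordinates `φ` and in the frame `x ∂_x, x ∂_i`. -/
theorem eval_eq_collarFrame {W : Set (EuclideanSpace ℝ (Fin d) × ℝ)} (hW : IsOpen W)
    {V : Set (EuclideanSpace ℝ (Fin (d + 1)))} (hV : IsOpen V)
    {φ : EuclideanSpace ℝ (Fin d) × ℝ → EuclideanSpace ℝ (Fin (d + 1))}
    (hφ : ContDiffOn ℝ ∞ φ W) (hm : Set.MapsTo φ W V)
    {g : MetricComponents (d + 1)} (hg : ∀ i j, ContDiffOn ℝ ∞ (fun y => g y i j) V)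
    (hsymm : ∀ y ∈ V, ∀ i j, g y i j = g y j i) (hdet : ∀ y ∈ V, (g y).det ≠ 0)
    {H : EuclideanSpace ℝ (Fin d) × ℝ → Matrix (Fin (d + 1)) (Fin (d + 1)) ℝ}
    (hH : ∀ z ∈ W, ∀ i j, H z i j = z.2 ^ 2 * ∑ s, ∑ t, fderiv ℝ φ z (dirVec d i) s
      * fderiv ℝ φ z (dirVec d j) t * g (φ z) s t)
    (hHdet : ∀ z ∈ W, (H z).det ≠ 0) (P : ScalarInvariant)
    {z : EuclideanSpace ℝ (Fin d) × ℝ} (hz : z ∈ W) :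
    P.eval g (φ z) = (collarFrame H).invariant P z := by
  let Φ : SmoothFun V →ₐ[ℝ] SmoothFun W := SmoothFun.comp φ hφ hm
  let GV : Matrix (Fin (d + 1)) (Fin (d + 1)) (SmoothFun V) :=
    Matrix.of fun i j => SmoothFun.mk (fun y => g y i j) (hg i j)
  let G2 : Matrix (Fin (d + 1)) (Fin (d + 1)) (SmoothFun W) := Φ.mapMatrix GV
  let Y : Fin (d + 1) → SmoothFun V := fun t =>
    SmoothFun.mk (fun y => y t) (EuclideanSpace.proj (𝕜 := ℝ) t).contDiff.contDiffOn
  -- x times the Jacobian of φ: row s expresses the field x ∂_s in the coordinate fields of V.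
  let K : Matrix (Fin (d + 1)) (Fin (d + 1)) (SmoothFun W) :=
    Matrix.of fun s t => smoothCollarDeriv hW s (Φ (Y t))
  let G1 : Matrix (Fin (d + 1)) (Fin (d + 1)) (SmoothFun W) := K * G2 * K.transpose
  have hφd : ∀ w : W, DifferentiableAt ℝ φ w := fun w =>
    (hφ.contDiffAt (hW.mem_nhds w.2)).differentiableAt (by simp)
  have hKapply : ∀ s t (w : W), (K s t).1 w
      = (w : EuclideanSpace ℝ (Fin d) × ℝ).2 * fderiv ℝ φ w (dirVec d s) t := by
    intro s t w
    change _ * derivOn _ _ w = _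
    congr 1
    refine (derivOn_restrict hW (dirVec d s) (f := (Φ (Y t)).1) (F := fun z => φ z t)
      (fun _ => rfl) w).trans ?_
    have := ((EuclideanSpace.proj (𝕜 := ℝ) t).hasFDerivAt (x := φ w)).comp
      (w : EuclideanSpace ℝ (Fin d) × ℝ) (hφd w).hasFDerivAt
    rw [show (fun z => φ z t) = EuclideanSpace.proj (𝕜 := ℝ) t ∘ φ from rfl, this.fderiv]
    rfl
  have hG1 : ∀ (w : W) i j, (G1 i j).1 w = H w i j := by
    intro w i j
    rw [hH w w.2, ← SmoothFun.eval_apply]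
    simp only [G1, Matrix.mul_apply, Matrix.transpose_apply, map_sum, map_mul, Finset.sum_mul,
      SmoothFun.eval_apply, hKapply, Finset.mul_sum]
    rw [Finset.sum_comm]
    refine Finset.sum_congr rfl fun s _ => Finset.sum_congr rfl fun t _ => ?_
    have : (G2 s t).1 w = g (φ w) s t := rfl
    rw [this]
    ring
  have hGVdet : IsUnit GV.det := SmoothFun.isUnit_det fun v => hdet v v.2
  have hG2det : IsUnit G2.det := by
    rw [show G2.det = Φ GV.det from (Φ.map_det GV).symm]
    exact hGVdet.map Φ
  have hG1det : IsUnit G1.det := SmoothFun.isUnit_det fun w => by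
    rw [show (Matrix.of fun i j => (G1 i j).1 w) = H w from Matrix.ext fun i j => hG1 w i j]
    exact hHdet w w.2
  -- Nondegeneracy of K g Kᵀ forces φ to have invertible derivative.
  have hKdet : IsUnit K.det := by
    have := hG1det
    simp only [G1, Matrix.det_mul] at this
    exact isUnit_of_mul_isUnit_left (isUnit_of_mul_isUnit_left this)
  have hG1symm : ∀ i j, G1 i j = G1 j i := by
    have h2 : G2.transpose = G2 := by
      exact Matrix.ext fun i j => SmoothFun.ext_apply fun w => hsymm _ (hm w.2) j i
    have : G1.transpose = G1 := by
      simp only [G1, Matrix.transpose_mul, Matrix.transpose_transpose, h2, Matrix.mul_assoc]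
    exact fun i j => congrFun (congrFun this j) i
  have hKK : K * K⁻¹ = 1 := Matrix.mul_nonsing_inv _ hKdet
  have hKK' : K⁻¹ * K = 1 := Matrix.nonsing_inv_mul _ hKdet
  let F1 := boundaryFrame (smoothCollarDeriv hW) G1 G1⁻¹
  have hF1 : F1.IsRegular :=
    isRegular_boundaryFrame hW hG1symm (Matrix.mul_nonsing_inv _ hG1det)
  -- Conversely, the coordinate fields of V written in the collar frame.
  let A : Fin (d + 1) → Fin (d + 1) → SmoothFun W := fun a s => K⁻¹ a s
  let F2 : FrameData (d + 1) (SmoothFun W) :=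
    { D := fun t f => F1.dir (A t) f
      c := 0
      G := G2
      Ginv := G2⁻¹ }
  have hdirY : ∀ b t, F1.dir (A b) (Φ (Y t)) = (1 : Matrix _ _ (SmoothFun W)) b t := fun b t => by
    rw [← hKK']
    rfl
  have hD1 : ∀ X : Fin (d + 1) → SmoothFun W, F1.dir X 1 = 0 := by
    intro X
    have := hF1.dir_mul X 1 1
    simpa using this
  have hframe : F1.IsFrame A F2 :=
    { D := fun s f => rfl
      c := fun a b => by
        -- A bracket of coordinate fields annihilates every coordinate function, since those fields
        -- send them to constants; as K is invertible, the bracket is zero.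
        have hV0 : ∀ t, F1.dir (F1.bracket (A a) (A b)) (Φ (Y t)) = 0 := by
          intro t
          rw [hF1.dir_bracket, hdirY, hdirY]
          have : ∀ c, F1.dir (A c) 0 = 0 := fun c => by
            have := hF1.dir_add (A c) 0 0
            simpa using this
          simp only [Matrix.one_apply]
          split_ifs <;> simp [hD1, this]
        have h1 : Matrix.vecMul (F1.bracket (A a) (A b)) K = 0 := funext hV0
        have h2 := congrArg (fun v => Matrix.vecMul v K⁻¹) h1
        simp only [Matrix.vecMul_vecMul, hKK, Matrix.vecMul_one, Matrix.zero_vecMul] at h2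
        rw [h2]
        simp [F2]
      G := fun i j => by
        have h : G2 = K⁻¹ * G1 * K⁻¹.transpose := by
          have h3 : K.transpose * K⁻¹.transpose = 1 := by
            rw [← Matrix.transpose_mul, hKK', Matrix.transpose_one]
          simp only [G1, Matrix.mul_assoc, h3, Matrix.mul_one]
          rw [← Matrix.mul_assoc, hKK', Matrix.one_mul]
        change G2 i j = _
        conv_lhs => rw [h]
        simp only [FrameData.inn, Matrix.mul_apply, Matrix.transpose_apply, Finset.sum_mul]
        rw [Finset.sum_comm]
        exact Finset.sum_congr rfl fun _ _ => Finset.sum_congr rfl fun _ _ => by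
          simp only [F1, A, boundaryFrame]; ring
      inv := Matrix.mul_nonsing_inv _ hG2det }
  -- Pullback by φ intertwines the coordinate derivations with those of `F2`: this is the chain rule
  -- combined with K⁻¹ K = 1.
  have hhom : FrameData.IsHom Φ (smoothCoordFrame hV GV) F2 :=
    { D := fun t f => by
        obtain ⟨F, hF, rfl⟩ := SmoothFun.exists_eq_mk f
        have h1 : ∀ s, smoothCollarDeriv hW s (Φ (SmoothFun.mk F hF))
            = ∑ t, K s t * Φ ((smoothCoordFrame hV GV).D t (SmoothFun.mk F hF)) := by
          intro s
          refine SmoothFun.ext_apply fun w => ?_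
          rw [← SmoothFun.eval_apply w (∑ t, _), map_sum]
          simp only [map_mul, SmoothFun.eval_apply, hKapply]
          change _ * derivOn _ _ w = _
          rw [show derivOn (dirVec d s) (Φ (SmoothFun.mk F hF)).1 w
              = fderiv ℝ (F ∘ φ) w (dirVec d s) from
            derivOn_restrict hW (dirVec d s) (f := (Φ (SmoothFun.mk F hF)).1) (F := F ∘ φ)
              (fun _ => rfl) w]
          have hFd : DifferentiableAt ℝ F (φ w) :=
            (hF.contDiffAt (hV.mem_nhds (hm w.2))).differentiableAt (by simp)
          rw [fderiv_comp _ hFd (hφd w)]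
          have hv : fderiv ℝ φ w (dirVec d s)
              = ∑ t, fderiv ℝ φ w (dirVec d s) t • EuclideanSpace.single t (1 : ℝ) := by
            ext i
            simp [Pi.single_apply]
          rw [ContinuousLinearMap.comp_apply, hv, map_sum, ← hv, Finset.mul_sum]
          refine Finset.sum_congr rfl fun t _ => ?_
          rw [map_smul, smul_eq_mul, mul_assoc]
          congr 2
          exact (derivOn_restrict hV _ (fun _ => rfl) ⟨φ w, hm w.2⟩).symm
        change _ = ∑ s, K⁻¹ t s * smoothCollarDeriv hW s (Φ (SmoothFun.mk F hF))
        simp only [h1, Finset.mul_sum, ← mul_assoc]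
        rw [Finset.sum_comm]
        simp only [← Finset.sum_mul, ← Matrix.mul_apply, hKK', Matrix.one_apply, ite_mul, one_mul,
          zero_mul, Finset.sum_ite_eq, Finset.mem_univ, if_true]
      c := fun _ _ _ => map_zero Φ
      G := fun _ _ => rfl
      Ginv := fun i j => by
        have h := congrArg Φ.mapMatrix (Matrix.mul_nonsing_inv GV hGVdet)
        rw [map_mul, map_one] at h
        exact congrFun (congrFun (Matrix.inv_eq_right_inv h) i) j |>.symm }
  rw [collarFrame_invariant hW G1 hG1det H hG1 P ⟨z, hz⟩,
    eval_eq_smoothCoordFrame hV GV hGVdet g (fun _ _ _ => rfl) P ⟨φ z, hm hz⟩,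
    ← hframe.invariant_eq hF1 P, ← hhom.invariant P]
  rfl

end ChangeOfCoordinates

/-! ### Components of metrics in charts -/

section Charts

variable {m : ℕ} {M : Type*} [TopologicalSpace M] [ChartedSpace (EuclideanSpace ℝ (Fin m)) M]
  [IsManifold (𝓡 m) ∞ M] {e : OpenPartialHomeomorph M (EuclideanSpace ℝ (Fin m))}

theorem contMDiffOn_coordVec (he : e ∈ IsManifold.maximalAtlas (𝓡 m) ∞ M) (i : Fin m) :
    ContMDiffOn 𝓘(ℝ, EuclideanSpace ℝ (Fin m)) ((𝓡 m).prod 𝓘(ℝ, EuclideanSpace ℝ (Fin m))) ∞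
      (fun y => Bundle.TotalSpace.mk' (EuclideanSpace ℝ (Fin m)) (E := TangentSpace (𝓡 m) (M := M))
        (e.symm y) (coordVec e i y)) e.target := by
  have : IsManifold (𝓡 m) 1 M := IsManifold.of_le (n := ∞) (WithTop.coe_le_coe.mpr le_top)
  have h1 := (contMDiffOn_symm_of_mem_maximalAtlas he).contMDiffOn_tangentMapWithin (m := ∞)
    (by simp) e.open_target.uniqueMDiffOn
  have h2 : ContMDiff 𝓘(ℝ, EuclideanSpace ℝ (Fin m))
      (𝓘(ℝ, EuclideanSpace ℝ (Fin m)).prod 𝓘(ℝ, EuclideanSpace ℝ (Fin m))) ∞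
      (fun y => (⟨y, EuclideanSpace.single i 1⟩ :
        TangentBundle 𝓘(ℝ, EuclideanSpace ℝ (Fin m)) (EuclideanSpace ℝ (Fin m)))) :=
    contMDiff_vectorSpace_iff_contDiff.2 contDiff_const
  refine (h1.comp h2.contMDiffOn fun y hy => hy).congr fun y hy => ?_
  simp only [Function.comp, tangentMapWithin, mfderivWithin_of_isOpen e.open_target hy]
  rfl

theorem contDiffOn_components (he : e ∈ IsManifold.maximalAtlas (𝓡 m) ∞ M) (g : SmoothMetric m M)
    (i j : Fin m) : ContDiffOn ℝ ∞ (fun y => components e g.inner y i j) e.target := by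
  rw [← contMDiffOn_iff_contDiffOn]
  intro y hy
  have hb := (contMDiffOn_symm_of_mem_maximalAtlas he) y hy
  have : ContMDiffWithinAt 𝓘(ℝ, EuclideanSpace ℝ (Fin m)) ((𝓡 m).prod 𝓘(ℝ)) ∞
      (fun y => Bundle.TotalSpace.mk' ℝ (E := Bundle.Trivial M ℝ) (e.symm y)
        (g.inner (e.symm y) (coordVec e i y) (coordVec e j y))) e.target y := by
    apply ContMDiffWithinAt.clm_bundle_apply₂ (F₁ := EuclideanSpace ℝ (Fin m))
      (F₂ := EuclideanSpace ℝ (Fin m))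
    · exact ContMDiffAt.comp_contMDiffWithinAt y g.contMDiff.contMDiffAt hb
    · exact contMDiffOn_coordVec he i y hy
    · exact contMDiffOn_coordVec he j y hy
  simp only [Bundle.contMDiffWithinAt_totalSpace] at this
  exact this.2

theorem components_apply_sum (B : BilinField m M) (y v w : EuclideanSpace ℝ (Fin m)) :
    ∑ s, ∑ t, v s * w t * components e B y s t
      = B (e.symm y) (mfderiv 𝓘(ℝ, EuclideanSpace ℝ (Fin m)) (𝓡 m) e.symm y v)
        (mfderiv 𝓘(ℝ, EuclideanSpace ℝ (Fin m)) (𝓡 m) e.symm y w) := by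
  have hv : ∀ v : EuclideanSpace ℝ (Fin m), v = ∑ t, v t • EuclideanSpace.single t (1 : ℝ) := by
    intro v
    ext i
    simp [Pi.single_apply]
  have hd : ∀ v : EuclideanSpace ℝ (Fin m), mfderiv 𝓘(ℝ, EuclideanSpace ℝ (Fin m)) (𝓡 m) e.symm y v
      = ∑ t, v t • coordVec e t y := by
    intro v
    conv_lhs => rw [hv v]
    refine (map_sum _ _ _).trans (Finset.sum_congr rfl fun t _ => ?_)
    exact map_smul _ _ _
  rw [hd, hd]
  simp only [map_sum, map_smul, sum_apply, smul_apply,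
    smul_eq_mul, Finset.mul_sum, components, Matrix.of_apply]
  rw [Finset.sum_comm]
  exact Finset.sum_congr rfl fun _ _ => Finset.sum_congr rfl fun _ _ => by ring

theorem mfderiv_injective_of_leftInverse {E₁ E₂ H₁ H₂ M₁ M₂ : Type*} [NormedAddCommGroup E₁]
    [NormedSpace ℝ E₁] [TopologicalSpace H₁] {I₁ : ModelWithCorners ℝ E₁ H₁} [TopologicalSpace M₁]
    [ChartedSpace H₁ M₁] [NormedAddCommGroup E₂]
    [NormedSpace ℝ E₂] [TopologicalSpace H₂] {I₂ : ModelWithCorners ℝ E₂ H₂} [TopologicalSpace M₂]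
    [ChartedSpace H₂ M₂] {f : M₁ → M₂} {f' : M₂ → M₁} {p : M₁} (hf : MDifferentiableAt I₁ I₂ f p)
    (hf' : MDifferentiableAt I₂ I₁ f' (f p)) (h : ∀ᶠ q in 𝓝 p, f' (f q) = q) :
    Function.Injective (mfderiv I₁ I₂ f p) := by
  have h1 := mfderiv_comp p hf' hf
  have h2 : mfderiv I₁ I₁ (f' ∘ f) p = mfderiv I₁ I₁ id p := Filter.EventuallyEq.mfderiv_eq h
  intro v w hvw
  have h3 : ∀ v : TangentSpace I₁ p, mfderiv I₂ I₁ f' (f p) (mfderiv I₁ I₂ f p v) = (v : E₁) := by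
    intro v
    have := congrArg (fun l : E₁ →L[ℝ] E₁ => l v) (h1.symm.trans (h2.trans mfderiv_id))
    exact this
  exact (h3 v).symm.trans ((congrArg _ hvw).trans (h3 w))

theorem mfderiv_chart_symm_injective (he : e ∈ IsManifold.maximalAtlas (𝓡 m) ∞ M)
    {y : EuclideanSpace ℝ (Fin m)} (hy : y ∈ e.target) :
    Function.Injective (mfderiv 𝓘(ℝ, EuclideanSpace ℝ (Fin m)) (𝓡 m) e.symm y) := by
  refine mfderiv_injective_of_leftInverse (f' := e)
    ((contMDiffAt_symm_of_mem_maximalAtlas he hy).mdifferentiableAt (by simp))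
    ((contMDiffAt_of_mem_maximalAtlas he (e.map_target hy)).mdifferentiableAt (by simp)) ?_
  filter_upwards [e.open_target.mem_nhds hy] with z hz using e.right_inv hz

theorem det_components_ne_zero (he : e ∈ IsManifold.maximalAtlas (𝓡 m) ∞ M) {B : BilinField m M}
    {y : EuclideanSpace ℝ (Fin m)} (hy : y ∈ e.target)
    (hB : ∀ v : TangentSpace (𝓡 m) (e.symm y), v ≠ 0 → 0 < B (e.symm y) v v) :
    (components e B y).det ≠ 0 := by
  intro h0
  obtain ⟨v, hv, h⟩ := Matrix.exists_mulVec_eq_zero_iff.mpr h0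
  have h1 := components_apply_sum (e := e) B y (WithLp.toLp 2 v) (WithLp.toLp 2 v)
  have h2 : ∑ s, ∑ t, v s * v t * components e B y s t = 0 := by
    have : ∀ s, ∑ t, v s * v t * components e B y s t = v s * (components e B y).mulVec v s := by
      intro s
      rw [Matrix.mulVec, dotProduct, Finset.mul_sum]
      exact Finset.sum_congr rfl fun t _ => by ring
    simp [this, h]
  refine (hB _ ?_).ne' (h1.symm.trans h2)
  intro h3
  have := mfderiv_chart_symm_injective he hy (h3.trans (map_zero _).symm)
  exact hv (funext fun i => congrFun (congrArg WithLp.ofLp this) i)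

end Charts

/-! ### The metric in the collar -/

section Augment

variable {d : ℕ} {R : Type*} [CommRing R]

/-- The block matrix `1 ⊕ M`. -/
def augment (M : Matrix (Fin d) (Fin d) R) : Matrix (Fin (d + 1)) (Fin (d + 1)) R :=
  Matrix.of (Fin.cons (Fin.cons 1 0) fun i => Fin.cons 0 (M i))

@[simp]
theorem augment_zero_zero (M : Matrix (Fin d) (Fin d) R) : augment M 0 0 = 1 := rfl

@[simp]
theorem augment_zero_succ (M : Matrix (Fin d) (Fin d) R) (j : Fin d) : augment M 0 j.succ = 0 := rfl

@[simp]
theorem augment_succ_zero (M : Matrix (Fin d) (Fin d) R) (i : Fin d) : augment M i.succ 0 = 0 := rfl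

@[simp]
theorem augment_succ_succ (M : Matrix (Fin d) (Fin d) R) (i j : Fin d) :
    augment M i.succ j.succ = M i j := rfl

theorem augment_mul (M M' : Matrix (Fin d) (Fin d) R) : augment M * augment M' = augment (M * M') := by
  refine Matrix.ext fun i j => ?_
  rw [Matrix.mul_apply, Fin.sum_univ_succ]
  refine Fin.cases ?_ (fun i => ?_) i <;> refine Fin.cases ?_ (fun j => ?_) j <;>
    simp [Matrix.mul_apply]

theorem augment_one : augment (1 : Matrix (Fin d) (Fin d) R) = 1 := by
  refine Matrix.ext fun i j => ?_
  refine Fin.cases ?_ (fun i => ?_) i <;> refine Fin.cases ?_ (fun j => ?_) j <;>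
    simp [Matrix.one_apply, Fin.succ_ne_zero, (Fin.succ_ne_zero _).symm]

theorem augment_transpose (M : Matrix (Fin d) (Fin d) R) :
    (augment M).transpose = augment M.transpose := by
  refine Matrix.ext fun i j => ?_
  refine Fin.cases ?_ (fun i => ?_) i <;> refine Fin.cases ?_ (fun j => ?_) j <;> simp

theorem augment_inv {M : Matrix (Fin d) (Fin d) R} (h : IsUnit M.det) :
    (augment M)⁻¹ = augment M⁻¹ :=
  Matrix.inv_eq_right_inv (by rw [augment_mul, Matrix.mul_nonsing_inv _ h, augment_one])

theorem isUnit_det_augment {M : Matrix (Fin d) (Fin d) R} (h : IsUnit M.det) :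
    IsUnit (augment M).det := by
  rw [← Matrix.isUnit_iff_isUnit_det]
  exact IsUnit.of_mul_eq_one (augment M⁻¹)
    (by rw [augment_mul, Matrix.mul_nonsing_inv _ h, augment_one])

end Augment

namespace SpecialCollar

variable {d : ℕ} {M N : Type*}
  [TopologicalSpace M] [ChartedSpace (EuclideanSpace ℝ (Fin (d + 1))) M]
  [IsManifold (𝓡 (d + 1)) ∞ M]
  [TopologicalSpace N] [ChartedSpace (EuclideanSpace ℝ (Fin d)) N]
  [IsManifold (𝓡 d) ∞ N] (X : SpecialCollar d M N)

theorem mem_source {q : N} {t : ℝ} (ht : t ∈ Set.Ioo 0 X.ε) : (q, t) ∈ X.collar.source := by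
  rw [X.collar_source]
  exact ⟨trivial, ht⟩

theorem mfderiv_collar_injective {q : N} {t : ℝ} (ht : t ∈ Set.Ioo 0 X.ε) :
    Function.Injective (mfderiv ((𝓡 d).prod 𝓘(ℝ, ℝ)) (𝓡 (d + 1)) X.collar (q, t)) := by
  have hs := X.mem_source (q := q) ht
  refine mfderiv_injective_of_leftInverse (f' := X.collar.symm)
    (X.collar.mdifferentiableAt (by simp) hs)
    (X.collar.symm.mdifferentiableAt (by simp) (X.collar.map_source hs)) ?_
  filter_upwards [X.collar.open_source.mem_nhds hs] with z hz using X.collar.left_inv hz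

theorem G_symm {q : N} {t : ℝ} (ht : t ∈ Set.Ioo 0 X.ε) (v w : TangentSpace (𝓡 d) q) :
    X.G t q v w = X.G t q w v := by
  have h1 := X.normal_form q t ht v w 0 0
  have h2 := X.normal_form q t ht w v 0 0
  rw [X.g.symm] at h2
  have := h1.symm.trans h2
  simpa using this

theorem G_pos {q : N} {t : ℝ} (ht : t ∈ Set.Ioo 0 X.ε) (v : TangentSpace (𝓡 d) q) (hv : v ≠ 0) :
    0 < X.G t q v v := by
  have h1 := X.normal_form q t ht v v 0 0
  rw [zero_mul, zero_add] at h1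
  refine lt_of_lt_of_eq (mul_pos (pow_pos ht.1 2) (X.g.pos _ _ fun h => hv ?_)) h1
  have := X.mfderiv_collar_injective ht (h.trans (map_zero _).symm)
  exact congrArg Prod.fst this

variable {e : OpenPartialHomeomorph N (EuclideanSpace ℝ (Fin d))}

/-- The matrix of `x² g` in the collar, in coordinates. -/
def metricMatrix (e : OpenPartialHomeomorph N (EuclideanSpace ℝ (Fin d)))
    (z : EuclideanSpace ℝ (Fin d) × ℝ) : Matrix (Fin (d + 1)) (Fin (d + 1)) ℝ :=
  augment (components e (X.G z.2) z.1)

theorem metricMatrix_apply (z : EuclideanSpace ℝ (Fin d) × ℝ) (i j : Fin (d + 1)) :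
    X.metricMatrix e z i j = (dirVec d i).2 * (dirVec d j).2 + X.G z.2 (e.symm z.1)
      (mfderiv 𝓘(ℝ, EuclideanSpace ℝ (Fin d)) (𝓡 d) e.symm z.1 (dirVec d i).1)
      (mfderiv 𝓘(ℝ, EuclideanSpace ℝ (Fin d)) (𝓡 d) e.symm z.1 (dirVec d j).1) := by
  have h0 : mfderiv 𝓘(ℝ, EuclideanSpace ℝ (Fin d)) (𝓡 d) e.symm z.1
    (0 : EuclideanSpace ℝ (Fin d)) = 0 := map_zero _
  refine Fin.cases ?_ (fun i => ?_) i <;> refine Fin.cases ?_ (fun j => ?_) j <;>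
    simp only [metricMatrix, dirVec, Fin.cons_zero, Fin.cons_succ, augment_zero_zero,
      augment_zero_succ, augment_succ_zero, augment_succ_succ, h0, map_zero, mul_zero,
      mul_one, add_zero, zero_add, zero_apply]
  rfl

theorem mfderiv_collar_coord (he : e ∈ IsManifold.maximalAtlas (𝓡 d) ∞ N)
    {z : EuclideanSpace ℝ (Fin d) × ℝ} (hz : z.1 ∈ e.target) (ht : z.2 ∈ Set.Ioo 0 X.ε)
    (v : EuclideanSpace ℝ (Fin d) × ℝ) :
    ContMDiffAt 𝓘(ℝ, EuclideanSpace ℝ (Fin d) × ℝ) (𝓡 (d + 1)) ∞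
      (fun z : EuclideanSpace ℝ (Fin d) × ℝ => X.collar (e.symm z.1, z.2)) z ∧
    mfderiv 𝓘(ℝ, EuclideanSpace ℝ (Fin d) × ℝ) (𝓡 (d + 1))
      (fun z : EuclideanSpace ℝ (Fin d) × ℝ => X.collar (e.symm z.1, z.2)) z v
    = mfderiv ((𝓡 d).prod 𝓘(ℝ, ℝ)) (𝓡 (d + 1)) X.collar (e.symm z.1, z.2)
      (show EuclideanSpace ℝ (Fin d) × ℝ from
        (mfderiv 𝓘(ℝ, EuclideanSpace ℝ (Fin d)) (𝓡 d) e.symm z.1 v.1, v.2)) := by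
  have hs := X.mem_source (q := e.symm z.1) ht
  have h1 : ContMDiffAt 𝓘(ℝ, EuclideanSpace ℝ (Fin d) × ℝ) 𝓘(ℝ, EuclideanSpace ℝ (Fin d)) ∞
    (Prod.fst : EuclideanSpace ℝ (Fin d) × ℝ → _) z := contDiff_fst.contMDiff.contMDiffAt
  have h2 : ContMDiffAt 𝓘(ℝ, EuclideanSpace ℝ (Fin d) × ℝ) 𝓘(ℝ, ℝ) ∞
    (Prod.snd : EuclideanSpace ℝ (Fin d) × ℝ → _) z := contDiff_snd.contMDiff.contMDiffAt
  have h3 := (contMDiffAt_symm_of_mem_maximalAtlas he hz)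
  have h4 : ContMDiffAt 𝓘(ℝ, EuclideanSpace ℝ (Fin d) × ℝ) (𝓡 d) ∞ (e.symm ∘ Prod.fst) z :=
    h3.comp z h1
  have h5 : ContMDiffAt 𝓘(ℝ, EuclideanSpace ℝ (Fin d) × ℝ) ((𝓡 d).prod 𝓘(ℝ, ℝ)) ∞
      (fun z : EuclideanSpace ℝ (Fin d) × ℝ => ((e.symm ∘ Prod.fst) z, z.2)) z :=
    h4.prodMk h2
  have h6 : ContMDiffAt ((𝓡 d).prod 𝓘(ℝ, ℝ)) (𝓡 (d + 1)) ∞ X.collar (e.symm z.1, z.2) :=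
    X.collar.contMDiffOn.contMDiffAt (X.collar.open_source.mem_nhds hs)
  refine ⟨h6.comp z h5, ?_⟩
  have e1 := mfderiv_comp z (h6.mdifferentiableAt (by simp)) (h5.mdifferentiableAt (by simp))
  have e2 := mfderiv_prodMk (h4.mdifferentiableAt (by simp)) (h2.mdifferentiableAt (by simp))
  have e3 := mfderiv_comp z (h3.mdifferentiableAt (by simp)) (h1.mdifferentiableAt (by simp))
  rw [mfderiv_eq_fderiv (f := Prod.fst)] at e3
  rw [mfderiv_eq_fderiv (f := Prod.snd)] at e2
  rw [e3, fderiv_fst, fderiv_snd] at e2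
  rw [e2] at e1
  exact congrArg (fun l : (EuclideanSpace ℝ (Fin d) × ℝ) →L[ℝ] EuclideanSpace ℝ (Fin (d + 1)) =>
    l v) e1

/-- The collar, in the coordinates `e` on the boundary and `κ` in the interior. -/
def transition (e : OpenPartialHomeomorph N (EuclideanSpace ℝ (Fin d)))
    (κ : OpenPartialHomeomorph M (EuclideanSpace ℝ (Fin (d + 1))))
    (z : EuclideanSpace ℝ (Fin d) × ℝ) : EuclideanSpace ℝ (Fin (d + 1)) :=
  κ (X.collar (e.symm z.1, z.2))

/-- The points at which the coordinates `e` and `κ` are defined. -/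
def transitionSource (e : OpenPartialHomeomorph N (EuclideanSpace ℝ (Fin d)))
    (κ : OpenPartialHomeomorph M (EuclideanSpace ℝ (Fin (d + 1)))) :
    Set (EuclideanSpace ℝ (Fin d) × ℝ) :=
  (e.target ×ˢ Set.Ioo 0 X.ε) ∩ (fun z => X.collar (e.symm z.1, z.2)) ⁻¹' κ.source

variable {κ : OpenPartialHomeomorph M (EuclideanSpace ℝ (Fin (d + 1)))}

theorem isOpen_transitionSource (he : e ∈ IsManifold.maximalAtlas (𝓡 d) ∞ N) :
    IsOpen (X.transitionSource e κ) :=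
  ContinuousOn.isOpen_inter_preimage (fun _ hz =>
    (X.mfderiv_collar_coord he hz.1 hz.2 0).1.continuousAt.continuousWithinAt)
    (e.open_target.prod isOpen_Ioo) κ.open_source

theorem contDiffAt_transition (he : e ∈ IsManifold.maximalAtlas (𝓡 d) ∞ N)
    (hκ : κ ∈ IsManifold.maximalAtlas (𝓡 (d + 1)) ∞ M) {z : EuclideanSpace ℝ (Fin d) × ℝ}
    (hz : z ∈ X.transitionSource e κ) : ContDiffAt ℝ ∞ (X.transition e κ) z := by
  rw [← contMDiffAt_iff_contDiffAt]
  exact ContMDiffAt.comp z (contMDiffAt_of_mem_maximalAtlas hκ hz.2)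
    (X.mfderiv_collar_coord he hz.1.1 hz.1.2 0).1

theorem symm_transition {z : EuclideanSpace ℝ (Fin d) × ℝ} (hz : z ∈ X.transitionSource e κ) :
    κ.symm (X.transition e κ z) = X.collar (e.symm z.1, z.2) := κ.left_inv hz.2

theorem mfderiv_symm_transition (he : e ∈ IsManifold.maximalAtlas (𝓡 d) ∞ N)
    (hκ : κ ∈ IsManifold.maximalAtlas (𝓡 (d + 1)) ∞ M) {z : EuclideanSpace ℝ (Fin d) × ℝ}
    (hz : z ∈ X.transitionSource e κ) (v : EuclideanSpace ℝ (Fin d) × ℝ) :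
    mfderiv 𝓘(ℝ, EuclideanSpace ℝ (Fin (d + 1))) (𝓡 (d + 1)) κ.symm (X.transition e κ z)
      (fderiv ℝ (X.transition e κ) z v)
    = (mfderiv ((𝓡 d).prod 𝓘(ℝ, ℝ)) (𝓡 (d + 1)) X.collar (e.symm z.1, z.2)
      (show EuclideanSpace ℝ (Fin d) × ℝ from
        (mfderiv 𝓘(ℝ, EuclideanSpace ℝ (Fin d)) (𝓡 d) e.symm z.1 v.1, v.2)) :
          EuclideanSpace ℝ (Fin (d + 1))) := by
  rw [← (X.mfderiv_collar_coord he hz.1.1 hz.1.2 v).2]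
  have e1 := mfderiv_comp z
    ((contMDiffAt_symm_of_mem_maximalAtlas hκ (κ.map_source hz.2)).mdifferentiableAt (by simp))
    ((X.contDiffAt_transition he hκ hz).contMDiffAt.mdifferentiableAt (by simp))
  rw [mfderiv_eq_fderiv (f := X.transition e κ)] at e1
  have e2 : κ.symm ∘ X.transition e κ =ᶠ[𝓝 z] fun z => X.collar (e.symm z.1, z.2) := by
    filter_upwards [(X.isOpen_transitionSource he).mem_nhds hz] with z hz using X.symm_transition hz
  have e3 := e1.symm.trans e2.mfderiv_eq
  exact congrArg (fun l : (EuclideanSpace ℝ (Fin d) × ℝ) →L[ℝ] EuclideanSpace ℝ (Fin (d + 1)) =>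
    l v) e3

/-- The normal form evaluated on the coordinate directions of the collar, transported to the chart κ
by the chain rule; it supplies the hypothesis `hH` of `eval_eq_collarFrame`. -/
theorem metricMatrix_eq (he : e ∈ IsManifold.maximalAtlas (𝓡 d) ∞ N)
    (hκ : κ ∈ IsManifold.maximalAtlas (𝓡 (d + 1)) ∞ M) {z : EuclideanSpace ℝ (Fin d) × ℝ}
    (hz : z ∈ X.transitionSource e κ) (i j : Fin (d + 1)) :
    X.metricMatrix e z i j = z.2 ^ 2 * ∑ s, ∑ t, fderiv ℝ (X.transition e κ) z (dirVec d i) s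
      * fderiv ℝ (X.transition e κ) z (dirVec d j) t
        * components κ X.g.inner (X.transition e κ z) s t := by
  -- Reading tangent vectors in the fixed model space allows the base point to be rewritten.
  let gE : M → EuclideanSpace ℝ (Fin (d + 1)) → EuclideanSpace ℝ (Fin (d + 1)) → ℝ :=
    fun p v w => X.g.inner p v w
  rw [components_apply_sum, metricMatrix_apply]
  change _ = _ * gE (κ.symm (X.transition e κ z)) _ _
  rw [X.symm_transition hz]
  exact (X.normal_form _ _ hz.1.2 _ _ _ _).symm.trans (congrArg (z.2 ^ 2 * ·)
    (congrArg₂ (gE _) (X.mfderiv_symm_transition he hκ hz _).symm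
      (X.mfderiv_symm_transition he hκ hz _).symm))

theorem eval_transition (he : e ∈ IsManifold.maximalAtlas (𝓡 d) ∞ N)
    (hκ : κ ∈ IsManifold.maximalAtlas (𝓡 (d + 1)) ∞ M) (P : ScalarInvariant)
    {z : EuclideanSpace ℝ (Fin d) × ℝ} (hz : z ∈ X.transitionSource e κ) :
    P.eval (components κ X.g.inner) (X.transition e κ z)
      = (collarFrame (X.metricMatrix e)).invariant P z :=
  eval_eq_collarFrame (X.isOpen_transitionSource he) κ.open_target
    (fun _ hz => (X.contDiffAt_transition he hκ hz).contDiffWithinAt)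
    (fun _ hz => κ.map_source hz.2) (contDiffOn_components hκ X.g)
    (fun _ _ _ _ => X.g.symm _ _ _)
    (fun _ hy => det_components_ne_zero hκ hy fun v hv => X.g.pos _ v hv)
    (fun _ hz => X.metricMatrix_eq he hκ hz)
    (fun _ hz => (isUnit_det_augment (isUnit_iff_ne_zero.mpr
      (det_components_ne_zero he hz.1.1 (X.G_pos hz.1.2)))).ne_zero) P hz

/-- Scalar invariants in the collar are computed in the frame `x ∂_x, x ∂_i`. -/
theorem onManifold_collar (he : e ∈ IsManifold.maximalAtlas (𝓡 d) ∞ N) (P : ScalarInvariant)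
    {u : EuclideanSpace ℝ (Fin d)} (hu : u ∈ e.target) {t : ℝ} (ht : t ∈ Set.Ioo 0 X.ε) :
    P.onManifold X.g (X.collar (e.symm u, t))
      = (collarFrame (X.metricMatrix e)).invariant P (u, t) := by
  have hz : ((u, t) : EuclideanSpace ℝ (Fin d) × ℝ) ∈ X.transitionSource e
      (chartAt (EuclideanSpace ℝ (Fin (d + 1))) (X.collar (e.symm u, t))) :=
    ⟨⟨hu, ht⟩, mem_chart_source _ _⟩
  rw [← X.eval_transition he (IsManifold.chart_mem_maximalAtlas _) P hz]
  rfl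

end SpecialCollar

/-! ### Simultaneous diagonalization -/

section Diagonalize

variable {d : ℕ}

theorem exists_orthogonal_diagonal {k : Matrix (Fin d) (Fin d) ℝ} (hk : k.transpose = k) :
    ∃ (U : Matrix (Fin d) (Fin d) ℝ) (μ : Fin d → ℝ),
      U * U.transpose = 1 ∧ U.transpose * U = 1 ∧ k = U * Matrix.diagonal μ * U.transpose := by
  have hk' : k.IsHermitian := by
    rw [Matrix.IsHermitian, Matrix.conjTranspose_eq_transpose_of_trivial, hk]
  have h1 := hk'.spectral_theorem
  rw [Unitary.conjStarAlgAut_apply] at h1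
  refine ⟨hk'.eigenvectorUnitary, hk'.eigenvalues, ?_, ?_, ?_⟩
  · have := Matrix.mem_unitaryGroup_iff.1 hk'.eigenvectorUnitary.2
    rwa [Matrix.star_eq_conjTranspose, Matrix.conjTranspose_eq_transpose_of_trivial] at this
  · have := Matrix.mem_unitaryGroup_iff'.1 hk'.eigenvectorUnitary.2
    rwa [Matrix.star_eq_conjTranspose, Matrix.conjTranspose_eq_transpose_of_trivial] at this
  · conv_lhs => rw [h1]
    rw [Matrix.star_eq_conjTranspose, Matrix.conjTranspose_eq_transpose_of_trivial]
    rfl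

/-- Diagonalize γ and rescale by the inverse square roots of its positive eigenvalues, so that it
becomes the identity; then diagonalize k by an orthogonal matrix, which preserves the identity. -/
theorem exists_simultaneous_diagonal {γ k : Matrix (Fin d) (Fin d) ℝ} (hγ : γ.transpose = γ)
    (hpos : ∀ v, v ≠ 0 → 0 < v ⬝ᵥ γ.mulVec v) (hk : k.transpose = k) :
    ∃ (a : Matrix (Fin d) (Fin d) ℝ) (μ : Fin d → ℝ),
      a * γ * a.transpose = 1 ∧ a * k * a.transpose = Matrix.diagonal μ := by
  obtain ⟨U, l, hU, hU', h⟩ := exists_orthogonal_diagonal hγ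
  have hl : ∀ i, 0 < l i := by
    intro i
    have h2 : U.transpose * γ * U = Matrix.diagonal l := by
      rw [h]
      simp only [← Matrix.mul_assoc, hU', Matrix.one_mul]
      rw [Matrix.mul_assoc, hU', Matrix.mul_one]
    have h3 : U.mulVec (Pi.single i 1) ≠ 0 := by
      intro h4
      have := congrArg U.transpose.mulVec h4
      rw [Matrix.mulVec_mulVec, hU', Matrix.one_mulVec, Matrix.mulVec_zero] at this
      simpa using congrFun this i
    have h5 := hpos _ h3
    rw [Matrix.mulVec_mulVec, ← Matrix.vecMul_transpose, ← Matrix.dotProduct_mulVec,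
      Matrix.mulVec_mulVec, ← Matrix.mul_assoc, h2] at h5
    simpa using h5
  let s : Matrix (Fin d) (Fin d) ℝ := Matrix.diagonal fun i => (Real.sqrt (l i))⁻¹
  have hs : s * Matrix.diagonal l * s.transpose = 1 := by
    simp only [s, Matrix.diagonal_transpose, Matrix.diagonal_mul_diagonal]
    rw [← Matrix.diagonal_one]
    congr 1
    funext i
    have := Real.mul_self_sqrt (hl i).le
    have h0 : Real.sqrt (l i) ≠ 0 := (Real.sqrt_pos.mpr (hl i)).ne'
    field_simp
    nlinarith
  let b := s * U.transpose
  have hb : b * γ * b.transpose = 1 := by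
    simp only [b, Matrix.transpose_mul, Matrix.transpose_transpose]
    calc s * U.transpose * γ * (U * s.transpose)
        = s * (U.transpose * U) * Matrix.diagonal l * (U.transpose * U) * s.transpose := by
          rw [h]; simp only [Matrix.mul_assoc]
      _ = 1 := by rw [hU', Matrix.mul_one, Matrix.mul_one, hs]
  have hk' : (b * k * b.transpose).transpose = b * k * b.transpose := by
    simp only [Matrix.transpose_mul, Matrix.transpose_transpose, hk, Matrix.mul_assoc]
  obtain ⟨V, μ, hV, hV', h'⟩ := exists_orthogonal_diagonal hk'
  refine ⟨V.transpose * b, μ, ?_, ?_⟩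
  · rw [Matrix.transpose_mul, Matrix.transpose_transpose]
    calc V.transpose * b * γ * (b.transpose * V)
        = V.transpose * (b * γ * b.transpose) * V := by simp only [Matrix.mul_assoc]
      _ = 1 := by rw [hb, Matrix.mul_one, hV']
  · rw [Matrix.transpose_mul, Matrix.transpose_transpose]
    calc V.transpose * b * k * (b.transpose * V)
        = V.transpose * (b * k * b.transpose) * V := by simp only [Matrix.mul_assoc]
      _ = (V.transpose * V) * Matrix.diagonal μ * (V.transpose * V) := by
          rw [h']; simp only [Matrix.mul_assoc]
      _ = _ := by rw [hV', Matrix.one_mul, Matrix.mul_one]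

theorem sum_eq_trace_of_diagonal {γ k a : Matrix (Fin d) (Fin d) ℝ} {μ : Fin d → ℝ}
    (h : a * γ * a.transpose = 1) (h' : a * k * a.transpose = Matrix.diagonal μ) :
    ∑ i, μ i = (γ⁻¹ * k).trace := by
  have h1 : γ * a.transpose * a = 1 := by
    rw [← mul_eq_one_comm, ← Matrix.mul_assoc, h]
  rw [Matrix.mul_assoc] at h1
  rw [Matrix.inv_eq_right_inv h1, ← Matrix.trace_diagonal, ← h', Matrix.trace_mul_comm,
    ← Matrix.mul_assoc]

end Diagonalize

/-! ### First-order variation at the boundary of the invariants -/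

section Invariant

variable {d : ℕ} {B B' : Type*} [CommRing B] [Algebra ℝ B] [CommRing B'] [Algebra ℝ B']

/-- The invariant `P` of the metric `x⁻² (dx² + γ)`, in the frame `x ∂_x, x ∂_i`. -/
def collarInvariant (D : Fin (d + 1) → B → B) (γ γinv : Matrix (Fin d) (Fin d) B)
    (P : ScalarInvariant) : B :=
  (boundaryFrame D (augment γ) (augment γinv)).invariant P

theorem map_augment (φ : B →ₐ[ℝ] B') {γ : Matrix (Fin d) (Fin d) B} {γ' : Matrix (Fin d) (Fin d) B'}
    (h : ∀ i j, φ (γ i j) = γ' i j) (i j : Fin (d + 1)) : φ (augment γ i j) = augment γ' i j := by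
  refine Fin.cases ?_ (fun i => ?_) i <;> refine Fin.cases ?_ (fun j => ?_) j <;> simp [h]

theorem map_collarInvariant {φ : B →ₐ[ℝ] B'} {D : Fin (d + 1) → B → B} {D' : Fin (d + 1) → B' → B'}
    {γ γinv : Matrix (Fin d) (Fin d) B} {γ' γinv' : Matrix (Fin d) (Fin d) B'}
    (hD : ∀ s b, φ (D s b) = D' s (φ b)) (hγ : ∀ i j, φ (γ i j) = γ' i j)
    (hγinv : ∀ i j, φ (γinv i j) = γinv' i j) (P : ScalarInvariant) :
    φ (collarInvariant D γ γinv P) = collarInvariant D' γ' γinv' P :=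
  (isHom_boundaryFrame hD (map_augment φ hγ) (map_augment φ hγinv)).invariant P

theorem map_inv_apply (φ : B →ₐ[ℝ] B') {γ : Matrix (Fin d) (Fin d) B}
    {γ' : Matrix (Fin d) (Fin d) B'} (hγ : ∀ i j, φ (γ i j) = γ' i j) (h : IsUnit γ.det)
    (i j : Fin d) : φ (γ⁻¹ i j) = γ'⁻¹ i j := by
  have e : φ.mapMatrix γ = γ' := Matrix.ext hγ
  have h1 := congrArg φ.mapMatrix (Matrix.mul_nonsing_inv γ h)
  rw [map_mul, map_one, e] at h1
  rw [Matrix.inv_eq_right_inv h1]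
  rfl

end Invariant

/-! ### The first-order variation over the dual numbers -/

section Model

variable {d : ℕ} {W W' : Type*} [AddCommGroup W] [Module ℝ W] [Module ℝᵐᵒᵖ W] [IsCentralScalar ℝ W]
  [AddCommGroup W'] [Module ℝ W'] [Module ℝᵐᵒᵖ W'] [IsCentralScalar ℝ W']

/-- The action of `x ∂_x, x ∂_i` on the leading terms of functions on the collar: on the
first-order deviations it is `T`, and `0`. -/
def modelDeriv (d : ℕ) (T : W →ₗ[ℝ] W) : Fin (d + 1) → TrivSqZeroExt ℝ W → TrivSqZeroExt ℝ W :=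
  Fin.cons (fun b => TrivSqZeroExt.inr (T b.snd)) fun _ _ => 0

@[simp]
theorem modelDeriv_zero (T : W →ₗ[ℝ] W) (b : TrivSqZeroExt ℝ W) :
    modelDeriv d T 0 b = TrivSqZeroExt.inr (T b.snd) := rfl

@[simp]
theorem modelDeriv_succ (T : W →ₗ[ℝ] W) (i : Fin d) (b : TrivSqZeroExt ℝ W) :
    modelDeriv d T i.succ b = 0 := rfl

theorem modelDeriv_inl (T : W →ₗ[ℝ] W) (s : Fin (d + 1)) (c : ℝ) :
    modelDeriv d T s (TrivSqZeroExt.inl c) = 0 := by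
  refine Fin.cases ?_ (fun i => ?_) s <;> simp

/-- The metric `γ + h`, with `h` of first order. -/
def modelMetric (γ : Matrix (Fin d) (Fin d) ℝ) (h : Matrix (Fin d) (Fin d) W) :
    Matrix (Fin d) (Fin d) (TrivSqZeroExt ℝ W) :=
  Matrix.of fun i j => TrivSqZeroExt.inl (γ i j) + TrivSqZeroExt.inr (h i j)

theorem isUnit_det_modelMetric {γ : Matrix (Fin d) (Fin d) ℝ} (hγ : IsUnit γ.det)
    (h : Matrix (Fin d) (Fin d) W) : IsUnit (modelMetric γ h).det := by
  rw [TrivSqZeroExt.isUnit_iff_isUnit_fst]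
  have e : (TrivSqZeroExt.fstHom ℝ ℝ W).mapMatrix (modelMetric γ h) = γ :=
    Matrix.ext fun i j => by simp [modelMetric]
  have := (AlgHom.map_det (TrivSqZeroExt.fstHom ℝ ℝ W) (modelMetric γ h))
  rw [e] at this
  change IsUnit (TrivSqZeroExt.fstHom ℝ ℝ W (modelMetric γ h).det)
  rwa [this]

/-- Any T acting on nilpotent parts and killing constants is a derivation, as products of nilpotents
vanish. The tangential derivations are 0, which is consistent with [x ∂_x, x ∂_i] = x ∂_i. Hence
frame independence applies in the model. -/
theorem isRegular_model (T : W →ₗ[ℝ] W) {γ : Matrix (Fin d) (Fin d) ℝ} (hγ : IsUnit γ.det)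
    (hγs : ∀ i j, γ i j = γ j i) {h : Matrix (Fin d) (Fin d) W} (hs : ∀ i j, h i j = h j i) :
    (boundaryFrame (modelDeriv d T) (augment (modelMetric γ h))
      (augment (modelMetric γ h)⁻¹)).IsRegular where
  D_add s f g := by
    refine Fin.cases ?_ (fun i => ?_) s <;> simp [boundaryFrame]
  D_mul s f g := by
    refine Fin.cases ?_ (fun i => ?_) s
    · refine TrivSqZeroExt.ext ?_ ?_ <;> simp [boundaryFrame]
      abel
    · simp [boundaryFrame]
  comm a b f := by
    simp only [boundaryFrame, sub_mul, Finset.sum_sub_distrib]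
    refine Fin.cases ?_ (fun i => ?_) a <;> refine Fin.cases ?_ (fun j => ?_) b <;>
      simp [Fin.succ_ne_zero]
  c_antisymm a b w := by simp [boundaryFrame]
  symm i j := by
    have : (augment (modelMetric γ h)).transpose = augment (modelMetric γ h) := by
      rw [augment_transpose]
      congr 1
      exact Matrix.ext fun i j => by simp [modelMetric, hγs j i, hs j i]
    exact congrFun (congrFun this j) i
  inv := by
    change augment _ * augment _ = 1
    rw [augment_mul, Matrix.mul_nonsing_inv _ (isUnit_det_modelMetric hγ h), augment_one]

/-- The first-order variation of the invariant `P`. -/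
def variation (T : W →ₗ[ℝ] W) (P : ScalarInvariant) (γ : Matrix (Fin d) (Fin d) ℝ)
    (h : Matrix (Fin d) (Fin d) W) : W :=
  (collarInvariant (modelDeriv d T) (modelMetric γ h) (modelMetric γ h)⁻¹ P).snd

/-- S induces a homomorphism of square-zero extensions compatible with the derivations, so this is
naturality of invariants. Keeping W arbitrary makes linearity of the variation a formal consequence.
-/
theorem map_variation {T : W →ₗ[ℝ] W} {T' : W' →ₗ[ℝ] W'} (S : W →ₗ[ℝ] W')
    (hS : ∀ w, S (T w) = T' (S w)) (P : ScalarInvariant) {γ : Matrix (Fin d) (Fin d) ℝ}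
    (hγ : IsUnit γ.det) (h : Matrix (Fin d) (Fin d) W) :
    S (variation T P γ h) = variation T' P γ (h.map S) := by
  have hm : ∀ i j, TrivSqZeroExt.map S (modelMetric γ h i j) = modelMetric γ (h.map S) i j :=
    fun i j => by simp [modelMetric]
  have := map_collarInvariant (φ := TrivSqZeroExt.map S) (D := modelDeriv d T)
    (D' := modelDeriv d T') (fun s b => by
      refine Fin.cases ?_ (fun i => ?_) s
      · simp [hS]
      · simp) hm (map_inv_apply _ hm (isUnit_det_modelMetric hγ h)) P
  rw [variation, variation, ← this]
  simp

/-- A single variation over W × W is mapped to W by the two projections and by their sum. -/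
theorem variation_add (T : W →ₗ[ℝ] W) (P : ScalarInvariant) {γ : Matrix (Fin d) (Fin d) ℝ}
    (hγ : IsUnit γ.det) (h h' : Matrix (Fin d) (Fin d) W) :
    variation T P γ (h + h') = variation T P γ h + variation T P γ h' := by
  let H : Matrix (Fin d) (Fin d) (W × W) := Matrix.of fun i j => (h i j, h' i j)
  have h1 := map_variation (T := T.prodMap T) (T' := T) (LinearMap.fst ℝ W W) (fun _ => rfl) P hγ H
  have h2 := map_variation (T := T.prodMap T) (T' := T) (LinearMap.snd ℝ W W) (fun _ => rfl) P hγ H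
  have h3 := map_variation (T := T.prodMap T) (T' := T)
    (LinearMap.fst ℝ W W + LinearMap.snd ℝ W W) (fun _ => by simp) P hγ H
  rw [show h = H.map (LinearMap.fst ℝ W W) from rfl, show h' = H.map (LinearMap.snd ℝ W W) from rfl,
    ← h1, ← h2]
  exact h3.symm

theorem variation_smul (T : W →ₗ[ℝ] W) (P : ScalarInvariant) {γ : Matrix (Fin d) (Fin d) ℝ}
    (hγ : IsUnit γ.det) (c : ℝ) (h : Matrix (Fin d) (Fin d) W) :
    variation T P γ (c • h) = c • variation T P γ h := by
  have h1 := map_variation (T := T) (T' := T) (c • LinearMap.id) (fun _ => by simp) P hγ h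
  rw [show h.map (c • LinearMap.id : W →ₗ[ℝ] W) = c • h from rfl] at h1
  rw [← h1, LinearMap.smul_apply, LinearMap.id_apply]

/-- The matrix 1 ⊕ a is a change of frame with constant entries: the derivations kill it and, as it
leaves the x-direction apart, the structure constants keep their form. The claim is then frame
independence over the dual numbers. -/
theorem variation_conj (T : W →ₗ[ℝ] W) (P : ScalarInvariant) {γ a : Matrix (Fin d) (Fin d) ℝ}
    (hγ : IsUnit γ.det) (ha : IsUnit a.det) (hγs : γ.transpose = γ)
    {k : Matrix (Fin d) (Fin d) ℝ} (hk : k.transpose = k) (w : W) :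
    variation T P (a * γ * a.transpose) ((a * k * a.transpose).map (· • w))
      = variation T P γ (k.map (· • w)) := by
  set γ' := a * γ * a.transpose with hγ'
  have hγ'u : IsUnit γ'.det := by
    rw [hγ', Matrix.det_mul, Matrix.det_mul, Matrix.det_transpose]
    exact (ha.mul hγ).mul ha
  let F := boundaryFrame (modelDeriv d T) (augment (modelMetric γ (k.map (· • w))))
    (augment (modelMetric γ (k.map (· • w)))⁻¹)
  let F' := boundaryFrame (modelDeriv d T)
    (augment (modelMetric γ' ((a * k * a.transpose).map (· • w))))
    (augment (modelMetric γ' ((a * k * a.transpose).map (· • w)))⁻¹)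
  have hF : F.IsRegular := isRegular_model T hγ (fun i j => congrFun (congrFun hγs j) i)
    fun i j => by simp [← congrFun (congrFun hk j) i]
  let α : Matrix (Fin d) (Fin d) (TrivSqZeroExt ℝ W) := a.map TrivSqZeroExt.inl
  let A : Fin (d + 1) → Fin (d + 1) → TrivSqZeroExt ℝ W := fun s t => augment α s t
  have hAD : ∀ s t r, modelDeriv d T s (A t r) = 0 := by
    intro s t r
    have : ∃ c : ℝ, A t r = TrivSqZeroExt.inl c := by
      refine Fin.cases ?_ (fun i => ?_) t <;> refine Fin.cases ?_ (fun j => ?_) r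
      · exact ⟨1, rfl⟩
      · exact ⟨0, rfl⟩
      · exact ⟨0, rfl⟩
      · exact ⟨a i j, rfl⟩
    obtain ⟨c, hc⟩ := this
    rw [hc, modelDeriv_inl]
  have hconj : ∀ i j, modelMetric γ' ((a * k * a.transpose).map (· • w)) i j
      = (α * modelMetric γ (k.map (· • w)) * α.transpose) i j := by
    intro i j
    refine TrivSqZeroExt.ext ?_ ?_
    · simp [modelMetric, hγ', Matrix.mul_apply, α, TrivSqZeroExt.fst_sum]
    · simp [modelMetric, Matrix.mul_apply, α, TrivSqZeroExt.snd_sum, TrivSqZeroExt.fst_sum,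
        Finset.sum_smul, Finset.smul_sum, smul_smul]
      refine Finset.sum_congr rfl fun x _ => ?_
      rw [Finset.sum_mul, Finset.sum_smul]
      exact Finset.sum_congr rfl fun y _ => by rw [mul_comm]
  have hframe : F.IsFrame A F' :=
    { D := fun s f => by
        change modelDeriv d T s f = ∑ t, A s t * modelDeriv d T t f
        rw [Fin.sum_univ_succ]
        refine Fin.cases ?_ (fun i => ?_) s <;> simp [A]
      c := fun p q => by
        have h0 : ∀ X r s, F.dir X (A r s) = 0 := fun X r s =>
          Finset.sum_eq_zero fun t _ => by
            rw [show F.D t (A r s) = modelDeriv d T t (A r s) from rfl, hAD, mul_zero]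
        funext r
        rw [FrameData.bracket, h0, h0, sub_zero, zero_add]
        simp only [F, F', boundaryFrame, Finset.sum_apply, Pi.smul_apply, smul_eq_mul, sub_mul,
          mul_sub, Finset.sum_sub_distrib, ite_and, ite_mul, one_mul, zero_mul, mul_ite, mul_one,
          mul_zero]
        have hA0 : ∀ p, A p 0 = if p = 0 then 1 else 0 := by
          intro p
          refine Fin.cases ?_ (fun i => ?_) p <;> simp [A, Fin.succ_ne_zero]
        simp [hA0, Finset.sum_ite_irrel]
      G := fun i j => by
        have h : augment (modelMetric γ' ((a * k * a.transpose).map (· • w)))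
            = augment α * augment (modelMetric γ (k.map (· • w))) * (augment α).transpose := by
          rw [augment_transpose, augment_mul, augment_mul]
          exact congrArg augment (Matrix.ext hconj)
        change augment _ i j = _
        conv_lhs => rw [h]
        simp only [FrameData.inn, Matrix.mul_apply, Matrix.transpose_apply, Finset.sum_mul]
        rw [Finset.sum_comm]
        exact Finset.sum_congr rfl fun _ _ => Finset.sum_congr rfl fun _ _ => by
          simp only [F, A, boundaryFrame]; ring
      inv := by
        change augment _ * augment _ = 1
        rw [augment_mul, Matrix.mul_nonsing_inv _ (isUnit_det_modelMetric hγ'u _), augment_one] }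
  exact congrArg TrivSqZeroExt.snd (hframe.invariant_eq hF P)

/-- After reduction to γ = 1 and k diagonal, permutation matrices are still admissible changes of
frame. The variation, linear in the diagonal entries, thus takes the same value on all basis vectors
and depends only on their sum, the trace of γ⁻¹ k. -/
theorem variation_smul_eq_zero (T : W →ₗ[ℝ] W) (P : ScalarInvariant)
    {γ k : Matrix (Fin d) (Fin d) ℝ} (hγs : γ.transpose = γ)
    (hpos : ∀ v, v ≠ 0 → 0 < v ⬝ᵥ γ.mulVec v) (hk : k.transpose = k)
    (htr : (γ⁻¹ * k).trace = 0) (w : W) : variation T P γ (k.map (· • w)) = 0 := by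
  obtain ⟨a, μ, h1, h2⟩ := exists_simultaneous_diagonal hγs hpos hk
  have hu : IsUnit (a.det * γ.det * a.det) := by
    have := congrArg Matrix.det h1
    rw [Matrix.det_mul, Matrix.det_mul, Matrix.det_transpose, Matrix.det_one] at this
    rw [this]
    exact isUnit_one
  have ha : IsUnit a.det := isUnit_of_mul_isUnit_right hu
  have hγ : IsUnit γ.det := isUnit_of_mul_isUnit_right (isUnit_of_mul_isUnit_left hu)
  have hone : IsUnit (1 : Matrix (Fin d) (Fin d) ℝ).det := by simp
  rw [← variation_conj T P hγ ha hγs hk w, h1, h2]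
  let l : (Fin d → ℝ) →ₗ[ℝ] W :=
    { toFun := fun v => variation T P 1 ((Matrix.diagonal v).map (· • w))
      map_add' := fun v v' => by
        rw [← variation_add T P hone]
        congr 1
        refine Matrix.ext fun i j => ?_
        by_cases h : i = j <;> simp [h, add_smul]
      map_smul' := fun c v => by
        rw [RingHom.id_apply, ← variation_smul T P hone]
        congr 1
        refine Matrix.ext fun i j => ?_
        by_cases h : i = j <;> simp [h, mul_smul] }
  have hperm : ∀ (σ : Equiv.Perm (Fin d)) (v : Fin d → ℝ), l (v ∘ σ) = l v := by
    intro σ v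
    let p : Matrix (Fin d) (Fin d) ℝ := Matrix.of fun i j => if σ i = j then 1 else 0
    have hp : ∀ v : Fin d → ℝ, p * Matrix.diagonal v * p.transpose = Matrix.diagonal (v ∘ σ) := by
      intro v
      refine Matrix.ext fun i j => ?_
      rw [Matrix.mul_apply]
      simp [p, Matrix.mul_diagonal, Matrix.diagonal_apply, eq_comm]
      split_ifs with h
      · rw [h]
      · rfl
    have hp1 : p * 1 * p.transpose = 1 := by
      rw [← Matrix.diagonal_one, hp]
      rfl
    have hpu : IsUnit p.det := by
      rw [Matrix.mul_one] at hp1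
      exact Matrix.isUnit_det_of_right_inverse hp1
    have := variation_conj T P (γ := 1) hone hpu Matrix.transpose_one
      (Matrix.diagonal_transpose v) w
    rw [hp, hp1] at this
    exact this
  change l μ = 0
  rw [LinearMap.pi_apply_eq_sum_univ l μ]
  have hsum : ∑ i, μ i = 0 := (sum_eq_trace_of_diagonal h1 h2).trans htr
  rcases isEmpty_or_nonempty (Fin d) with hd | ⟨⟨i₀⟩⟩
  · simp
  · have : ∀ i, l (fun j => if i = j then 1 else 0) = l (fun j => if i₀ = j then 1 else 0) := by
      intro i
      rw [← hperm (Equiv.swap i₀ i) (fun j => if i = j then 1 else 0)]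
      congr 1
      funext j
      simp only [Function.comp]
      congr 1
      rw [eq_iff_iff, Equiv.swap_comm, ← Equiv.symm_apply_eq, Equiv.symm_swap]
      simp
    simp only [this, ← Finset.sum_smul, hsum, zero_smul]

/-- The first-order variation of a scalar invariant depends only on traces. -/
theorem variation_eq_zero (T : ℝ × ℝ →ₗ[ℝ] ℝ × ℝ) (P : ScalarInvariant)
    {γ k k' : Matrix (Fin d) (Fin d) ℝ} (hγs : γ.transpose = γ)
    (hpos : ∀ v, v ≠ 0 → 0 < v ⬝ᵥ γ.mulVec v) (hk : k.transpose = k) (hk' : k'.transpose = k')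
    (htr : (γ⁻¹ * k).trace = 0) (htr' : (γ⁻¹ * k').trace = 0) :
    variation T P γ (Matrix.of fun i j => (k i j, k' i j)) = 0 := by
  have hγ : IsUnit γ.det := by
    rw [isUnit_iff_ne_zero]
    intro h0
    obtain ⟨v, hv, h⟩ := Matrix.exists_mulVec_eq_zero_iff.mpr h0
    have := hpos v hv
    simp [h] at this
  have : (Matrix.of fun i j => (k i j, k' i j))
      = k.map (· • ((1, 0) : ℝ × ℝ)) + k'.map (· • ((0, 1) : ℝ × ℝ)) :=
    Matrix.ext fun i j => by simp
  rw [this, variation_add T P hγ, variation_smul_eq_zero T P hγs hpos hk htr,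
    variation_smul_eq_zero T P hγs hpos hk' htr', add_zero]

end Model

/-! ### Pairs of expansions that agree to order `n` -/

section Agree

variable {S : Type*} [CommRing S] {n : ℕ}

theorem coeff_zero_mul (p q : PowerSeries S) :
    PowerSeries.coeff 0 (p * q) = PowerSeries.coeff 0 p * PowerSeries.coeff 0 q := by
  simp

/-- In p p' − q q' = p (p' − q') + (p − q) q' both differences are divisible by X^n, so at order n
only the leading coefficients of the cofactors count; those of p' and q' coincide because n ≥ 1. -/
theorem coeff_mul_sub_of_agree {p q p' q' : PowerSeries S} (hn : 1 ≤ n)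
    (h : PowerSeries.X ^ n ∣ p - q) (h' : PowerSeries.X ^ n ∣ p' - q') :
    PowerSeries.X ^ n ∣ p * p' - q * q' ∧
    PowerSeries.coeff n (p * p') - PowerSeries.coeff n (q * q')
      = PowerSeries.coeff 0 p * (PowerSeries.coeff n p' - PowerSeries.coeff n q')
        + (PowerSeries.coeff n p - PowerSeries.coeff n q) * PowerSeries.coeff 0 p' := by
  obtain ⟨r, hr⟩ := h
  obtain ⟨r', hr'⟩ := h'
  have e : p * p' - q * q' = PowerSeries.X ^ n * (p * r' + r * q') := by
    linear_combination p * hr' + q' * hr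
  have h0 : PowerSeries.coeff 0 p' = PowerSeries.coeff 0 q' := by
    rw [← sub_eq_zero, ← map_sub, hr', PowerSeries.coeff_X_pow_mul', if_neg (by omega)]
  refine ⟨⟨_, e⟩, ?_⟩
  rw [← map_sub, ← map_sub, ← map_sub, e, hr, hr']
  simp only [PowerSeries.coeff_X_pow_mul', le_refl, if_true, Nat.sub_self, map_add,
    coeff_zero_mul]
  rw [h0]

/-- This rests on p' − q' = −p' q' (p − q). -/
theorem coeff_inv_sub_of_agree {p q p' q' : PowerSeries S}
    (h : PowerSeries.X ^ n ∣ p - q) (hp : p * p' = 1) (hq : q * q' = 1) :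
    PowerSeries.X ^ n ∣ p' - q' ∧
    PowerSeries.coeff n p' - PowerSeries.coeff n q'
      = -(PowerSeries.coeff 0 p' * PowerSeries.coeff 0 q' *
        (PowerSeries.coeff n p - PowerSeries.coeff n q)) := by
  obtain ⟨r, hr⟩ := h
  have e : p' - q' = PowerSeries.X ^ n * -(p' * q' * r) := by
    linear_combination (-(p' * q')) * hr - p' * hq + q' * hp
  refine ⟨⟨_, e⟩, ?_⟩
  rw [← map_sub, ← map_sub, e, hr]
  simp only [PowerSeries.coeff_X_pow_mul', le_refl, if_true, Nat.sub_self, map_neg,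
    coeff_zero_mul]

end Agree

/-! ### Pairs of expansions and the dual number recording their difference -/

section FormalPair

variable {E : Type*} [NormedAddCommGroup E] [NormedSpace ℝ E] {n : ℕ} {u₀ : E}

/-- The expansion at the point `u`. -/
def evalAt (u : E) : FormalSeries E →+* PowerSeries (Polynomial ℝ) :=
  PowerSeries.map (Polynomial.mapRingHom (Pi.evalRingHom (fun _ : E => ℝ) u))

theorem coeff_evalAt (u : E) (A : FormalSeries E) (k : ℕ) :
    PowerSeries.coeff k (evalAt u A) = coeffAt u A k := by
  simp [evalAt, coeffAt]

/-- The expansions `a` and `b` agree below order `n`, their leading term at `u₀` is the body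
of `c`, and the difference of their terms of order `n` is the soul of `c`. -/
structure Agree (n : ℕ) (u₀ : E) (a b : FormalSeries E) (c : TrivSqZeroExt ℝ (ℝ × ℝ)) : Prop where
  below : ∀ᶠ u in 𝓝 u₀, PowerSeries.X ^ n ∣ evalAt u a - evalAt u b
  zero : PowerSeries.coeff 0 (evalAt u₀ a) = Polynomial.C c.fst
  top : PowerSeries.coeff n (evalAt u₀ a) - PowerSeries.coeff n (evalAt u₀ b)
    = Polynomial.C c.snd.1 + Polynomial.C c.snd.2 * Polynomial.X

namespace Agree

variable {a b a' b' : FormalSeries E} {c c' : TrivSqZeroExt ℝ (ℝ × ℝ)}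

theorem add (h : Agree n u₀ a b c) (h' : Agree n u₀ a' b' c') :
    Agree n u₀ (a + a') (b + b') (c + c') where
  below := by
    filter_upwards [h.below, h'.below] with u h1 h2
    rw [map_add, map_add, add_sub_add_comm]
    exact dvd_add h1 h2
  zero := by rw [map_add, map_add, h.zero, h'.zero, TrivSqZeroExt.fst_add, map_add]
  top := by
    rw [map_add, map_add, map_add, map_add, add_sub_add_comm, h.top, h'.top]
    simp only [TrivSqZeroExt.snd_add, Prod.fst_add, Prod.snd_add, map_add]
    ring

theorem mul (hn : 1 ≤ n) (h : Agree n u₀ a b c) (h' : Agree n u₀ a' b' c') :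
    Agree n u₀ (a * a') (b * b') (c * c') where
  below := by
    filter_upwards [h.below, h'.below] with u h1 h2
    rw [map_mul, map_mul]
    exact (coeff_mul_sub_of_agree hn h1 h2).1
  zero := by
    rw [map_mul, coeff_zero_mul, h.zero, h'.zero, TrivSqZeroExt.fst_mul, map_mul]
  top := by
    rw [map_mul (evalAt u₀), map_mul (evalAt u₀), (coeff_mul_sub_of_agree hn h.below.self_of_nhds
      h'.below.self_of_nhds).2, h.zero, h'.zero, h.top, h'.top]
    simp only [TrivSqZeroExt.snd_mul, Prod.fst_add, Prod.snd_add, Prod.smul_fst, Prod.smul_snd,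
      map_add, smul_eq_mul, map_mul, MulOpposite.smul_eq_mul_unop, MulOpposite.unop_op]
    ring

theorem const (r : ℝ) : Agree n u₀ (algebraMap ℝ (FormalSeries E) r)
    (algebraMap ℝ (FormalSeries E) r) (algebraMap ℝ _ r) where
  below := by simp
  zero := by
    rw [PowerSeries.algebraMap_apply, coeff_evalAt, coeffAt, PowerSeries.coeff_zero_C]
    change (Polynomial.C _).map _ = _
    rw [Polynomial.map_C]
    rfl
  top := by
    rw [sub_self]
    simp [TrivSqZeroExt.algebraMap_eq_inl]

/-- Makes an element of `agreeAlg` a unit as soon as its three components are, so that the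
determinant of the metric can be inverted there. -/
theorem of_mul_eq_one (h : Agree n u₀ a b c) (ha : a * a' = 1) (hb : b * b' = 1)
    (hc : c * c' = 1) (hn : 1 ≤ n) : Agree n u₀ a' b' c' := by
  have ea : ∀ u, evalAt u a * evalAt u a' = 1 := fun u => by rw [← map_mul, ha, map_one]
  have eb : ∀ u, evalAt u b * evalAt u b' = 1 := fun u => by rw [← map_mul, hb, map_one]
  have hc0 : c.fst * c'.fst = 1 := by rw [← TrivSqZeroExt.fst_mul, hc, TrivSqZeroExt.fst_one]
  have hz : PowerSeries.coeff 0 (evalAt u₀ a') = Polynomial.C c'.fst := by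
    have h1 := congrArg (PowerSeries.coeff 0) (ea u₀)
    rw [coeff_zero_mul, h.zero, PowerSeries.coeff_zero_one] at h1
    have h2 : Polynomial.C c.fst * Polynomial.C c'.fst = (1 : Polynomial ℝ) := by
      rw [← map_mul, hc0, map_one]
    linear_combination Polynomial.C c'.fst * h1 - PowerSeries.coeff 0 (evalAt u₀ a') * h2
  have hb0 : PowerSeries.coeff 0 (evalAt u₀ b') = Polynomial.C c'.fst := by
    rw [← hz, eq_comm, ← sub_eq_zero, ← map_sub]
    exact PowerSeries.X_pow_dvd_iff.1
      (coeff_inv_sub_of_agree h.below.self_of_nhds (ea u₀) (eb u₀)).1 0 (by omega)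
  refine ⟨?_, hz, ?_⟩
  · filter_upwards [h.below] with u hu
    exact (coeff_inv_sub_of_agree hu (ea u) (eb u)).1
  · rw [(coeff_inv_sub_of_agree h.below.self_of_nhds (ea u₀) (eb u₀)).2, hz, hb0, h.top]
    have h1 := congrArg TrivSqZeroExt.snd hc
    rw [TrivSqZeroExt.snd_mul, TrivSqZeroExt.snd_one, op_smul_eq_smul] at h1
    have h2 : c'.snd = -((c'.fst * c'.fst) • c.snd) := by
      have h3 := congrArg (c'.fst • ·) h1
      simp only [smul_add, smul_smul, smul_zero] at h3
      rw [mul_comm c'.fst c.fst, hc0, one_smul] at h3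
      exact eq_neg_of_add_eq_zero_left h3
    rw [h2]
    simp only [Prod.fst_neg, Prod.snd_neg, Prod.smul_fst, Prod.smul_snd, smul_eq_mul, map_neg,
      map_mul]
    ring

/-- The action of `x ∂_x` on the terms `x ^ n` and `x ^ n log x`. -/
def indicial (n : ℕ) : ℝ × ℝ →ₗ[ℝ] ℝ × ℝ where
  toFun w := (n * w.1 + w.2, n * w.2)
  map_add' w w' := by ext <;> simp <;> ring
  map_smul' r w := by ext <;> simp <;> ring

theorem evalAt_formalDeriv_zero (u : E) (v : E × ℝ) (A : FormalSeries E) :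
    PowerSeries.coeff 0 (evalAt u (formalDeriv v A))
      = v.2 • Polynomial.derivative (PowerSeries.coeff 0 (evalAt u A)) := by
  rw [coeff_evalAt, coeff_evalAt, coeffAt, coeff_formalDeriv_zero, coeffAt,
    Polynomial.derivative_map]
  refine Polynomial.ext fun p => ?_
  simp

theorem evalAt_formalDeriv_succ (u : E) (v : E × ℝ) (A : FormalSeries E) (k : ℕ) :
    PowerSeries.coeff (k + 1) (evalAt u (formalDeriv v A))
      = coeffAt u (PowerSeries.C (coeffDeriv v.1 (PowerSeries.coeff k A))) 0
        + v.2 • (((k + 1 : ℕ) : ℝ) • PowerSeries.coeff (k + 1) (evalAt u A)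
          + Polynomial.derivative (PowerSeries.coeff (k + 1) (evalAt u A))) := by
  rw [coeff_evalAt, coeff_evalAt, coeffAt, coeff_formalDeriv_succ, coeffAt, coeffAt,
    PowerSeries.coeff_zero_C]
  refine Polynomial.ext fun p => ?_
  simp [Polynomial.coeff_derivative]

/-- Tangential derivatives at u₀ see the coefficients near u₀; hence agreement below order n is
required on a neighbourhood. -/
theorem coeffDeriv_agree (h : ∀ᶠ u in 𝓝 u₀, PowerSeries.X ^ n ∣ evalAt u a - evalAt u b) (w : E)
    {k : ℕ} (hk : k < n) :
    coeffAt u₀ (PowerSeries.C (coeffDeriv w (PowerSeries.coeff k a))) 0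
      = coeffAt u₀ (PowerSeries.C (coeffDeriv w (PowerSeries.coeff k b))) 0 := by
  refine Polynomial.ext fun p => ?_
  rw [coeff_coeffAt, coeff_coeffAt, PowerSeries.coeff_zero_C, PowerSeries.coeff_zero_C,
    coeff_coeffDeriv, coeff_coeffDeriv]
  have : (PowerSeries.coeff k a).coeff p =ᶠ[𝓝 u₀] (PowerSeries.coeff k b).coeff p := by
    filter_upwards [h] with u hu
    have := PowerSeries.X_pow_dvd_iff.1 hu k hk
    rw [map_sub, sub_eq_zero, coeff_evalAt, coeff_evalAt] at this
    rw [← coeff_coeffAt, ← coeff_coeffAt, this]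
  change fderiv ℝ _ u₀ w = fderiv ℝ _ u₀ w
  rw [this.fderiv_eq]

end Agree

variable {d : ℕ} {u₁ : EuclideanSpace ℝ (Fin d)} {a b : FormalSeries (EuclideanSpace ℝ (Fin d))}
  {c : TrivSqZeroExt ℝ (ℝ × ℝ)}

/-- A tangential x ∂_i takes its order-n coefficient from order n − 1, where the expansions agree,
so it acts by 0 on the difference; x ∂_x acts by `indicial`. -/
theorem Agree.deriv (hn : 1 ≤ n) (h : Agree n u₁ a b c) (s : Fin (d + 1)) :
    Agree n u₁ (formalDeriv (dirVec d s) a) (formalDeriv (dirVec d s) b)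
      (modelDeriv d (Agree.indicial n) s c) where
  below := by
    filter_upwards [h.below.eventually_nhds] with u hu
    rw [PowerSeries.X_pow_dvd_iff]
    have h0 : ∀ k < n, PowerSeries.coeff k (evalAt u a) = PowerSeries.coeff k (evalAt u b) :=
      fun k hk => by
        rw [← sub_eq_zero, ← map_sub]
        exact PowerSeries.X_pow_dvd_iff.1 hu.self_of_nhds k hk
    intro k hk
    rw [map_sub, sub_eq_zero]
    rcases k with _ | k
    · rw [Agree.evalAt_formalDeriv_zero, Agree.evalAt_formalDeriv_zero, h0 0 hk]
    · rw [Agree.evalAt_formalDeriv_succ, Agree.evalAt_formalDeriv_succ, h0 _ hk,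
        Agree.coeffDeriv_agree hu _ (Nat.lt_of_succ_lt hk)]
  zero := by
    rw [Agree.evalAt_formalDeriv_zero, h.zero, Polynomial.derivative_C, smul_zero]
    refine Fin.cases ?_ (fun i => ?_) s <;> simp
  top := by
    obtain ⟨k, rfl⟩ : ∃ k, n = k + 1 := ⟨n - 1, by omega⟩
    rw [Agree.evalAt_formalDeriv_succ, Agree.evalAt_formalDeriv_succ,
      Agree.coeffDeriv_agree h.below _ (Nat.lt_succ_self k), add_sub_add_left_eq_sub, ← smul_sub,
      add_sub_add_comm, ← smul_sub, ← Polynomial.derivative_sub, h.top]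
    refine Fin.cases ?_ (fun i => ?_) s
    · simp only [dirVec, Fin.cons_zero, one_smul, modelDeriv_zero, TrivSqZeroExt.snd_inr,
        Agree.indicial, LinearMap.coe_mk, AddHom.coe_mk, map_add, map_mul,
        Polynomial.derivative_C, Polynomial.derivative_C_mul, Polynomial.derivative_X,
        Polynomial.smul_eq_C_mul]
      ring
    · simp [dirVec]

/-- The algebra of pairs of expansions that agree to order `n`. -/
def agreeAlg (n : ℕ) (hn : 1 ≤ n) (u₀ : E) :
    Subalgebra ℝ ((FormalSeries E × FormalSeries E) × TrivSqZeroExt ℝ (ℝ × ℝ)) where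
  carrier := {q | Agree n u₀ q.1.1 q.1.2 q.2}
  mul_mem' h h' := Agree.mul hn h h'
  add_mem' h h' := Agree.add h h'
  algebraMap_mem' r := (Agree.const r : Agree n u₀ _ _ _)

/-- If two metrics agree below order `n`, then their invariants do, and the difference of the terms
of order `n` is given by the first-order variation. -/
theorem agree_collarInvariant (hn : 1 ≤ n)
    {Γ Γ' : Matrix (Fin d) (Fin d) (FormalSeries (EuclideanSpace ℝ (Fin d)))}
    {γ : Matrix (Fin d) (Fin d) (TrivSqZeroExt ℝ (ℝ × ℝ))}
    (hΓ : IsUnit Γ.det) (hΓ' : IsUnit Γ'.det) (hγ : IsUnit γ.det)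
    (h : ∀ i j, Agree n u₁ (Γ i j) (Γ' i j) (γ i j)) (P : ScalarInvariant) :
    Agree n u₁ (collarInvariant (fun s => formalDeriv (dirVec d s)) Γ Γ⁻¹ P)
      (collarInvariant (fun s => formalDeriv (dirVec d s)) Γ' Γ'⁻¹ P)
      (collarInvariant (modelDeriv d (Agree.indicial n)) γ γ⁻¹ P) := by
  -- The invariant is computed once over the algebra of triples and read off through its three
  -- projections.
  let R := agreeAlg n hn u₁
  let D : Fin (d + 1) → R → R := fun s q =>
    ⟨((formalDeriv (dirVec d s) q.1.1.1, formalDeriv (dirVec d s) q.1.1.2),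
      modelDeriv d (Agree.indicial n) s q.1.2), Agree.deriv hn q.2 s⟩
  let M : Matrix (Fin d) (Fin d) R := Matrix.of fun i j => ⟨((Γ i j, Γ' i j), γ i j), h i j⟩
  let φ₁ : R →ₐ[ℝ] FormalSeries (EuclideanSpace ℝ (Fin d)) :=
    ((AlgHom.fst ℝ _ _).comp (AlgHom.fst ℝ _ _)).comp R.val
  let φ₂ : R →ₐ[ℝ] FormalSeries (EuclideanSpace ℝ (Fin d)) :=
    ((AlgHom.snd ℝ _ _).comp (AlgHom.fst ℝ _ _)).comp R.val
  let φ₃ : R →ₐ[ℝ] TrivSqZeroExt ℝ (ℝ × ℝ) := (AlgHom.snd ℝ _ _).comp R.val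
  have d1 : φ₁ M.det = Γ.det := AlgHom.map_det φ₁ M
  have d2 : φ₂ M.det = Γ'.det := AlgHom.map_det φ₂ M
  have d3 : φ₃ M.det = γ.det := AlgHom.map_det φ₃ M
  have hM : IsUnit M.det := by
    obtain ⟨x, hx⟩ := hΓ.exists_right_inv
    obtain ⟨y, hy⟩ := hΓ'.exists_right_inv
    obtain ⟨z, hz⟩ := hγ.exists_right_inv
    rw [← d1] at hx
    rw [← d2] at hy
    rw [← d3] at hz
    exact IsUnit.of_mul_eq_one (⟨((x, y), z), Agree.of_mul_eq_one M.det.2 hx hy hz hn⟩ : R)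
      (Subtype.ext (Prod.ext (Prod.ext hx hy) hz))
  have e1 := map_collarInvariant (φ := φ₁) (D := D) (D' := fun s => formalDeriv (dirVec d s))
    (γ := M) (γ' := Γ) (fun _ _ => rfl) (fun _ _ => rfl)
    (map_inv_apply φ₁ (γ' := Γ) (fun _ _ => rfl) hM) P
  have e2 := map_collarInvariant (φ := φ₂) (D := D) (D' := fun s => formalDeriv (dirVec d s))
    (γ := M) (γ' := Γ') (fun _ _ => rfl) (fun _ _ => rfl)
    (map_inv_apply φ₂ (γ' := Γ') (fun _ _ => rfl) hM) P
  have e3 := map_collarInvariant (φ := φ₃) (D := D) (D' := modelDeriv d (Agree.indicial n))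
    (γ := M) (γ' := γ) (fun _ _ => rfl) (fun _ _ => rfl)
    (map_inv_apply φ₃ (γ' := γ) (fun _ _ => rfl) hM) P
  rw [← e1, ← e2, ← e3]
  exact (collarInvariant D M M⁻¹ P).2

end FormalPair

/-! ### The expansion of the metric in a chart of the boundary -/

/-- Above order n the bound may grow freely: k S(k) with S increasing is superadditive, and S is
chosen to dominate `L₀`. When i + j = n, either one index is 0 or both are below n, so the value 1
at n causes no conflict. -/
theorem exists_superadditive (n : ℕ) (hn : 1 ≤ n) (L₀ : ℕ → ℕ) (h₀ : ∀ k < n, L₀ k = 0)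
    (h₁ : L₀ n = 1) : ∃ L : ℕ → ℕ, (∀ k < n, L k = 0) ∧ L n = 1 ∧ (∀ k, L₀ k ≤ L k) ∧
      ∀ i j, L i + L j ≤ L (i + j) := by
  let S : ℕ → ℕ := fun k => 1 + ∑ i ∈ Finset.range (k + 1), L₀ i
  have hS : Monotone S := fun i j hij => Nat.add_le_add_left
    (Finset.sum_le_sum_of_subset (Finset.range_mono (by omega))) 1
  let L : ℕ → ℕ := fun k => if k < n then 0 else if k = n then 1 else k * S k
  have hL : ∀ k, L k ≤ k * S k := by
    intro k
    simp only [L]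
    split_ifs with h1 h2
    · exact Nat.zero_le _
    · exact Nat.one_le_iff_ne_zero.mpr (Nat.mul_ne_zero (by omega) (by simp [S]))
    · exact le_rfl
  refine ⟨L, fun k hk => by simp [L, hk], by simp [L], fun k => ?_, fun i j => ?_⟩
  · rcases lt_trichotomy k n with h | rfl | h
    · simp [h₀ k h]
    · simp [L, h₁]
    · simp only [L, if_neg (not_lt.mpr h.le), if_neg h.ne']
      have h2 : L₀ k ≤ S k :=
        (Finset.single_le_sum (f := L₀) (fun _ _ => Nat.zero_le _)
          (Finset.self_mem_range_succ k)).trans (Nat.le_add_left _ _)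
      exact h2.trans (Nat.le_mul_of_pos_left _ (by omega))
  · rcases lt_trichotomy (i + j) n with h | h | h
    · simp [L, show i < n by omega, show j < n by omega]
    · have : L (i + j) = 1 := by simp [L, h]
      rw [this]
      rcases Nat.eq_zero_or_pos i with rfl | hi
      · simp [L, show j = n by omega, show 0 < n by omega]
      · rcases Nat.eq_zero_or_pos j with rfl | hj
        · simp [L, show i = n by omega, show 0 < n by omega]
        · simp [L, show i < n by omega, show j < n by omega]
    · have : L (i + j) = (i + j) * S (i + j) := by
        simp [L, show ¬ (i + j < n) by omega, show i + j ≠ n by omega]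
      rw [this, add_mul]
      exact Nat.add_le_add ((hL i).trans (Nat.mul_le_mul_left _ (hS (by omega))))
        ((hL j).trans (Nat.mul_le_mul_left _ (hS (by omega))))

theorem HasPhgExpansionOn.congr_coeff {E : Type*} [NormedAddCommGroup E] [NormedSpace ℝ E]
    {U : Set E} (hU : IsOpen U) {f : E → ℝ → ℝ} {L : ℕ → ℕ} {a a' : ℕ → ℕ → E → ℝ}
    (h : HasPhgExpansionOn U f L a) (ha : ∀ k p, ∀ u ∈ U, a' k p u = a k p u) :
    HasPhgExpansionOn U f L a' := by
  refine ⟨fun k p hp => (h.1 k p hp).congr (ha k p), fun r j K hKU hK => ?_⟩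
  obtain ⟨C, δ, hδ, hb⟩ := h.2 r j K hKU hK
  refine ⟨C, δ, hδ, fun u hu x hx => ⟨(hb u hu x hx).1, ?_⟩⟩
  have e : (fun z : E × ℝ => f z.1 z.2 - ∑ k ∈ Finset.range (r + j + 1),
      ∑ p ∈ Finset.range (L k + 1), a' k p z.1 * z.2 ^ k * Real.log z.2 ^ p) =ᶠ[𝓝 (u, x)]
      fun z => f z.1 z.2 - ∑ k ∈ Finset.range (r + j + 1),
      ∑ p ∈ Finset.range (L k + 1), a k p z.1 * z.2 ^ k * Real.log z.2 ^ p := by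
    filter_upwards [continuous_fst.continuousAt.preimage_mem_nhds (hU.mem_nhds (hKU hu))] with z hz
    simp only [ha _ _ _ hz]
  rw [(e.iteratedFDeriv ℝ j).self_of_nhds]
  exact (hb u hu x hx).2

section FormalMetric

variable {d : ℕ} {N : Type*} [TopologicalSpace N] [ChartedSpace (EuclideanSpace ℝ (Fin d)) N]
  [IsManifold (𝓡 d) ∞ N] {e : OpenPartialHomeomorph N (EuclideanSpace ℝ (Fin d))}
  {L : ℕ → ℕ} {γ : ℕ → ℕ → BilinField d N}

open scoped Classical in
/-- The expansion of a metric in the chart `e`, extended by the identity matrix. -/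
def formalMetric (e : OpenPartialHomeomorph N (EuclideanSpace ℝ (Fin d))) (L : ℕ → ℕ)
    (γ : ℕ → ℕ → BilinField d N) :
    Matrix (Fin d) (Fin d) (FormalSeries (EuclideanSpace ℝ (Fin d))) :=
  Matrix.of fun i j => ofCoeffs L fun k p u =>
    if u ∈ e.target then components e (γ k p) u i j
    else if k = 0 then (1 : Matrix (Fin d) (Fin d) ℝ) i j else 0

theorem coeffAt_formalMetric {u : EuclideanSpace ℝ (Fin d)} (hu : u ∈ e.target) (k p : ℕ)
    (i j : Fin d) : (coeffAt u (formalMetric e L γ i j) k).coeff p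
      = if p ≤ L k then components e (γ k p) u i j else 0 := by
  rw [coeff_coeffAt, formalMetric, Matrix.of_apply, coeff_ofCoeffs]
  split_ifs with h <;> simp [hu]

/-- Invertibility is needed over functions on the whole Euclidean space, which is why the identity
matrix replaces the metric outside the chart. The extension need not be smooth, `IsPhg` being local
at a point. -/
theorem isUnit_det_formalMetric (he : e ∈ IsManifold.maximalAtlas (𝓡 d) ∞ N) (hL : L 0 = 0)
    (hpos : ∀ (q : N) (v : TangentSpace (𝓡 d) q), v ≠ 0 → 0 < γ 0 0 q v v) :
    IsUnit (formalMetric e L γ).det := by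
  classical
  let M₀ : Matrix (Fin d) (Fin d) (EuclideanSpace ℝ (Fin d) → ℝ) := Matrix.of fun i j u =>
    if u ∈ e.target then components e (γ 0 0) u i j else (1 : Matrix (Fin d) (Fin d) ℝ) i j
  rw [PowerSeries.isUnit_iff_constantCoeff, RingHom.map_det]
  have h0 : PowerSeries.constantCoeff.mapMatrix (formalMetric e L γ)
      = (Polynomial.C : (EuclideanSpace ℝ (Fin d) → ℝ) →+* _).mapMatrix M₀ := by
    refine Matrix.ext fun i j => Polynomial.ext fun p => ?_
    rw [RingHom.mapMatrix_apply, RingHom.mapMatrix_apply, Matrix.map_apply, Matrix.map_apply,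
      ← PowerSeries.coeff_zero_eq_constantCoeff_apply, formalMetric, Matrix.of_apply, coeff_ofCoeffs, Polynomial.coeff_C, hL]
    rcases p with _ | p
    · simp [M₀]
    · simp
  rw [h0, ← RingHom.map_det]
  refine IsUnit.map _ (Pi.isUnit_iff.mpr fun u => ?_)
  have h1 : M₀.det u = (if u ∈ e.target then components e (γ 0 0) u else 1).det := by
    have := RingHom.map_det (Pi.evalRingHom (fun _ : EuclideanSpace ℝ (Fin d) => ℝ) u) M₀
    refine this.trans (congrArg Matrix.det (Matrix.ext fun i j => ?_))
    by_cases hu : u ∈ e.target <;> simp [M₀, hu]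
  rw [h1, isUnit_iff_ne_zero]
  split_ifs with hu
  · exact det_components_ne_zero he hu (hpos _)
  · simp

end FormalMetric

/-! ### The expansion of the invariants -/

namespace SpecialCollar

variable {d : ℕ} {M N : Type*}
  [TopologicalSpace M] [ChartedSpace (EuclideanSpace ℝ (Fin (d + 1))) M]
  [IsManifold (𝓡 (d + 1)) ∞ M]
  [TopologicalSpace N] [ChartedSpace (EuclideanSpace ℝ (Fin d)) N]
  [IsManifold (𝓡 d) ∞ N] (X : SpecialCollar d M N)
  {e : OpenPartialHomeomorph N (EuclideanSpace ℝ (Fin d))}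
  {L₀ L : ℕ → ℕ} {γ : ℕ → ℕ → BilinField d N} {u : EuclideanSpace ℝ (Fin d)}

theorem eventually_bdry_mem (hu : u ∈ e.target) :
    ∀ᶠ z in bdry u, z.1 ∈ e.target ∧ z.2 ∈ Set.Ioo 0 X.ε :=
  (tendsto_fst_bdry.eventually (e.open_target.mem_nhds hu)).and
    (tendsto_snd_bdry.eventually (Ioo_mem_nhdsGT X.ε_pos))

theorem isPhg_components (hexp : ∀ i j : Fin d, HasPhgExpansionOn e.target
      (fun u x => components e (X.G x) u i j) L₀ (fun k p u => components e (γ k p) u i j))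
    (hL : ∀ k, L₀ k ≤ L k) (hu : u ∈ e.target) (i j : Fin d) :
    IsPhg u L (fun z => components e (X.G z.2) z.1 i j) (formalMetric e L₀ γ i j) := by
  classical
  exact ((hexp i j).congr_coeff e.open_target
    (a' := fun k p u => if u ∈ e.target then components e (γ k p) u i j
      else if k = 0 then (1 : Matrix (Fin d) (Fin d) ℝ) i j else 0)
    fun k p u hu => if_pos hu).isPhg e.open_target hL hu

/-- Cramer's rule: determinant and adjugate are polynomials in the entries and stay in `phgAlg`, so
only the scalar determinant has to be inverted. -/
theorem isPhg_inv_components (hexp : ∀ i j : Fin d, HasPhgExpansionOn e.target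
      (fun u x => components e (X.G x) u i j) L₀ (fun k p u => components e (γ k p) u i j))
    (hL : ∀ k, L₀ k ≤ L k) (hLL : ∀ i j, L i + L j ≤ L (i + j))
    (hdet : IsUnit (formalMetric e L₀ γ).det) (hu : u ∈ e.target) (i j : Fin d) :
    IsPhg u L (fun z => (components e (X.G z.2) z.1)⁻¹ i j) ((formalMetric e L₀ γ)⁻¹ i j) := by
  let S := phgAlg u L hLL
  let m : Matrix (Fin d) (Fin d) (EuclideanSpace ℝ (Fin d) × ℝ → ℝ) :=
    Matrix.of fun i j z => components e (X.G z.2) z.1 i j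
  let Q : Matrix (Fin d) (Fin d) S :=
    Matrix.of fun i j => ⟨(m i j, formalMetric e L₀ γ i j), X.isPhg_components hexp hL hu i j⟩
  let φ₁ : S →ₐ[ℝ] (EuclideanSpace ℝ (Fin d) × ℝ → ℝ) := (AlgHom.fst ℝ _ _).comp S.val
  let φ₂ : S →ₐ[ℝ] FormalSeries (EuclideanSpace ℝ (Fin d)) := (AlgHom.snd ℝ _ _).comp S.val
  have d1 : φ₁ Q.det = m.det := AlgHom.map_det φ₁ Q
  have d2 : φ₂ Q.det = (formalMetric e L₀ γ).det := AlgHom.map_det φ₂ Q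
  have a1 : φ₁ (Q.adjugate i j) = m.adjugate i j :=
    congrArg (fun B => B i j) (RingHom.map_adjugate φ₁.toRingHom Q)
  have a2 : φ₂ (Q.adjugate i j) = (formalMetric e L₀ γ).adjugate i j :=
    congrArg (fun B => B i j) (RingHom.map_adjugate φ₂.toRingHom Q)
  have hd : IsPhg u L m.det (formalMetric e L₀ γ).det := by
    rw [← d1, ← d2]
    exact Q.det.2
  have ha : IsPhg u L (m.adjugate i j) ((formalMetric e L₀ γ).adjugate i j) := by
    rw [← a1, ← a2]
    exact (Q.adjugate i j).2
  have hmul := (hd.inv hLL (Ring.mul_inverse_cancel _ hdet)).mul hLL ha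
  rw [Matrix.inv_def, Matrix.smul_apply, smul_eq_mul]
  convert hmul using 1
  funext z
  let ρ := Pi.evalRingHom (fun _ : EuclideanSpace ℝ (Fin d) × ℝ => ℝ) z
  have r0 : ρ.mapMatrix m = components e (X.G z.2) z.1 := rfl
  have r1 : (components e (X.G z.2) z.1).det = m.det z := by
    rw [← r0]
    exact (RingHom.map_det ρ m).symm
  have r2 : (components e (X.G z.2) z.1).adjugate i j = m.adjugate i j z := by
    rw [← r0, ← RingHom.map_adjugate]
    rfl
  rw [Matrix.inv_def, Matrix.smul_apply, Ring.inverse_eq_inv', r1, r2]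
  rfl

theorem isPhg_augment {m : EuclideanSpace ℝ (Fin d) × ℝ → Matrix (Fin d) (Fin d) ℝ}
    {Γ : Matrix (Fin d) (Fin d) (FormalSeries (EuclideanSpace ℝ (Fin d)))}
    (hLL : ∀ i j, L i + L j ≤ L (i + j))
    (h : ∀ i j, IsPhg u L (fun z => m z i j) (Γ i j)) (i j : Fin (d + 1)) :
    IsPhg u L (fun z => augment (m z) i j) (augment Γ i j) := by
  refine Fin.cases ?_ (fun i => ?_) i <;> refine Fin.cases ?_ (fun j => ?_) j
  · exact (phgAlg u L hLL).one_mem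
  · exact (phgAlg u L hLL).zero_mem
  · exact (phgAlg u L hLL).zero_mem
  · exact h i j

/-- The expansion of a scalar invariant in the chart `e`. -/
def formalInvariant (e : OpenPartialHomeomorph N (EuclideanSpace ℝ (Fin d))) (L₀ : ℕ → ℕ)
    (γ : ℕ → ℕ → BilinField d N) (P : ScalarInvariant) : FormalSeries (EuclideanSpace ℝ (Fin d)) :=
  collarInvariant (fun s => formalDeriv (dirVec d s)) (formalMetric e L₀ γ)
    (formalMetric e L₀ γ)⁻¹ P

/-- The invariant is computed in the algebra of pairs (function, expansion); its projections are the
invariant in the collar frame and the formal invariant. -/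
theorem isPhg_onManifold (he : e ∈ IsManifold.maximalAtlas (𝓡 d) ∞ N)
    (hexp : ∀ i j : Fin d, HasPhgExpansionOn e.target
      (fun u x => components e (X.G x) u i j) L₀ (fun k p u => components e (γ k p) u i j))
    (hpos : ∀ (q : N) (v : TangentSpace (𝓡 d) q), v ≠ 0 → 0 < γ 0 0 q v v) (hL0 : L₀ 0 = 0)
    (hL : ∀ k, L₀ k ≤ L k) (hLL : ∀ i j, L i + L j ≤ L (i + j))
    (P : ScalarInvariant) (hu : u ∈ e.target) :
    IsPhg u L (fun z => P.onManifold X.g (X.collar (e.symm z.1, z.2)))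
      (formalInvariant e L₀ γ P) := by
  let S := phgAlg u L hLL
  have hmono : ∀ k, L k ≤ L (k + 1) := fun k => (Nat.le_add_right _ _).trans (hLL k 1)
  have hdet := isUnit_det_formalMetric (L := L₀) he hL0 hpos
  let D : Fin (d + 1) → S → S := fun s f =>
    ⟨(collarDeriv s f.1.1, formalDeriv (dirVec d s) f.1.2), IsPhg.deriv hmono f.2 (dirVec d s)⟩
  let φ₁ : S →ₐ[ℝ] (EuclideanSpace ℝ (Fin d) × ℝ → ℝ) := (AlgHom.fst ℝ _ _).comp S.val
  let φ₂ : S →ₐ[ℝ] FormalSeries (EuclideanSpace ℝ (Fin d)) := (AlgHom.snd ℝ _ _).comp S.val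
  have hG := isPhg_augment hLL (X.isPhg_components hexp hL hu)
  have hGinv : ∀ i j, IsPhg u L (fun z => (X.metricMatrix e z)⁻¹ i j)
      (augment (formalMetric e L₀ γ)⁻¹ i j) := fun i j => by
    refine (isPhg_augment hLL (X.isPhg_inv_components hexp hL hLL hdet hu) i j).congr ?_
    filter_upwards [X.eventually_bdry_mem hu] with z hz
    rw [metricMatrix, augment_inv (isUnit_iff_ne_zero.mpr
      (det_components_ne_zero he hz.1 (X.G_pos hz.2)))]
  let Gm : Matrix (Fin (d + 1)) (Fin (d + 1)) S := Matrix.of fun i j =>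
    ⟨(fun z => X.metricMatrix e z i j, augment (formalMetric e L₀ γ) i j), hG i j⟩
  let Gi : Matrix (Fin (d + 1)) (Fin (d + 1)) S := Matrix.of fun i j =>
    ⟨(fun z => (X.metricMatrix e z)⁻¹ i j, augment (formalMetric e L₀ γ)⁻¹ i j), hGinv i j⟩
  have h1 : FrameData.IsHom φ₁ (boundaryFrame D Gm Gi) (collarFrame (X.metricMatrix e)) :=
    isHom_boundaryFrame (fun _ _ => rfl) (fun _ _ => rfl) fun _ _ => rfl
  have h2 : FrameData.IsHom φ₂ (boundaryFrame D Gm Gi)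
      (boundaryFrame (fun s => formalDeriv (dirVec d s)) (augment (formalMetric e L₀ γ))
        (augment (formalMetric e L₀ γ)⁻¹)) :=
    isHom_boundaryFrame (fun _ _ => rfl) (fun _ _ => rfl) fun _ _ => rfl
  have e1 := h1.invariant P
  have e2 : φ₂ ((boundaryFrame D Gm Gi).invariant P) = formalInvariant e L₀ γ P := h2.invariant P
  have h : IsPhg u L ((collarFrame (X.metricMatrix e)).invariant P) (formalInvariant e L₀ γ P) := by
    rw [← e1, ← e2]
    exact ((boundaryFrame D Gm Gi).invariant P).2
  refine h.congr ?_
  filter_upwards [X.eventually_bdry_mem hu] with z hz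
  exact (X.onManifold_collar he P hz.1 hz.2).symm

theorem hasLogExpansion_onManifold (he : e ∈ IsManifold.maximalAtlas (𝓡 d) ∞ N)
    (hexp : ∀ i j : Fin d, HasPhgExpansionOn e.target
      (fun u x => components e (X.G x) u i j) L₀ (fun k p u => components e (γ k p) u i j))
    (hpos : ∀ (q : N) (v : TangentSpace (𝓡 d) q), v ≠ 0 → 0 < γ 0 0 q v v) (hL0 : L₀ 0 = 0)
    (hL : ∀ k, L₀ k ≤ L k) (hLL : ∀ i j, L i + L j ≤ L (i + j))
    (P : ScalarInvariant) {q : N} (hq : q ∈ e.source) :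
    HasLogExpansion (fun x => P.onManifold X.g (X.collar (q, x)))
      (coeffAt (e q) (formalInvariant e L₀ γ P)) := by
  have := (X.isPhg_onManifold he hexp hpos hL0 hL hLL P (e.map_source hq)).hasLogExpansion
  simpa only [e.left_inv hq] using this

/-- The coefficients at q are read in the preferred chart at q. In any other chart the formal
invariant has the same values there, by uniqueness of the expansion along x ↦ (q, x). -/
theorem exists_hasFunctionExpansion {n : ℕ} (hn : 1 ≤ n) (P : ScalarInvariant)
    (h : X.HasMetricExpansion n γ) :
    ∃ A : ℕ → ℕ → N → ℝ, X.HasFunctionExpansion n (P.onManifold X.g) A := by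
  obtain ⟨⟨L₀, h0, h1, hexp⟩, hpos⟩ := h
  obtain ⟨L, hL0, hL1, hL, hLL⟩ := exists_superadditive n hn L₀ h0 h1
  let κ : N → OpenPartialHomeomorph N (EuclideanSpace ℝ (Fin d)) := fun q => chartAt _ q
  have hκ : ∀ q, κ q ∈ IsManifold.maximalAtlas (𝓡 d) ∞ N := IsManifold.chart_mem_maximalAtlas
  refine ⟨fun k p q => (coeffAt (κ q q) (formalInvariant (κ q) L₀ γ P) k).coeff p, L, hL0, hL1,
    fun e he => ?_⟩
  refine hasPhgExpansionOn_of_isPhg e.open_target (A := formalInvariant e L₀ γ P)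
    (fun k p _ u hu => ?_) fun u hu =>
      X.isPhg_onManifold he (hexp e he) hpos (h0 0 hn) hL hLL P hu
  have h1 := X.hasLogExpansion_onManifold (hκ (e.symm u)) (hexp _ (hκ (e.symm u))) hpos (h0 0 hn)
    hL hLL P (mem_chart_source _ (e.symm u))
  have h2 := X.hasLogExpansion_onManifold he (hexp e he) hpos (h0 0 hn) hL hLL P (e.map_target hu)
  rw [e.right_inv hu] at h2
  rw [← coeff_coeffAt, ← h1.unique h2 EventuallyEq.rfl k]

end SpecialCollar

/-! ### Dependence of the invariants on the traces -/

section ChartAt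

variable {d : ℕ} {N : Type*} [TopologicalSpace N] [ChartedSpace (EuclideanSpace ℝ (Fin d)) N]
  [IsManifold (𝓡 d) ∞ N]

/-- The tangent space at q is identified with the model space by the preferred chart, so `traceWith`
is the trace of the components in that chart. -/
theorem coordVec_chartAt (q : N) (i : Fin d) :
    (coordVec (chartAt (EuclideanSpace ℝ (Fin d)) q) i (chartAt (EuclideanSpace ℝ (Fin d)) q q) :
      EuclideanSpace ℝ (Fin d)) = EuclideanSpace.single i 1 := by
  set e := chartAt (EuclideanSpace ℝ (Fin d)) q with he
  have hq : q ∈ e.source := mem_chart_source _ q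
  have hm : e ∈ IsManifold.maximalAtlas (𝓡 d) ∞ N := IsManifold.chart_mem_maximalAtlas q
  have hd : MDifferentiableAt 𝓘(ℝ, EuclideanSpace ℝ (Fin d)) (𝓡 d) e.symm (e q) :=
    (contMDiffAt_symm_of_mem_maximalAtlas hm (e.map_source hq)).mdifferentiableAt (by simp)
  have h1 : mfderiv 𝓘(ℝ, EuclideanSpace ℝ (Fin d)) (𝓡 d) e.symm (e q)
      = (ContinuousLinearMap.id ℝ (EuclideanSpace ℝ (Fin d))) := by
    have h2 : writtenInExtChartAt 𝓘(ℝ, EuclideanSpace ℝ (Fin d)) (𝓡 d) (e q) e.symm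
        =ᶠ[𝓝 (e q)] id := by
      filter_upwards [e.open_target.mem_nhds (e.map_source hq)] with y hy
      simp only [writtenInExtChartAt, e.left_inv hq, extChartAt, mfld_simps]
      exact e.right_inv hy
    have h3 := h2.fderiv_eq (𝕜 := ℝ)
    rw [fderiv_id] at h3
    refine hd.mfderiv.trans ?_
    change fderivWithin ℝ _ (Set.range id) (e q) = _
    rw [Set.range_id, fderivWithin_univ]
    exact h3
  exact congrArg (fun l : EuclideanSpace ℝ (Fin d) →L[ℝ] EuclideanSpace ℝ (Fin d) =>
    l (EuclideanSpace.single i 1)) h1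

theorem components_chartAt (B : BilinField d N) (q : N) :
    components (chartAt (EuclideanSpace ℝ (Fin d)) q) B (chartAt (EuclideanSpace ℝ (Fin d)) q q)
      = Matrix.of fun i j => B q (show EuclideanSpace ℝ (Fin d) from EuclideanSpace.single i 1)
        (show EuclideanSpace ℝ (Fin d) from EuclideanSpace.single j 1) := by
  let b : N → EuclideanSpace ℝ (Fin d) → EuclideanSpace ℝ (Fin d) → ℝ := fun q v w => B q v w
  refine Matrix.ext fun i j => ?_
  refine (congrArg₂ (b _) (coordVec_chartAt q i) (coordVec_chartAt q j)).trans ?_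
  rw [(chartAt (EuclideanSpace ℝ (Fin d)) q).left_inv (mem_chart_source _ q)]
  rfl

theorem traceWith_eq (B₀ B : BilinField d N) (q : N) : traceWith B₀ B q
    = Matrix.trace ((components (chartAt (EuclideanSpace ℝ (Fin d)) q) B₀
        (chartAt (EuclideanSpace ℝ (Fin d)) q q))⁻¹ *
      components (chartAt (EuclideanSpace ℝ (Fin d)) q) B
        (chartAt (EuclideanSpace ℝ (Fin d)) q q)) := by
  rw [components_chartAt, components_chartAt]
  rfl

end ChartAt

section Coefficients

variable {d n : ℕ} {N : Type*} [TopologicalSpace N] [ChartedSpace (EuclideanSpace ℝ (Fin d)) N]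
  [IsManifold (𝓡 d) ∞ N] {e : OpenPartialHomeomorph N (EuclideanSpace ℝ (Fin d))}
  {L₀ L₀' : ℕ → ℕ} {γ γ' : ℕ → ℕ → BilinField d N} {u : EuclideanSpace ℝ (Fin d)}

theorem dotProduct_components_mulVec_pos (he : e ∈ IsManifold.maximalAtlas (𝓡 d) ∞ N)
    {B : BilinField d N} (hu : u ∈ e.target)
    (hB : ∀ v : TangentSpace (𝓡 d) (e.symm u), v ≠ 0 → 0 < B (e.symm u) v v) {v : Fin d → ℝ}
    (hv : v ≠ 0) : 0 < v ⬝ᵥ (components e B u).mulVec v := by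
  have h1 := components_apply_sum (e := e) B u (WithLp.toLp 2 v) (WithLp.toLp 2 v)
  have h2 : v ⬝ᵥ (components e B u).mulVec v
      = ∑ s, ∑ t, v s * v t * components e B u s t := by
    simp only [dotProduct, Matrix.mulVec, Finset.mul_sum]
    exact Finset.sum_congr rfl fun _ _ => Finset.sum_congr rfl fun _ _ => by ring
  rw [h2]
  refine lt_of_lt_of_eq (hB _ fun h3 => hv ?_) h1.symm
  have := mfderiv_chart_symm_injective he hu (h3.trans (map_zero _).symm)
  exact funext fun i => congrFun (congrArg WithLp.ofLp this) i

/-- The input of `agree_collarInvariant`. Below order n there are no logarithms, so agreement of the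
coefficients `γ k 0` suffices. -/
theorem agree_formalMetric (hn : 1 ≤ n) (hL : ∀ k < n, L₀ k = 0) (hLn : L₀ n = 1)
    (hL' : ∀ k < n, L₀' k = 0) (hLn' : L₀' n = 1)
    (hu : u ∈ e.target) (h : ∀ k < n, ∀ᶠ y in 𝓝 (e.symm u), γ k 0 y = γ' k 0 y) (i j : Fin d) :
    Agree n u (formalMetric e L₀ γ i j) (formalMetric e L₀' γ' i j)
      (modelMetric (components e (γ 0 0) u) (Matrix.of fun i j =>
        ((components e (γ n 0) u - components e (γ' n 0) u) i j,
          (components e (γ n 1) u - components e (γ' n 1) u) i j)) i j) where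
  below := by
    have h1 : ∀ᶠ y in 𝓝 (e.symm u), ∀ k < n, γ k 0 y = γ' k 0 y := by
      have := (Set.finite_Iio n).eventually_all.2 h
      simpa using this
    filter_upwards [(e.continuousAt_symm hu).eventually h1, e.open_target.mem_nhds hu] with v hv hvt
    rw [PowerSeries.X_pow_dvd_iff]
    intro k hk
    rw [map_sub, sub_eq_zero, coeff_evalAt, coeff_evalAt]
    refine Polynomial.ext fun p => ?_
    rw [coeffAt_formalMetric hvt, coeffAt_formalMetric hvt, hL k hk, hL' k hk]
    split_ifs with hp
    · obtain rfl : p = 0 := by omega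
      simp only [components, Matrix.of_apply, hv k hk]
    · rfl
  zero := by
    refine Polynomial.ext fun p => ?_
    rw [coeff_evalAt, coeffAt_formalMetric hu, hL 0 hn, Polynomial.coeff_C]
    rcases p with _ | p <;> simp [modelMetric]
  top := by
    refine Polynomial.ext fun p => ?_
    rw [coeff_evalAt, coeff_evalAt, Polynomial.coeff_sub, coeffAt_formalMetric hu,
      coeffAt_formalMetric hu, hLn, hLn', Polynomial.coeff_add, Polynomial.coeff_C,
      Polynomial.coeff_C_mul, Polynomial.coeff_X]
    rcases p with _ | _ | p <;> simp [modelMetric]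

end Coefficients

namespace SpecialCollar

variable {d n : ℕ} {M N : Type*}
  [TopologicalSpace M] [ChartedSpace (EuclideanSpace ℝ (Fin (d + 1))) M]
  [IsManifold (𝓡 (d + 1)) ∞ M]
  [TopologicalSpace N] [ChartedSpace (EuclideanSpace ℝ (Fin d)) N]
  [IsManifold (𝓡 d) ∞ N] (X : SpecialCollar d M N)
  {e : OpenPartialHomeomorph N (EuclideanSpace ℝ (Fin d))}
  {L₀ : ℕ → ℕ} {γ : ℕ → ℕ → BilinField d N} {u : EuclideanSpace ℝ (Fin d)}

/-- The coefficients are not assumed symmetric: they inherit symmetry from G_x by uniqueness. The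
diagonalization relies on it. -/
theorem components_transpose (hexp : ∀ i j : Fin d, HasPhgExpansionOn e.target
      (fun u x => components e (X.G x) u i j) L₀ (fun k p u => components e (γ k p) u i j))
    (hu : u ∈ e.target) {k p : ℕ} (hp : p ≤ L₀ k) :
    (components e (γ k p) u).transpose = components e (γ k p) u := by
  refine Matrix.ext fun i j => ?_
  have h1 := fun i j => (X.isPhg_components hexp (fun _ => le_rfl) hu i j).hasLogExpansion
  have h2 := congrArg (fun a => a.coeff p) ((h1 j i).unique (h1 i j) (by
    filter_upwards [Ioo_mem_nhdsGT X.ε_pos] with t ht using X.G_symm ht _ _) k)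
  simp only [coeffAt_formalMetric hu, if_pos hp] at h2
  exact h2

theorem coeff_eq_of_hasFunctionExpansion {P : ScalarInvariant} {A : ℕ → ℕ → N → ℝ}
    (hA : X.HasFunctionExpansion n (P.onManifold X.g) A)
    (he : e ∈ IsManifold.maximalAtlas (𝓡 d) ∞ N) {F : FormalSeries (EuclideanSpace ℝ (Fin d))}
    {q : N} (hq : q ∈ e.source)
    (hF : HasLogExpansion (fun x => P.onManifold X.g (X.collar (q, x))) (coeffAt (e q) F))
    {p : ℕ} (hp : p ≤ 1) : A n p q = (coeffAt (e q) F n).coeff p := by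
  obtain ⟨L, -, hLn, h⟩ := hA
  have h1 := ((h e he).isPhg e.open_target (fun _ => le_rfl) (e.map_source hq)).hasLogExpansion
  simp only [e.left_inv hq] at h1
  rw [← h1.unique hF EventuallyEq.rfl n, coeff_coeffAt, coeff_ofCoeffs, hLn, if_pos hp,
    e.left_inv hq]

variable {M' : Type*} [TopologicalSpace M'] [ChartedSpace (EuclideanSpace ℝ (Fin (d + 1))) M']
  [IsManifold (𝓡 (d + 1)) ∞ M'] (X' : SpecialCollar d M' N) {γ' : ℕ → ℕ → BilinField d N}

/-- The differences of the order-n coefficients are trace-free at q, so their variation vanishes and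
the formal invariants agree at order n there; uniqueness transfers this to the given expansions. -/
theorem coeff_eq_of_traceWith_eq (hn : 1 ≤ n) (P : ScalarInvariant) {A A' : ℕ → ℕ → N → ℝ}
    (h : X.HasMetricExpansion n γ) (h' : X'.HasMetricExpansion n γ')
    (hA : X.HasFunctionExpansion n (P.onManifold X.g) A)
    (hA' : X'.HasFunctionExpansion n (P.onManifold X'.g) A') {q : N}
    (hbelow : ∀ k < n, ∀ᶠ y in 𝓝 q, γ k 0 y = γ' k 0 y)
    (htr₀ : traceWith (γ 0 0) (γ n 0) q = traceWith (γ 0 0) (γ' n 0) q)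
    (htr₁ : traceWith (γ 0 0) (γ n 1) q = traceWith (γ 0 0) (γ' n 1) q) {p : ℕ} (hp : p ≤ 1) :
    A n p q = A' n p q := by
  obtain ⟨⟨L₀, hL, hLn, hexp⟩, hpos⟩ := h
  obtain ⟨⟨L₀', hL', hLn', hexp'⟩, hpos'⟩ := h'
  obtain ⟨L, -, -, hLL₀, hLL⟩ := exists_superadditive n hn L₀ hL hLn
  obtain ⟨L', -, -, hLL₀', hLL'⟩ := exists_superadditive n hn L₀' hL' hLn'
  rw [traceWith_eq, traceWith_eq] at htr₀ htr₁
  set e := chartAt (EuclideanSpace ℝ (Fin d)) q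
  have he : e ∈ IsManifold.maximalAtlas (𝓡 d) ∞ N := IsManifold.chart_mem_maximalAtlas q
  have hq : q ∈ e.source := mem_chart_source _ q
  have hu : e q ∈ e.target := e.map_source hq
  rw [X.coeff_eq_of_hasFunctionExpansion hA he hq (X.hasLogExpansion_onManifold he (hexp e he) hpos
      (hL 0 hn) hLL₀ hLL P hq) hp,
    X'.coeff_eq_of_hasFunctionExpansion hA' he hq (X'.hasLogExpansion_onManifold he (hexp' e he)
      hpos' (hL' 0 hn) hLL₀' hLL' P hq) hp]
  have hγs := X.components_transpose (hexp e he) hu (Nat.zero_le (L₀ 0))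
  have hγpos : ∀ v, v ≠ 0 → 0 < v ⬝ᵥ (components e (γ 0 0) (e q)).mulVec v := fun v hv =>
    dotProduct_components_mulVec_pos he hu (hpos _) hv
  have hsub : ∀ p ≤ 1, (components e (γ n p) (e q) - components e (γ' n p) (e q)).transpose
      = components e (γ n p) (e q) - components e (γ' n p) (e q) := fun p hp => by
    rw [Matrix.transpose_sub, X.components_transpose (hexp e he) hu (hLn ▸ hp),
      X'.components_transpose (hexp' e he) hu (hLn' ▸ hp)]
  have hag := agree_collarInvariant hn (isUnit_det_formalMetric he (hL 0 hn) hpos)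
    (isUnit_det_formalMetric he (hL' 0 hn) hpos')
    (isUnit_det_modelMetric (isUnit_iff_ne_zero.mpr (det_components_ne_zero he hu (hpos _))) _)
    (agree_formalMetric hn hL hLn hL' hLn' hu (by rwa [e.left_inv hq])) P
  have htop := hag.top
  have hvar := variation_eq_zero (Agree.indicial n) P hγs hγpos (hsub 0 (by omega)) (hsub 1 le_rfl)
    (by rw [Matrix.mul_sub, Matrix.trace_sub, htr₀, sub_self])
    (by rw [Matrix.mul_sub, Matrix.trace_sub, htr₁, sub_self])
  rw [variation] at hvar
  rw [hvar, coeff_evalAt, coeff_evalAt] at htop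
  simp only [Prod.fst_zero, Prod.snd_zero, map_zero, zero_mul, add_zero] at htop
  exact congrArg (fun a => a.coeff p) (sub_eq_zero.mp htop)

end SpecialCollar

end AH

end

theorem mainTheorem10 (d n : ℕ) (hn : 1 ≤ n) (P : AH.ScalarInvariant)
    (N : Type*) [TopologicalSpace N] [T2Space N] [CompactSpace N]
    [ChartedSpace (EuclideanSpace ℝ (Fin d)) N] [IsManifold (𝓡 d) ∞ N] :
    (∀ (M : Type*) [TopologicalSpace M] [T2Space M]
        [ChartedSpace (EuclideanSpace ℝ (Fin (d + 1))) M] [IsManifold (𝓡 (d + 1)) ∞ M]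
        (X : AH.SpecialCollar d M N) (γ : ℕ → ℕ → AH.BilinField d N),
        X.HasMetricExpansion n γ →
        ∃ A : ℕ → ℕ → N → ℝ, X.HasFunctionExpansion n (P.onManifold X.g) A) ∧
    (∀ (M : Type*) [TopologicalSpace M] [T2Space M]
        [ChartedSpace (EuclideanSpace ℝ (Fin (d + 1))) M] [IsManifold (𝓡 (d + 1)) ∞ M]
        (M' : Type*) [TopologicalSpace M'] [T2Space M']
        [ChartedSpace (EuclideanSpace ℝ (Fin (d + 1))) M'] [IsManifold (𝓡 (d + 1)) ∞ M']
        (X : AH.SpecialCollar d M N) (γ : ℕ → ℕ → AH.BilinField d N) (A : ℕ → ℕ → N → ℝ)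
        (X' : AH.SpecialCollar d M' N) (γ' : ℕ → ℕ → AH.BilinField d N) (A' : ℕ → ℕ → N → ℝ),
        X.HasMetricExpansion n γ → X'.HasMetricExpansion n γ' →
        X.HasFunctionExpansion n (P.onManifold X.g) A →
        X'.HasFunctionExpansion n (P.onManifold X'.g) A' →
        ∀ q : N,
          (∀ k < n, ∀ᶠ y in 𝓝 q, γ k 0 y = γ' k 0 y) →
          AH.traceWith (γ 0 0) (γ n 0) q = AH.traceWith (γ 0 0) (γ' n 0) q →
          AH.traceWith (γ 0 0) (γ n 1) q = AH.traceWith (γ 0 0) (γ' n 1) q →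
          A n 0 q = A' n 0 q ∧ A n 1 q = A' n 1 q) := by
  refine ⟨fun M _ _ _ _ X γ h => X.exists_hasFunctionExpansion hn P h, ?_⟩
  intro M _ _ _ _ M' _ _ _ _ X γ A X' γ' A' h h' hA hA' q hbelow htr₀ htr₁
  exact ⟨X.coeff_eq_of_traceWith_eq X' hn P h h' hA hA' hbelow htr₀ htr₁ zero_le_one,
    X.coeff_eq_of_traceWith_eq X' hn P h h' hA hA' hbelow htr₀ htr₁ le_rfl⟩
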